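/- **Categories.** Let $\mathbf{FinSet}$ be (a small version of) the category of finite sets and functions. For a category $\mathcal C$, let $\mathcal C^{+}$ be its free finite coproduct completion: objects are finite families $\{X_a\}_{a\in A}$ of objects of $\mathcal C$; a morphism $\{X_a\}_{a\in A}\to\{Y_b\}_{b\in B}$ is a function $\varphi:A\to B$ with morphisms $X_a\to Y_{\varphi(a)}$. If $\mathcal C$ is symmetric monoidal, so is $\mathcal C^{+}$, with $\{X_a\}_a\otimes\{Y_b\}_b=\{X_a\otimes Y_b\}_{(a,b)}$. Let $\mathcal K$ be the discrete category of finite-dimensional Hilbert spaces, without loss of generality the spaces $\mathbb C^X$ for $X\in\mathbf{FinSet}$. The free affine symmetric monoidal category $Fwm(\mathcal K)$ has finite sequences $(V_1,\dots,V_n)$ as objects; a morphism $(V_1,\dots,V_n)\to(W_1,\dots,W_m)$ is an injection $f:\{1,\dots,m\}\to\{1,\dots,n\}$ with $V_{f(i)}=W_i$; the tensor product is concatenation. Put $\mathbf Q''=Fwm(\mathcal K)^{+}$. Write $L(V)$ for the linear operators on $V$. A linear map $F:L(V)\to L(W)$ is completely positive if $F(\rho)=\sum_iK_i\rho K_i^{\dagger}$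 for finitely many $K_i:V\to W$. Objects of $\mathbf Q$ are finite families $(V_j)_j$ of finite-dimensional Hilbert spaces; a morphism $(V_j)_j\to(W_i)_i$ is a matrix of completely positive maps $F_{ij}:L(V_j)\to L(W_i)$ with $\sum_i\operatorname{tr}F_{ij}(\rho)\le\operatorname{tr}\rho$ for all $j$ and all positive $\rho\in L(V_j)$. Composition is matrix multiplication. $\mathbf Q$ is symmetric monoidal by $(V_j)_j\otimes(W_k)_k=(V_j\otimes W_k)_{(j,k)}$, $(F\otimes G)_{(i,i'),(j,j')}=F_{ij}\otimes G_{i'j'}$; the concatenation $\oplus$ of families is its coproduct. **Functors.** $\Phi:\mathbf{FinSet}\to\mathbf Q''$ sends $A$ to $\{I\}_{a\in A}$, with $I$ the empty sequence. $\Psi:\mathbf Q''\to\mathbf Q$ sends $\{(V^a_1,\dots,V^a_{n_a})\}_{a}$ to $(V^a_1\otimes\cdots\otimes V^a_{n_a})_{a}$; a morphism $(\varphi,(f_a)_a)$ goes to the matrix whose entry at $(\varphi(a),a)$ is the superoperator that traces out the tensor factors not in the image of $f_a$ and permutes the others according to $f_a$, all other entries being $0$. **Adjunctions.** Categories of presheaves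 on small symmetric monoidal categories carry the Day convolution tensor product (on $[\mathbf{FinSet}^{op},\mathbf{Set}]$, with $\times$ on $\mathbf{FinSet}$, this is the cartesian product). Let $\Gamma$ be the class of finite product cones in $\mathbf Q^{op}$, and let $[\mathbf Q^{op},\mathbf{Set}]_\Gamma\subseteq[\mathbf Q^{op},\mathbf{Set}]$ be the full subcategory of the presheaves that preserve finite products. Consider $$[\mathbf{FinSet}^{op},\mathbf{Set}]\;\underset{\Phi^*}{\overset{\mathrm{Lan}_\Phi}{\rightleftarrows}}\;[\mathbf Q''^{op},\mathbf{Set}]\;\underset{G}{\overset{F}{\rightleftarrows}}\;[\mathbf Q^{op},\mathbf{Set}]_\Gamma ,$$ where $\Phi^*$, $\Psi^*$ are precomposition, $F$ is $\mathrm{Lan}_\Psi$ followed by a left adjoint $R$ of the inclusion, and $G$ is the inclusion followed by $\Psi^*$. **Theorem.** The reflection $R$ exists, and there are a symmetric monoidal structure on $[\mathbf Q^{op},\mathbf{Set}]_\Gamma$ and strong symmetric monoidal structures on $R$, $\mathrm{Lan}_\Phi$ and $\mathrm{Lan}_\Psi$ such that $\mathcal C=[\mathbf Q''^{op},\mathbf{Set}]$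 and $[\mathbf Q^{op},\mathbf{Set}]_\Gamma$ are monoidal closed, and such that the two adjunctions form a *concrete model of the quantum lambda calculus*. That is, for the induced symmetric monoidal comonad $!=\mathrm{Lan}_\Phi\circ\Phi^*$ and symmetric monoidal monad $T=G\circ F$ on $\mathcal C$: 1. $!$ is a linear exponential comonad: there are maps $d_A:{!A}\to{!A}\otimes{!A}$ and $e_A:{!A}\to I$, forming commutative comonoids, which are monoidal natural transformations and morphisms of $!$-coalgebras, and each $\delta_A:{!A}\to{!!A}$ is a morphism of comonoids; 2. $!$ is idempotent ($\delta$ is invertible) and strongly monoidal (the maps $I\to{!I}$ and ${!A}\otimes{!B}\to{!(A\otimes B)}$ are invertible); 3. $T$ is a strong monad, with the strength $A\otimes TB\xrightarrow{\eta\otimes 1}TA\otimes TB\to T(A\otimes B)$; 4. $\mathcal C$ has Kleisli exponentials: a functor $[-,-]_k:\mathcal C^{op}\times\mathcal C\to\mathcal C$ and bijections $\mathcal C(A\otimes B,TX)\cong\mathcal C(A,[B,X]_k)$, natural in $A,B,X$; 5. the tensor unit of $\mathcal C$ is terminal; 6. $\mathcal C$ has finite coproducts, and $!$ preserves them; 7.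 there is a full and faithful functor $\mathbf Q\to\mathcal C_T$ into the Kleisli category of $T$ that is strong symmetric monoidal for $\otimes$ and preserves finite coproducts $\oplus$, where $\mathcal C_T$ has the tensor product induced by that of $\mathcal C$ and the monoidal monad $T$. -/

import Mathlib

open CategoryTheory MonoidalCategory Limits Opposite

set_option linter.unusedSectionVars false
set_option linter.unusedVariables false
universe v u v' u'

/-- A symmetric monoidal monad: the functor is lax symmetric monoidal, and the unit and the
multiplication are monoidal natural transformations. -/
class SymmetricMonoidalMonad {C : Type u} [Category.{v} C] [MonoidalCategory C]
    [SymmetricCategory C] (T : Monad C) extends T.toFunctor.LaxBraided where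
  η_isMonoidal : NatTrans.IsMonoidal T.η
  μ_isMonoidal : NatTrans.IsMonoidal T.μ

/-- A symmetric monoidal comonad `(!, δ, ε, m)`: the functor is lax symmetric monoidal (with
structure maps `m`), and `δ`, `ε` are monoidal natural transformations. -/
class SymmetricMonoidalComonad {C : Type u} [Category.{v} C] [MonoidalCategory C]
    [SymmetricCategory C] (W : Comonad C) extends W.toFunctor.LaxBraided where
  ε_isMonoidal : NatTrans.IsMonoidal W.ε
  δ_isMonoidal : NatTrans.IsMonoidal W.δ

/-! ## The symmetric monoidal structure on the Kleisli category of a symmetric monoidal monad -/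

namespace KleisliTensor
open Functor.LaxMonoidal
variable {C : Type u} [Category.{v} C] [MonoidalCategory C] [SymmetricCategory C]
  (T : Monad C) [SymmetricMonoidalMonad T]

lemma η_tensor (X Y : C) : (T.η.app X ⊗ₘ T.η.app Y) ≫ μ T.toFunctor X Y = T.η.app (X ⊗ Y) := by
  have := SymmetricMonoidalMonad.η_isMonoidal (T := T)
  simpa using (NatTrans.IsMonoidal.tensor (τ := T.η) X Y).symm

lemma η_unit : ε T.toFunctor = T.η.app (𝟙_ C) := by
  have := SymmetricMonoidalMonad.η_isMonoidal (T := T)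
  simpa using (NatTrans.IsMonoidal.unit (τ := T.η)).symm

lemma μ_tensor (X Y : C) : (T.μ.app X ⊗ₘ T.μ.app Y) ≫ μ T.toFunctor X Y =
    μ T.toFunctor (T.obj X) (T.obj Y) ≫ T.map (μ T.toFunctor X Y) ≫ T.μ.app (X ⊗ Y) := by
  have := SymmetricMonoidalMonad.μ_isMonoidal (T := T)
  simpa using (NatTrans.IsMonoidal.tensor (τ := T.μ) X Y).symm

/-- The image of a morphism of `C` in the Kleisli category. -/
def pure {X Y : C} (f : X ⟶ Y) : Kleisli.mk T X ⟶ Kleisli.mk T Y :=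
  (Kleisli.Adjunction.toKleisli T).map f

/-- The image of an isomorphism of `C` in the Kleisli category. -/
def pureIso {X Y : C} (e : X ≅ Y) : Kleisli.mk T X ≅ Kleisli.mk T Y :=
  (Kleisli.Adjunction.toKleisli T).mapIso e

lemma pure_of {X Y : C} (f : X ⟶ Y) : (pure T f).of = f ≫ T.η.app Y := rfl
lemma pureIso_hom {X Y : C} (e : X ≅ Y) : (pureIso T e).hom = pure T e.hom := rfl
lemma pure_comp {X Y Z : C} (f : X ⟶ Y) (g : Y ⟶ Z) : pure T f ≫ pure T g = pure T (f ≫ g) :=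
  ((Kleisli.Adjunction.toKleisli T).map_comp f g).symm
lemma pure_id (X : C) : pure T (𝟙 X) = 𝟙 (Kleisli.mk T X) :=
  (Kleisli.Adjunction.toKleisli T).map_id X

lemma comp_of {X Y Z : Kleisli T} (f : X ⟶ Y) (g : Y ⟶ Z) :
    (f ≫ g).of = f.of ≫ T.map g.of ≫ T.μ.app Z.of := rfl

lemma pure_comp_of {X Y : C} {Z : Kleisli T} (f : X ⟶ Y) (g : Kleisli.mk T Y ⟶ Z) :
    (pure T f ≫ g).of = f ≫ g.of := by
  have h : g.of ≫ T.η.app (T.obj Z.of) = T.η.app Y ≫ T.map g.of := T.η.naturality g.of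
  have h2 : T.η.app (T.obj Z.of) ≫ T.μ.app Z.of = 𝟙 _ := T.left_unit Z.of
  rw [comp_of, pure_of, Category.assoc, ← reassoc_of% h, h2]
  erw [Category.comp_id]

lemma comp_pure_of {X : Kleisli T} {Y Z : C} (f : X ⟶ Kleisli.mk T Y) (g : Y ⟶ Z) :
    (f ≫ pure T g).of = f.of ≫ T.map g := by
  rw [comp_of, pure_of, Functor.map_comp, Category.assoc, T.right_unit]
  erw [Category.comp_id]

/-- On objects the tensor product is that of `C`; the tensor product of `f : X ⟶ T X'` and
`g : Y ⟶ T Y'` is `X ⊗ Y ⟶ T X' ⊗ T Y' ⟶ T (X' ⊗ Y')`. -/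
instance : MonoidalCategoryStruct (Kleisli T) where
  tensorObj X Y := .mk T (X.of ⊗ Y.of)
  tensorUnit := .mk T (𝟙_ C)
  tensorHom f g := .mk ((f.of ⊗ₘ g.of) ≫ μ T.toFunctor _ _)
  whiskerLeft X {_ _} g := .mk ((T.η.app X.of ⊗ₘ g.of) ≫ μ T.toFunctor _ _)
  whiskerRight f Y := .mk ((f.of ⊗ₘ T.η.app Y.of) ≫ μ T.toFunctor _ _)
  associator X Y Z := pureIso T (α_ X.of Y.of Z.of)
  leftUnitor X := pureIso T (λ_ X.of)
  rightUnitor X := pureIso T (ρ_ X.of)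

lemma pure_whiskerRight {X Y : C} (f : X ⟶ Y) (Z : C) :
    pure T f ▷ Kleisli.mk T Z = pure T (f ▷ Z) := by
  ext
  change ((f ≫ T.η.app Y) ⊗ₘ T.η.app Z) ≫ μ T.toFunctor _ _ = f ▷ Z ≫ T.η.app (Y ⊗ Z)
  rw [← η_tensor, ← tensorHom_id, tensorHom_comp_tensorHom_assoc, Category.id_comp]

lemma whiskerLeft_pure {X Y : C} (Z : C) (f : X ⟶ Y) :
    Kleisli.mk T Z ◁ pure T f = pure T (Z ◁ f) := by
  ext
  change (T.η.app Z ⊗ₘ (f ≫ T.η.app Y)) ≫ μ T.toFunctor _ _ = Z ◁ f ≫ T.η.app (Z ⊗ Y)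
  rw [← η_tensor, ← id_tensorHom, tensorHom_comp_tensorHom_assoc, Category.id_comp]

lemma comp_tensor {X Y Z X' Y' Z' : C} (f : X ⟶ T.obj Y) (g : Y ⟶ T.obj Z)
    (f' : X' ⟶ T.obj Y') (g' : Y' ⟶ T.obj Z') :
    ((f ⊗ₘ f') ≫ μ T.toFunctor _ _) ≫ T.map ((g ⊗ₘ g') ≫ μ T.toFunctor _ _) ≫ T.μ.app _ =
    ((f ≫ T.map g ≫ T.μ.app _) ⊗ₘ (f' ≫ T.map g' ≫ T.μ.app _)) ≫ μ T.toFunctor _ _ := by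
  rw [Functor.map_comp]
  simp only [Category.assoc]
  rw [← Functor.LaxMonoidal.μ_natural_assoc, ← μ_tensor]
  simp only [← tensorHom_comp_tensorHom, Category.assoc]

lemma assoc_nat {X X' Y Y' Z Z' : C} (f : X ⟶ T.obj X') (g : Y ⟶ T.obj Y') (h : Z ⟶ T.obj Z') :
    ((((f ⊗ₘ g) ≫ μ T.toFunctor _ _) ⊗ₘ h) ≫ μ T.toFunctor _ _) ≫ T.map (α_ _ _ _).hom =
      (α_ _ _ _).hom ≫ (f ⊗ₘ ((g ⊗ₘ h) ≫ μ T.toFunctor _ _)) ≫ μ T.toFunctor _ _ := by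
  have e1 : ((f ⊗ₘ g) ≫ μ T.toFunctor _ _) ⊗ₘ h =
      ((f ⊗ₘ g) ⊗ₘ h) ≫ (μ T.toFunctor _ _ ▷ T.obj Z') := by
    rw [← tensorHom_id, tensorHom_comp_tensorHom, Category.comp_id]
  have e2 : f ⊗ₘ ((g ⊗ₘ h) ≫ μ T.toFunctor _ _) =
      (f ⊗ₘ (g ⊗ₘ h)) ≫ (T.obj X' ◁ μ T.toFunctor _ _) := by
    rw [← id_tensorHom, tensorHom_comp_tensorHom, Category.comp_id]
  rw [e1, e2, Category.assoc, Category.assoc, Category.assoc, Functor.LaxMonoidal.associativity,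
    associator_naturality_assoc]

lemma left_nat {X Y : C} (f : X ⟶ T.obj Y) :
    ((T.η.app (𝟙_ C) ⊗ₘ f) ≫ μ T.toFunctor _ _) ≫ T.map (λ_ _).hom = (λ_ _).hom ≫ f := by
  rw [← η_unit, tensorHom_def', Category.assoc, Category.assoc,
    ← Functor.LaxMonoidal.left_unitality]
  exact leftUnitor_naturality f

lemma right_nat {X Y : C} (f : X ⟶ T.obj Y) :
    ((f ⊗ₘ T.η.app (𝟙_ C)) ≫ μ T.toFunctor _ _) ≫ T.map (ρ_ _).hom = (ρ_ _).hom ≫ f := by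
  rw [← η_unit, MonoidalCategory.tensorHom_def, Category.assoc, Category.assoc,
    ← Functor.LaxMonoidal.right_unitality]
  exact rightUnitor_naturality f

lemma braid_nat {X X' Y Y' : C} (f : X ⟶ T.obj X') (g : Y ⟶ T.obj Y') :
    ((f ⊗ₘ g) ≫ μ T.toFunctor _ _) ≫ T.map (β_ _ _).hom =
      (β_ _ _).hom ≫ (g ⊗ₘ f) ≫ μ T.toFunctor _ _ := by
  rw [Category.assoc, Functor.LaxBraided.braided, BraidedCategory.braiding_naturality_assoc]

instance : MonoidalCategory (Kleisli T) := .ofTensorHom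
  (id_tensorHom_id := by
    intros; ext; exact η_tensor T _ _)
  (id_tensorHom := by intros; rfl)
  (tensorHom_id := by intros; rfl)
  (tensorHom_comp_tensorHom := by
    intros; ext; exact comp_tensor T _ _ _ _)
  (associator_naturality := by
    intros; ext
    erw [pureIso_hom, pureIso_hom, pure_comp_of, comp_pure_of]
    exact assoc_nat T _ _ _)
  (leftUnitor_naturality := by
    intros; ext
    erw [pureIso_hom, pureIso_hom, pure_comp_of, comp_pure_of]
    exact left_nat T _)
  (rightUnitor_naturality := by
    intros; ext
    erw [pureIso_hom, pureIso_hom, pure_comp_of, comp_pure_of]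
    exact right_nat T _)
  (pentagon := by
    intro W X Y Z
    change pure T (α_ _ _ _).hom ▷ Kleisli.mk T Z.of ≫ pure T (α_ _ _ _).hom ≫
      Kleisli.mk T W.of ◁ pure T (α_ _ _ _).hom = pure T (α_ _ _ _).hom ≫ pure T (α_ _ _ _).hom
    rw [pure_whiskerRight, whiskerLeft_pure]
    erw [pure_comp, pure_comp, pure_comp]
    rw [MonoidalCategory.pentagon])
  (triangle := by
    intro X Y
    change pure T (α_ _ _ _).hom ≫ Kleisli.mk T X.of ◁ pure T (λ_ _).hom =
      pure T (ρ_ _).hom ▷ Kleisli.mk T Y.of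
    rw [pure_whiskerRight, whiskerLeft_pure]
    erw [pure_comp]
    rw [MonoidalCategory.triangle])

instance : SymmetricCategory (Kleisli T) where
  braiding X Y := pureIso T (β_ X.of Y.of)
  braiding_naturality_right X Y Z f := by
    ext
    erw [pureIso_hom, pureIso_hom, pure_comp_of, comp_pure_of]
    exact braid_nat T _ _
  braiding_naturality_left f Z := by
    ext
    erw [pureIso_hom, pureIso_hom, pure_comp_of, comp_pure_of]
    exact braid_nat T _ _
  hexagon_forward X Y Z := by
    change pure T (α_ _ _ _).hom ≫ pure T (β_ _ _).hom ≫ pure T (α_ _ _ _).hom =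
      pure T (β_ _ _).hom ▷ Kleisli.mk T Z.of ≫ pure T (α_ _ _ _).hom ≫
        Kleisli.mk T Y.of ◁ pure T (β_ _ _).hom
    rw [pure_whiskerRight, whiskerLeft_pure]
    erw [pure_comp, pure_comp, pure_comp, pure_comp]
    rw [BraidedCategory.hexagon_forward]
  hexagon_reverse X Y Z := by
    change pure T (α_ _ _ _).inv ≫ pure T (β_ _ _).hom ≫ pure T (α_ _ _ _).inv =
      Kleisli.mk T X.of ◁ pure T (β_ _ _).hom ≫ pure T (α_ _ _ _).inv ≫
        pure T (β_ _ _).hom ▷ Kleisli.mk T Y.of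
    rw [pure_whiskerRight, whiskerLeft_pure]
    erw [pure_comp, pure_comp, pure_comp, pure_comp]
    rw [BraidedCategory.hexagon_reverse]
  symmetry X Y := by
    change pure T (β_ _ _).hom ≫ pure T (β_ _ _).hom = 𝟙 _
    rw [pure_comp, SymmetricCategory.symmetry]
    exact pure_id T _

end KleisliTensor

/-! ## The symmetric monoidal (co)monad of a symmetric monoidal adjunction -/

section AdjunctionMonad
variable {C : Type u} [Category.{v} C] [MonoidalCategory C] [SymmetricCategory C]
  {D : Type u'} [Category.{v'} D] [MonoidalCategory D] [SymmetricCategory D]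
  {F : C ⥤ D} {G : D ⥤ C} (adj : F ⊣ G) [F.Braided]

/-- The right adjoint of a strong symmetric monoidal functor is lax symmetric monoidal, with the
structure maps induced by the adjunction. -/
@[reducible]
def CategoryTheory.Adjunction.rightLaxBraided : G.LaxBraided :=
  letI := adj.rightAdjointLaxMonoidal
  { braided := fun X Y => by
      simp only [Adjunction.rightAdjointLaxMonoidal_μ]
      rw [← Adjunction.homEquiv_naturality_right, ← Adjunction.homEquiv_naturality_left]
      congr 1
      simp only [Functor.map_braiding, Category.assoc, Functor.Monoidal.μ_δ_assoc,
        BraidedCategory.braiding_naturality] }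

/-- The monad of an adjunction whose left adjoint is strong symmetric monoidal. -/
@[reducible]
def CategoryTheory.Adjunction.symmetricMonoidalMonad : SymmetricMonoidalMonad adj.toMonad :=
  letI := adj.rightLaxBraided
  letI : adj.toMonad.toFunctor.LaxBraided := inferInstanceAs (F ⋙ G).LaxBraided
  haveI : adj.IsMonoidal := inferInstance
  { η_isMonoidal := inferInstanceAs (NatTrans.IsMonoidal adj.unit)
    μ_isMonoidal := by
      have h : NatTrans.IsMonoidal ((Functor.associator F G (F ⋙ G)).hom ≫
        Functor.whiskerLeft F ((Functor.associator G F G).inv ≫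
          Functor.whiskerRight adj.counit G ≫ G.leftUnitor.hom)) := inferInstance
      have e : (Functor.associator F G (F ⋙ G)).hom ≫
        Functor.whiskerLeft F ((Functor.associator G F G).inv ≫
          Functor.whiskerRight adj.counit G ≫ G.leftUnitor.hom) = adj.toMonad.μ := by
        ext X
        simp
      rw [e] at h
      exact h }

/-- The comonad of an adjunction whose left adjoint is strong symmetric monoidal. -/
@[reducible]
def CategoryTheory.Adjunction.symmetricMonoidalComonad : SymmetricMonoidalComonad adj.toComonad :=
  letI := adj.rightLaxBraided
  letI : adj.toComonad.toFunctor.LaxBraided := inferInstanceAs (G ⋙ F).LaxBraided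
  haveI : adj.IsMonoidal := inferInstance
  { ε_isMonoidal := inferInstanceAs (NatTrans.IsMonoidal adj.counit)
    δ_isMonoidal := by
      have h : NatTrans.IsMonoidal (Functor.whiskerLeft G (F.leftUnitor.inv ≫
        Functor.whiskerRight adj.unit F ≫ (Functor.associator F G F).hom) ≫
          (Functor.associator G F (G ⋙ F)).inv) := inferInstance
      have e : Functor.whiskerLeft G (F.leftUnitor.inv ≫
        Functor.whiskerRight adj.unit F ≫ (Functor.associator F G F).hom) ≫
          (Functor.associator G F (G ⋙ F)).inv = adj.toComonad.δ := by
        ext X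
        simp
      rw [e] at h
      exact h }

end AdjunctionMonad
/-! ## Models of the quantum lambda calculus -/

section Models
variable {C : Type u} [Category.{v} C] [MonoidalCategory C] [SymmetricCategory C]

/-- A linear exponential comonad structure on a symmetric monoidal comonad `!`: commutative
comonoids `(!A, d_A, e_A)` such that `d` and `e` are monoidal natural transformations, `d_A` and
`e_A` are coalgebra morphisms for the coalgebras `(!A, δ_A)`, `(!A ⊗ !A, (δ_A ⊗ δ_A) ≫ m)` and
`(I, m_I)`, and `δ_A` is a morphism of comonoids. -/
structure LinearExponentialComonad (W : Comonad C) [SymmetricMonoidalComonad W] where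
  d (A : C) : W.obj A ⟶ W.obj A ⊗ W.obj A
  e (A : C) : W.obj A ⟶ 𝟙_ C
  counit_comul (A : C) : d A ≫ (e A ▷ W.obj A) = (λ_ (W.obj A)).inv
  comul_counit (A : C) : d A ≫ (W.obj A ◁ e A) = (ρ_ (W.obj A)).inv
  comul_assoc (A : C) : d A ≫ (W.obj A ◁ d A) =
    d A ≫ (d A ▷ W.obj A) ≫ (α_ (W.obj A) (W.obj A) (W.obj A)).hom
  comul_comm (A : C) : d A ≫ (β_ (W.obj A) (W.obj A)).hom = d A
  d_natural {A B : C} (f : A ⟶ B) : W.map f ≫ d B = d A ≫ (W.map f ⊗ₘ W.map f)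
  e_natural {A B : C} (f : A ⟶ B) : W.map f ≫ e B = e A
  d_tensor (A B : C) : Functor.LaxMonoidal.μ W.toFunctor A B ≫ d (A ⊗ B) =
    (d A ⊗ₘ d B) ≫ tensorμ (W.obj A) (W.obj A) (W.obj B) (W.obj B) ≫
      (Functor.LaxMonoidal.μ W.toFunctor A B ⊗ₘ Functor.LaxMonoidal.μ W.toFunctor A B)
  d_unit : Functor.LaxMonoidal.ε W.toFunctor ≫ d (𝟙_ C) = (λ_ (𝟙_ C)).inv ≫
    (Functor.LaxMonoidal.ε W.toFunctor ⊗ₘ Functor.LaxMonoidal.ε W.toFunctor)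
  e_tensor (A B : C) : Functor.LaxMonoidal.μ W.toFunctor A B ≫ e (A ⊗ B) =
    (e A ⊗ₘ e B) ≫ (λ_ (𝟙_ C)).hom
  e_unit : Functor.LaxMonoidal.ε W.toFunctor ≫ e (𝟙_ C) = 𝟙 (𝟙_ C)
  d_coalgebra (A : C) : W.δ.app A ≫ W.map (d A) =
    d A ≫ (W.δ.app A ⊗ₘ W.δ.app A) ≫ Functor.LaxMonoidal.μ W.toFunctor (W.obj A) (W.obj A)
  e_coalgebra (A : C) : W.δ.app A ≫ W.map (e A) = e A ≫ Functor.LaxMonoidal.ε W.toFunctor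
  δ_comul (A : C) : W.δ.app A ≫ d (W.obj A) = d A ≫ (W.δ.app A ⊗ₘ W.δ.app A)
  δ_counit (A : C) : W.δ.app A ≫ e (W.obj A) = e A

/-- A strength `t_{A,B} : A ⊗ T B ⟶ T (A ⊗ B)` of a monad `T`. -/
structure MonadStrength (T : Monad C) where
  t (A B : C) : A ⊗ T.obj B ⟶ T.obj (A ⊗ B)
  natural {A A' B B' : C} (f : A ⟶ A') (g : B ⟶ B') :
    (f ⊗ₘ T.map g) ≫ t A' B' = t A B ≫ T.map (f ⊗ₘ g)
  unitality (A : C) : t (𝟙_ C) A ≫ T.map (λ_ A).hom = (λ_ (T.obj A)).hom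
  associativity (A B D : C) : t (A ⊗ B) D ≫ T.map (α_ A B D).hom =
    (α_ A B (T.obj D)).hom ≫ (A ◁ t B D) ≫ t A (B ⊗ D)
  t_η (A B : C) : (A ◁ T.η.app B) ≫ t A B = T.η.app (A ⊗ B)
  t_μ (A B : C) : (A ◁ T.μ.app B) ≫ t A B =
    t A (T.obj B) ≫ T.map (t A B) ≫ T.μ.app (A ⊗ B)

/-- Kleisli exponentials: a functor `[-,-]ₖ : Cᵒᵖ × C ⥤ C` (here in curried form) and an
isomorphism `C(A ⊗ B, T X) ≅ C(A, [B, X]ₖ)`, natural in `A`, `B` and `X`. -/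
structure KleisliExponentials (T : Monad C) where
  expo : Cᵒᵖ ⥤ C ⥤ C
  equiv (A B X : C) : (A ⊗ B ⟶ T.obj X) ≃ (A ⟶ (expo.obj (op B)).obj X)
  natural_left {A A' : C} (B X : C) (f : A' ⟶ A) (g : A ⊗ B ⟶ T.obj X) :
    equiv A' B X ((f ▷ B) ≫ g) = f ≫ equiv A B X g
  natural_middle (A : C) {B B' : C} (X : C) (f : B' ⟶ B) (g : A ⊗ B ⟶ T.obj X) :
    equiv A B' X ((A ◁ f) ≫ g) = equiv A B X g ≫ (expo.map f.op).app X
  natural_right (A B : C) {X X' : C} (f : X ⟶ X') (g : A ⊗ B ⟶ T.obj X) :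
    equiv A B X' (g ≫ T.map f) = equiv A B X g ≫ (expo.obj (op B)).map f

/-- A linear category for duplication: an idempotent, strongly monoidal linear exponential
comonad, a strong monad and Kleisli exponentials. -/
structure LinearCategoryForDuplication (W : Comonad C) [SymmetricMonoidalComonad W]
    (T : Monad C) where
  linearExponential : LinearExponentialComonad W
  idempotent (A : C) : IsIso (W.δ.app A)
  strong_unit : IsIso (Functor.LaxMonoidal.ε W.toFunctor)
  strong_tensor (A B : C) : IsIso (Functor.LaxMonoidal.μ W.toFunctor A B)
  strength : MonadStrength T
  kleisliExponentials : KleisliExponentials T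

/-- An abstract model of the quantum lambda calculus: an affine linear category for duplication
with finite coproducts that are preserved by the comonad. -/
structure AbstractModel (W : Comonad C) [SymmetricMonoidalComonad W] (T : Monad C) extends
    LinearCategoryForDuplication W T where
  affine : IsTerminal (𝟙_ C)
  hasFiniteCoproducts : HasFiniteCoproducts C
  preservesFiniteCoproducts : PreservesFiniteCoproducts W.toFunctor

/-- A concrete model of the quantum lambda calculus: an abstract model with a full and faithful
embedding of `Q` into the Kleisli category of `T` that preserves the tensor product (is strong
symmetric monoidal) and finite coproducts. The tensor product of the Kleisli category is that of the
symmetric monoidal monad `T`, and the strength of `T` is the one of this monoidal structure. -/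
structure ConcreteModel (Q : Type u') [Category.{v'} Q] [MonoidalCategory Q] [SymmetricCategory Q]
    (W : Comonad C) [SymmetricMonoidalComonad W] (T : Monad C) [SymmetricMonoidalMonad T] extends
    AbstractModel W T where
  strength_eq (A B : C) : strength.t A B =
    (T.η.app A ▷ T.obj B) ≫ Functor.LaxMonoidal.μ T.toFunctor A B
  embedding : Q ⥤ Kleisli T
  full : embedding.Full
  faithful : embedding.Faithful
  preservesTensor : embedding.Braided
  preservesCoproducts : PreservesFiniteCoproducts embedding

end Models
/-- The opposite of a symmetric monoidal category. -/
instance oppositeSymmetric (C : Type*) [Category* C] [MonoidalCategory C] [SymmetricCategory C] :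
    SymmetricCategory Cᵒᵖ where
  symmetry X Y := Quiver.Hom.unop_inj (SymmetricCategory.symmetry X.unop Y.unop)

/-- The category of presheaves of sets on a small monoidal category `C`, with the Day convolution
tensor product. -/
abbrev PSh (C : Type) [SmallCategory.{0} C] [MonoidalCategory C] : Type 1 :=
  DayFunctor Cᵒᵖ (Type)

namespace PSh
variable {C : Type} [SmallCategory.{0} C] [MonoidalCategory C] 

open scoped DayConvolution

/-- The Day convolution that defines the tensor product. -/
@[reducible]
noncomputable def conv (F G : PSh C) : DayConvolution F.functor G.functor :=
  LawfulDayConvolutionMonoidalCategoryStruct.convolution Cᵒᵖ (Type) (PSh C) F G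

attribute [local instance] conv

@[reducible]
noncomputable def convR (F G H : PSh C) : DayConvolution F.functor (G.functor ⊛ H.functor) :=
  conv F (G ⊗ H)

@[reducible]
noncomputable def convL (F G H : PSh C) : DayConvolution (F.functor ⊛ G.functor) H.functor :=
  conv (F ⊗ G) H

attribute [local instance] convR convL

lemma associator_hom_eq (F G H : PSh C) : (α_ F G H).hom = 
      DayFunctor.Hom.mk (DayConvolution.associator F.functor G.functor H.functor).hom :=
  DayFunctor.hom_ext
    (LawfulDayConvolutionMonoidalCategoryStruct.ι_map_associator_hom_eq_associator_hom
      (C := Cᵒᵖ) (V := Type) (D := PSh C) F G H)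

noncomputable def associatorIso (F G H : PSh C) : (F ⊗ G) ⊗ H ≅ F ⊗ (G ⊗ H) where
  hom := ⟨(DayConvolution.associator F.functor G.functor H.functor).hom⟩
  inv := ⟨(DayConvolution.associator F.functor G.functor H.functor).inv⟩
  hom_inv_id := DayFunctor.hom_ext 
    (DayConvolution.associator F.functor G.functor H.functor).hom_inv_id
  inv_hom_id := DayFunctor.hom_ext 
    (DayConvolution.associator F.functor G.functor H.functor).inv_hom_id

lemma associator_eq (F G H : PSh C) : α_ F G H = associatorIso F G H :=
  Iso.ext (associator_hom_eq F G H)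

lemma tensorHom_eq {F G F' G' : PSh C} (f : F ⟶ G) (g : F' ⟶ G') :
    f ⊗ₘ g = DayFunctor.Hom.mk (DayConvolution.map f.natTrans g.natTrans) :=
  DayFunctor.hom_ext
    (LawfulDayConvolutionMonoidalCategoryStruct.ι_map_tensorHom_hom_eq_tensorHom
      (C := Cᵒᵖ) (V := Type) (D := PSh C) f g)

variable [SymmetricCategory C]

/-- The symmetry of the Day convolution tensor product. -/
noncomputable def braid (F G : PSh C) : F ⊗ G ≅ G ⊗ F where
  hom := ⟨(DayConvolution.braiding F.functor G.functor).hom⟩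
  inv := ⟨(DayConvolution.braiding F.functor G.functor).inv⟩
  hom_inv_id := DayFunctor.hom_ext (DayConvolution.braiding F.functor G.functor).hom_inv_id
  inv_hom_id := DayFunctor.hom_ext (DayConvolution.braiding F.functor G.functor).inv_hom_id

noncomputable instance : BraidedCategory (PSh C) where
  braiding := braid
  braiding_naturality_right F G H f := by
    rw [← id_tensorHom, ← tensorHom_id, tensorHom_eq, tensorHom_eq]
    exact congrArg DayFunctor.Hom.mk
      (DayConvolution.braiding_naturality_right F.functor f.natTrans)
  braiding_naturality_left f H := by
    rw [← id_tensorHom, ← tensorHom_id, tensorHom_eq, tensorHom_eq]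
    exact congrArg DayFunctor.Hom.mk
      (DayConvolution.braiding_naturality_left f.natTrans H.functor)
  hexagon_forward F G H := by
    rw [← id_tensorHom, ← tensorHom_id, tensorHom_eq, tensorHom_eq, associator_eq, associator_eq,
      associator_eq]
    exact congrArg DayFunctor.Hom.mk
      (DayConvolution.hexagon_forward F.functor G.functor H.functor)
  hexagon_reverse F G H := by
    rw [← id_tensorHom, ← tensorHom_id, tensorHom_eq, tensorHom_eq, associator_eq, associator_eq,
      associator_eq]
    exact congrArg DayFunctor.Hom.mk
      (DayConvolution.hexagon_reverse F.functor G.functor H.functor)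

noncomputable instance : SymmetricCategory (PSh C) where
  symmetry F G := DayFunctor.hom_ext (DayConvolution.symmetry F.functor G.functor)
end PSh

/-! ## Finite sets -/

/-- A small collection of finite sets that contains every `{0, …, n - 1}` and is closed under
disjoint unions and finite products. -/
inductive FinSet : Type
  | unit : FinSet
  | fin (n : ℕ) : FinSet
  | sum (a b : FinSet) : FinSet
  | prod (a b : FinSet) : FinSet
  | pi (n : ℕ) (a : Fin n → FinSet) : FinSet

namespace FinSet

/-- The underlying type of a finite set. -/
@[reducible] def El : FinSet → Type
  | unit => Unit
  | fin n => Fin n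
  | sum a b => a.El ⊕ b.El
  | prod a b => a.El × b.El
  | pi _ a => ∀ i, (a i).El

instance : CoeSort FinSet Type := ⟨El⟩

instance decEq : (a : FinSet) → DecidableEq a
  | unit => inferInstanceAs (DecidableEq Unit)
  | fin n => inferInstanceAs (DecidableEq (Fin n))
  | sum a b =>
    letI := decEq a
    letI := decEq b
    inferInstanceAs (DecidableEq (a.El ⊕ b.El))
  | prod a b =>
    letI := decEq a
    letI := decEq b
    inferInstanceAs (DecidableEq (a.El × b.El))
  | pi _ a =>
    letI := fun i => decEq (a i)
    inferInstanceAs (DecidableEq (∀ i, (a i).El))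

instance fintype : (a : FinSet) → Fintype a
  | unit => inferInstanceAs (Fintype Unit)
  | fin n => inferInstanceAs (Fintype (Fin n))
  | sum a b =>
    letI := fintype a
    letI := fintype b
    inferInstanceAs (Fintype (a.El ⊕ b.El))
  | prod a b =>
    letI := fintype a
    letI := fintype b
    inferInstanceAs (Fintype (a.El × b.El))
  | pi _ a =>
    letI := fun i => fintype (a i)
    inferInstanceAs (Fintype (∀ i, (a i).El))

/-- The category of finite sets and functions. -/
instance : SmallCategory FinSet where
  Hom a b := a → b
  id a := id
  comp f g := g ∘ f

end FinSet

/-! ## The free finite coproduct completion -/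

/-- An object of `C⁺`, the free completion of `C` under finite coproducts: a finite family of objects
of `C`. -/
structure FinFam (C : Type u) : Type u where
  index : FinSet
  obj : index → C

namespace FinFam

section
variable {C : Type u} [Category.{v} C]

/-- A morphism of families: a function `φ` of the index sets and morphisms `X_a ⟶ Y_{φ a}`. -/
structure Hom (X Y : FinFam C) where
  map : X.index → Y.index
  app (a : X.index) : X.obj a ⟶ Y.obj (map a)

instance : Category (FinFam C) where
  Hom := Hom
  id X := ⟨id, fun _ => 𝟙 _⟩
  comp f g := ⟨fun a => g.map (f.map a), fun a => f.app a ≫ g.app (f.map a)⟩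
  id_comp f := by
    simp
  comp_id f := by
    simp
  assoc f g h := by
    simp

@[simp] lemma id_map (X : FinFam C) (a : X.index) : Hom.map (𝟙 X) a = a := rfl
@[simp] lemma id_app (X : FinFam C) (a : X.index) : Hom.app (𝟙 X) a = 𝟙 _ := rfl
@[simp] lemma comp_map {X Y Z : FinFam C} (f : X ⟶ Y) (g : Y ⟶ Z) (a : X.index) :
    (f ≫ g).map a = g.map (f.map a) := rfl
@[simp] lemma comp_app {X Y Z : FinFam C} (f : X ⟶ Y) (g : Y ⟶ Z) (a : X.index) :
    (f ≫ g).app a = f.app a ≫ g.app (f.map a) := rfl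

lemma hom_ext {X Y : FinFam C} {m : X.index → Y.index} {f g : ∀ a, X.obj a ⟶ Y.obj (m a)}
    (h : ∀ a, f a = g a) : (⟨m, f⟩ : X ⟶ Y) = ⟨m, g⟩ := by
  obtain rfl : f = g := funext h
  rfl

end

section
variable {C : Type u} [Category.{v} C] [MonoidalCategory C]

/-- The tensor product of families is `(X_a ⊗ Y_b)_{(a, b)}`. -/
instance : MonoidalCategoryStruct (FinFam C) where
  tensorObj X Y := ⟨.prod X.index Y.index, fun p => X.obj p.1 ⊗ Y.obj p.2⟩
  tensorUnit := ⟨.unit, fun _ => 𝟙_ C⟩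
  tensorHom f g := ⟨fun p => (f.map p.1, g.map p.2), fun p => f.app p.1 ⊗ₘ g.app p.2⟩
  whiskerLeft X {_ _} g := ⟨fun p => (p.1, g.map p.2), fun p => X.obj p.1 ◁ g.app p.2⟩
  whiskerRight f Y := ⟨fun p => (f.map p.1, p.2), fun p => f.app p.1 ▷ Y.obj p.2⟩
  associator X Y Z :=
    { hom := ⟨fun p => (p.1.1, p.1.2, p.2), fun p => (α_ _ _ _).hom⟩
      inv := ⟨fun p => ((p.1, p.2.1), p.2.2), fun p => (α_ _ _ _).inv⟩
      hom_inv_id := hom_ext fun _ => Iso.hom_inv_id _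
      inv_hom_id := hom_ext fun _ => Iso.inv_hom_id _ }
  leftUnitor X :=
    { hom := ⟨fun p => p.2, fun p => (λ_ _).hom⟩
      inv := ⟨fun p => ((), p), fun p => (λ_ _).inv⟩
      hom_inv_id := hom_ext fun _ => Iso.hom_inv_id _
      inv_hom_id := hom_ext fun _ => Iso.inv_hom_id _ }
  rightUnitor X :=
    { hom := ⟨fun p => p.1, fun p => (ρ_ _).hom⟩
      inv := ⟨fun p => (p, ()), fun p => (ρ_ _).inv⟩
      hom_inv_id := hom_ext fun _ => Iso.hom_inv_id _
      inv_hom_id := hom_ext fun _ => Iso.inv_hom_id _ }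

instance : MonoidalCategory (FinFam C) where
  tensorHom_def f g := hom_ext fun _ => MonoidalCategory.tensorHom_def _ _
  id_tensorHom_id X Y := hom_ext fun _ => id_tensorHom_id _ _
  tensorHom_comp_tensorHom _ _ _ _ := hom_ext fun _ => tensorHom_comp_tensorHom _ _ _ _
  whiskerLeft_id _ _ := hom_ext fun _ => whiskerLeft_id _ _
  id_whiskerRight _ _ := hom_ext fun _ => id_whiskerRight _ _
  associator_naturality _ _ _ := hom_ext fun _ => associator_naturality _ _ _
  leftUnitor_naturality _ := hom_ext fun _ => leftUnitor_naturality _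
  rightUnitor_naturality _ := hom_ext fun _ => rightUnitor_naturality _
  pentagon _ _ _ _ := hom_ext fun _ => pentagon _ _ _ _
  triangle _ _ := hom_ext fun _ => triangle _ _

instance [SymmetricCategory C] : SymmetricCategory (FinFam C) where
  braiding X Y :=
    { hom := ⟨fun p => (p.2, p.1), fun p => (β_ _ _).hom⟩
      inv := ⟨fun p => (p.2, p.1), fun p => (β_ _ _).inv⟩
      hom_inv_id := hom_ext fun _ => Iso.hom_inv_id _
      inv_hom_id := hom_ext fun _ => Iso.inv_hom_id _ }
  braiding_naturality_right _ _ _ _ := hom_ext fun _ => BraidedCategory.braiding_naturality_right _ _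
  braiding_naturality_left _ _ := hom_ext fun _ => BraidedCategory.braiding_naturality_left _ _
  hexagon_forward _ _ _ := hom_ext fun _ => BraidedCategory.hexagon_forward _ _ _
  hexagon_reverse _ _ _ := hom_ext fun _ => BraidedCategory.hexagon_reverse _ _ _
  symmetry _ _ := hom_ext fun _ => SymmetricCategory.symmetry _ _

end

/-- The functor from finite sets to `C⁺` with `A ↦ {I}_{a ∈ A}`. -/
def unitFamily (C : Type u) [Category.{v} C] [MonoidalCategory C] : FinSet ⥤ FinFam C where
  obj A := ⟨A, fun _ => 𝟙_ C⟩
  map f := ⟨f, fun _ => 𝟙 (𝟙_ C)⟩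
  map_comp _ _ := hom_ext fun _ => (Category.id_comp _).symm

end FinFam

/-! ## The free affine symmetric monoidal category on a discrete category -/

/-- An object of the free affine symmetric monoidal category on the discrete category `K`: a finite
sequence of elements of `K`. -/
structure Fwm (K : Type) : Type where
  len : ℕ
  obj : Fin len → K

namespace Fwm
variable {K : Type}

/-- A morphism `{V_1, …, V_n} ⟶ {W_1, …, W_m}` is an injective function `f : [m] → [n]` with
`V_{f i} = W_i`. -/
@[ext]
structure Hom (X Y : Fwm K) where
  map : Fin Y.len → Fin X.len
  injective : Function.Injective map
  obj_map (i : Fin Y.len) : X.obj (map i) = Y.obj i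

instance : SmallCategory (Fwm K) where
  Hom := Hom
  id X := ⟨id, Function.injective_id, fun _ => rfl⟩
  comp f g := ⟨f.map ∘ g.map, f.injective.comp g.injective,
    fun i => (f.obj_map _).trans (g.obj_map i)⟩

@[simp] lemma id_map (X : Fwm K) : Hom.map (𝟙 X) = id := rfl
@[simp] lemma comp_map {X Y Z : Fwm K} (f : X ⟶ Y) (g : Y ⟶ Z) :
    (f ≫ g).map = f.map ∘ g.map := rfl

@[ext] lemma hom_ext {X Y : Fwm K} {f g : X ⟶ Y} (h : ∀ i, f.map i = g.map i) : f = g :=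
  Hom.ext (funext h)

/-- Concatenation. -/
def tensor (X Y : Fwm K) : Fwm K := ⟨X.len + Y.len, Fin.append X.obj Y.obj⟩

def inl {X Y : Fwm K} (i : Fin X.len) : Fin (tensor X Y).len := Fin.castAdd Y.len i
def inr {X Y : Fwm K} (i : Fin Y.len) : Fin (tensor X Y).len := Fin.natAdd X.len i

def cases {X Y : Fwm K} {α : Type} (f : Fin X.len → α) (g : Fin Y.len → α) :
    Fin (tensor X Y).len → α := Fin.addCases f g

@[simp] lemma cases_inl {X Y : Fwm K} {α : Type} (f : Fin X.len → α) (g : Fin Y.len → α) (i) :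
    cases f g (inl i) = f i := Fin.addCases_left i
@[simp] lemma cases_inr {X Y : Fwm K} {α : Type} (f : Fin X.len → α) (g : Fin Y.len → α) (i) :
    cases f g (inr i) = g i := Fin.addCases_right i
@[simp] lemma tensor_obj_inl {X Y : Fwm K} (i : Fin X.len) :
    (tensor X Y).obj (inl i) = X.obj i := Fin.append_left _ _ i
@[simp] lemma tensor_obj_inr {X Y : Fwm K} (i : Fin Y.len) :
    (tensor X Y).obj (inr i) = Y.obj i := Fin.append_right _ _ i
@[simp] lemma inl_inj {X Y : Fwm K} (i j : Fin X.len) :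
    (inl i : Fin (tensor X Y).len) = inl j ↔ i = j := (Fin.castAdd_injective _ _).eq_iff
@[simp] lemma inr_inj {X Y : Fwm K} (i j : Fin Y.len) :
    (inr i : Fin (tensor X Y).len) = inr j ↔ i = j := (Fin.natAdd_injective _ _).eq_iff
@[simp] lemma inl_ne_inr {X Y : Fwm K} (i : Fin X.len) (j : Fin Y.len) :
    (inl i : Fin (tensor X Y).len) ≠ inr j := by
  intro h
  have := congrArg Fin.val h
  simp [inl, inr] at this
  omega
@[simp] lemma inr_ne_inl {X Y : Fwm K} (i : Fin X.len) (j : Fin Y.len) :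
    (inr j : Fin (tensor X Y).len) ≠ inl i := (inl_ne_inr i j).symm

lemma forall_tensor {X Y : Fwm K} {p : Fin (tensor X Y).len → Prop} :
    (∀ i, p i) ↔ (∀ i, p (inl i)) ∧ ∀ i, p (inr i) :=
  ⟨fun h => ⟨fun _ => h _, fun _ => h _⟩, fun h i => Fin.addCases h.1 h.2 i⟩

/-- The empty sequence. -/
def unit : Fwm K := ⟨0, Fin.elim0⟩

def unitElim {α : Type} : Fin (unit : Fwm K).len → α := Fin.elim0

lemma forall_unit {p : Fin (unit : Fwm K).len → Prop} : (∀ i, p i) ↔ True :=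
  ⟨fun _ => trivial, fun _ i => i.elim0⟩

def homOf {X Y : Fwm K} (m : Fin Y.len → Fin X.len) (h : ∀ i j, m i = m j → i = j)
    (h' : ∀ i, X.obj (m i) = Y.obj i) : X ⟶ Y := ⟨m, fun i j => h i j, h'⟩

@[simp] lemma homOf_map {X Y : Fwm K} (m : Fin Y.len → Fin X.len) (h : ∀ i j, m i = m j → i = j)
    (h' : ∀ i, X.obj (m i) = Y.obj i) : (homOf m h h').map = m := rfl

def tensorMap {X X' Y Y' : Fwm K} (f : X ⟶ Y) (g : X' ⟶ Y') : tensor X X' ⟶ tensor Y Y' :=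
  homOf (cases (fun i => inl (f.map i)) fun i => inr (g.map i))
    (by simp [forall_tensor, f.injective.eq_iff, g.injective.eq_iff])
    (by simp [forall_tensor, f.obj_map, g.obj_map])

def assoc (X Y Z : Fwm K) : tensor (tensor X Y) Z ≅ tensor X (tensor Y Z) where
  hom := homOf (cases (fun i => inl (inl i)) (cases (fun i => inl (inr i)) inr))
    (by simp [forall_tensor]) (by simp [forall_tensor])
  inv := homOf (cases (cases inl (fun i => inr (inl i))) (fun i => inr (inr i)))
    (by simp [forall_tensor]) (by simp [forall_tensor])
  hom_inv_id := by apply hom_ext; simp [forall_tensor]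
  inv_hom_id := by apply hom_ext; simp [forall_tensor]

def leftUnit (X : Fwm K) : tensor unit X ≅ X where
  hom := homOf inr (by simp) (by simp)
  inv := homOf (cases unitElim id) (by simp [forall_tensor, forall_unit])
    (by simp [forall_tensor, forall_unit])
  hom_inv_id := by apply hom_ext; simp [forall_tensor, forall_unit]
  inv_hom_id := by apply hom_ext; simp

def rightUnit (X : Fwm K) : tensor X unit ≅ X where
  hom := homOf inl (by simp) (by simp)
  inv := homOf (cases id unitElim) (by simp [forall_tensor, forall_unit])
    (by simp [forall_tensor, forall_unit])
  hom_inv_id := by apply hom_ext; simp [forall_tensor, forall_unit]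
  inv_hom_id := by apply hom_ext; simp

/-- The symmetry exchanges the two blocks. -/
def swap (X Y : Fwm K) : tensor X Y ⟶ tensor Y X :=
  homOf (cases inr inl) (by simp [forall_tensor]) (by simp [forall_tensor])

instance : MonoidalCategoryStruct (Fwm K) where
  tensorObj := tensor
  tensorUnit := unit
  tensorHom := tensorMap
  whiskerLeft X {_ _} g := tensorMap (𝟙 X) g
  whiskerRight f Y := tensorMap f (𝟙 Y)
  associator := assoc
  leftUnitor := leftUnit
  rightUnitor := rightUnit

lemma tensorMap_id (X Y : Fwm K) : tensorMap (𝟙 X) (𝟙 Y) = 𝟙 (tensor X Y) := by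
  apply hom_ext; simp [forall_tensor, tensorMap]

lemma tensorMap_comp {X X' Y Y' Z Z' : Fwm K} (f : X ⟶ Y) (g : X' ⟶ Y') (h : Y ⟶ Z)
    (k : Y' ⟶ Z') : tensorMap f g ≫ tensorMap h k = tensorMap (f ≫ h) (g ≫ k) := by
  apply hom_ext; simp [forall_tensor, tensorMap]

lemma assoc_nat {X₁ X₂ X₃ Y₁ Y₂ Y₃ : Fwm K} (f : X₁ ⟶ Y₁) (g : X₂ ⟶ Y₂) (h : X₃ ⟶ Y₃) :
    tensorMap (tensorMap f g) h ≫ (assoc Y₁ Y₂ Y₃).hom =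
      (assoc X₁ X₂ X₃).hom ≫ tensorMap f (tensorMap g h) := by
  apply hom_ext; simp [forall_tensor, tensorMap, assoc]

lemma left_nat {X Y : Fwm K} (f : X ⟶ Y) :
    tensorMap (𝟙 unit) f ≫ (leftUnit Y).hom = (leftUnit X).hom ≫ f := by
  apply hom_ext; simp [tensorMap, leftUnit]

lemma right_nat {X Y : Fwm K} (f : X ⟶ Y) :
    tensorMap f (𝟙 unit) ≫ (rightUnit Y).hom = (rightUnit X).hom ≫ f := by
  apply hom_ext; simp [tensorMap, rightUnit]

lemma pent (W X Y Z : Fwm K) :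
    tensorMap (assoc W X Y).hom (𝟙 Z) ≫ (assoc W (tensor X Y) Z).hom ≫
      tensorMap (𝟙 W) (assoc X Y Z).hom =
    (assoc (tensor W X) Y Z).hom ≫ (assoc W X (tensor Y Z)).hom := by
  apply hom_ext; simp [forall_tensor, tensorMap, assoc]

lemma tri (X Y : Fwm K) :
    (assoc X unit Y).hom ≫ tensorMap (𝟙 X) (leftUnit Y).hom =
      tensorMap (rightUnit X).hom (𝟙 Y) := by
  apply hom_ext; simp [forall_tensor, tensorMap, assoc, leftUnit, rightUnit]

instance : MonoidalCategory (Fwm K) := .ofTensorHom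
  (id_tensorHom_id := tensorMap_id)
  (tensorHom_comp_tensorHom := tensorMap_comp)
  (associator_naturality := assoc_nat)
  (leftUnitor_naturality := left_nat)
  (rightUnitor_naturality := right_nat)
  (pentagon := pent)
  (triangle := tri)

lemma swap_swap (X Y : Fwm K) : swap X Y ≫ swap Y X = 𝟙 (tensor X Y) := by
  apply hom_ext; simp [forall_tensor, swap]

lemma swap_nat {X X' Y Y' : Fwm K} (f : X ⟶ Y) (g : X' ⟶ Y') :
    tensorMap f g ≫ swap Y Y' = swap X X' ≫ tensorMap g f := by
  apply hom_ext; simp [forall_tensor, tensorMap, swap]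

lemma hex (X Y Z : Fwm K) :
    (assoc X Y Z).hom ≫ swap X (tensor Y Z) ≫ (assoc Y Z X).hom =
      tensorMap (swap X Y) (𝟙 Z) ≫ (assoc Y X Z).hom ≫ tensorMap (𝟙 Y) (swap X Z) := by
  apply hom_ext; simp [forall_tensor, tensorMap, swap, assoc]

lemma hex' (X Y Z : Fwm K) :
    (assoc X Y Z).inv ≫ swap (tensor X Y) Z ≫ (assoc Z X Y).inv =
      tensorMap (𝟙 X) (swap Y Z) ≫ (assoc X Z Y).inv ≫ tensorMap (swap X Z) (𝟙 Y) := by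
  apply hom_ext; simp [forall_tensor, tensorMap, swap, assoc]

instance : SymmetricCategory (Fwm K) where
  braiding X Y := ⟨swap X Y, swap Y X, swap_swap X Y, swap_swap Y X⟩
  braiding_naturality_right X _ _ f := swap_nat (𝟙 X) f
  braiding_naturality_left f Z := swap_nat f (𝟙 Z)
  hexagon_forward := hex
  hexagon_reverse := hex'
  symmetry := swap_swap

end Fwm

/-! ## Completely positive maps -/

section CompletelyPositive
open Matrix
open scoped Kronecker ComplexOrder

section
variable {X Y Z : Type} [Fintype X] [Fintype Y] [Fintype Z]

/-- A linear map `L(ℂ^X) → L(ℂ^Y)` is completely positive if it is of the form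
`ρ ↦ ∑ i, K i * ρ * (K i)†`. -/
def IsCompletelyPositive (F : Matrix X X ℂ →ₗ[ℂ] Matrix Y Y ℂ) : Prop :=
  ∃ (n : ℕ) (K : Fin n → Matrix Y X ℂ), ∀ ρ, F ρ = ∑ i, K i * ρ * (K i)ᴴ

/-- A linear map is trace preserving. (As the positive operators span, it is equivalent to ask this
for positive `ρ` only.) -/
def IsTracePreserving (F : Matrix X X ℂ →ₗ[ℂ] Matrix Y Y ℂ) : Prop :=
  ∀ ρ, (F ρ).trace = ρ.trace

namespace IsCompletelyPositive

lemma of_fintype {κ : Type} [Fintype κ] {F : Matrix X X ℂ →ₗ[ℂ] Matrix Y Y ℂ}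
    (K : κ → Matrix Y X ℂ) (h : ∀ ρ, F ρ = ∑ i, K i * ρ * (K i)ᴴ) : IsCompletelyPositive F :=
  ⟨Fintype.card κ, K ∘ (Fintype.equivFin κ).symm, fun ρ => by
    rw [h]
    exact ((Fintype.equivFin κ).symm.sum_comp fun i => K i * ρ * (K i)ᴴ).symm⟩

lemma id [DecidableEq X] :
    IsCompletelyPositive (LinearMap.id : Matrix X X ℂ →ₗ[ℂ] Matrix X X ℂ) :=
  of_fintype (fun _ : Unit => 1) (by simp)

lemma zero : IsCompletelyPositive (0 : Matrix X X ℂ →ₗ[ℂ] Matrix Y Y ℂ) :=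
  of_fintype (fun i : Empty => i.elim) (by simp)

lemma add {F G : Matrix X X ℂ →ₗ[ℂ] Matrix Y Y ℂ} (hF : IsCompletelyPositive F)
    (hG : IsCompletelyPositive G) : IsCompletelyPositive (F + G) := by
  obtain ⟨n, K, hK⟩ := hF
  obtain ⟨m, L, hL⟩ := hG
  exact of_fintype (Sum.elim K L) (by simp [hK, hL])

lemma sum {ι : Type} (s : Finset ι) {F : ι → (Matrix X X ℂ →ₗ[ℂ] Matrix Y Y ℂ)}
    (h : ∀ i, IsCompletelyPositive (F i)) : IsCompletelyPositive (∑ i ∈ s, F i) := by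
  classical
  induction s using Finset.induction_on with
  | empty => simpa using zero
  | insert i s hi ih =>
    rw [Finset.sum_insert hi]
    exact (h i).add ih

lemma comp {F : Matrix X X ℂ →ₗ[ℂ] Matrix Y Y ℂ} {G : Matrix Y Y ℂ →ₗ[ℂ] Matrix Z Z ℂ}
    (hG : IsCompletelyPositive G) (hF : IsCompletelyPositive F) :
    IsCompletelyPositive (G ∘ₗ F) := by
  obtain ⟨n, K, hK⟩ := hF
  obtain ⟨m, L, hL⟩ := hG
  refine of_fintype (fun p : Fin m × Fin n => L p.1 * K p.2) fun ρ => ?_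
  simp [hK, hL, Fintype.sum_prod_type, Matrix.mul_sum, Matrix.sum_mul, Matrix.mul_assoc,
    Matrix.conjTranspose_mul]

lemma posSemidef {F : Matrix X X ℂ →ₗ[ℂ] Matrix Y Y ℂ} (hF : IsCompletelyPositive F)
    {ρ : Matrix X X ℂ} (hρ : ρ.PosSemidef) : (F ρ).PosSemidef := by
  obtain ⟨n, K, hK⟩ := hF
  rw [hK]
  exact Matrix.posSemidef_sum _ fun i _ => hρ.mul_mul_conjTranspose_same (K i)

end IsCompletelyPositive
end

section Tensor
variable {X X' Y Y' Z Z' : Type} [Fintype X] [Fintype X'] [Fintype Y] [Fintype Y']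
  [Fintype Z] [Fintype Z'] [DecidableEq X] [DecidableEq X'] [DecidableEq Y] [DecidableEq Y']
  [DecidableEq Z] [DecidableEq Z']

/-- The map `L(V ⊗ V') ≅ L(V) ⊗ L(V') → L(W) ⊗ L(W') ≅ L(W ⊗ W')` given by `F ⊗ G`. -/
def tensorOp (F : Matrix X X ℂ →ₗ[ℂ] Matrix Y Y ℂ) (G : Matrix X' X' ℂ →ₗ[ℂ] Matrix Y' Y' ℂ) :
    Matrix (X × X') (X × X') ℂ →ₗ[ℂ] Matrix (Y × Y') (Y × Y') ℂ :=
  (kroneckerLinearEquiv Y Y Y' Y' ℂ).toLinearMap ∘ₗ TensorProduct.map F G ∘ₗ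
    (kroneckerLinearEquiv X X X' X' ℂ).symm.toLinearMap

@[simp] lemma tensorOp_kronecker (F : Matrix X X ℂ →ₗ[ℂ] Matrix Y Y ℂ)
    (G : Matrix X' X' ℂ →ₗ[ℂ] Matrix Y' Y' ℂ) (A : Matrix X X ℂ) (B : Matrix X' X' ℂ) :
    tensorOp F G (A ⊗ₖ B) = F A ⊗ₖ G B := by
  simp [tensorOp]

lemma kronecker_ext {M : Type} [AddCommGroup M] [Module ℂ M]
    {F G : Matrix (X × X') (X × X') ℂ →ₗ[ℂ] M} (h : ∀ A B, F (A ⊗ₖ B) = G (A ⊗ₖ B)) : F = G := by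
  have : F ∘ₗ (kroneckerLinearEquiv X X X' X' ℂ).toLinearMap =
      G ∘ₗ (kroneckerLinearEquiv X X X' X' ℂ).toLinearMap :=
    TensorProduct.ext' fun A B => by simpa using h A B
  ext1 ρ
  obtain ⟨t, rfl⟩ := (kroneckerLinearEquiv X X X' X' ℂ).surjective ρ
  exact LinearMap.congr_fun this t

lemma kronecker_ext₃ {M : Type} [AddCommGroup M] [Module ℂ M]
    {F G : Matrix ((X × Y) × Z) ((X × Y) × Z) ℂ →ₗ[ℂ] M}
    (h : ∀ A B C, F (A ⊗ₖ B ⊗ₖ C) = G (A ⊗ₖ B ⊗ₖ C)) : F = G := by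
  refine kronecker_ext fun D C => ?_
  have : F ∘ₗ (kroneckerLinearEquiv _ _ _ _ ℂ).toLinearMap ∘ₗ
      (TensorProduct.mk ℂ _ _).flip C = G ∘ₗ (kroneckerLinearEquiv _ _ _ _ ℂ).toLinearMap ∘ₗ
      (TensorProduct.mk ℂ _ _).flip C := kronecker_ext fun A B => by simpa using h A B C
  simpa using LinearMap.congr_fun this D

lemma tensorOp_id : tensorOp (LinearMap.id : Matrix X X ℂ →ₗ[ℂ] _)
    (LinearMap.id : Matrix X' X' ℂ →ₗ[ℂ] _) = LinearMap.id :=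
  kronecker_ext fun A B => by simp

lemma tensorOp_comp (F : Matrix X X ℂ →ₗ[ℂ] Matrix Y Y ℂ) (G : Matrix Y Y ℂ →ₗ[ℂ] Matrix Z Z ℂ)
    (F' : Matrix X' X' ℂ →ₗ[ℂ] Matrix Y' Y' ℂ) (G' : Matrix Y' Y' ℂ →ₗ[ℂ] Matrix Z' Z' ℂ) :
    tensorOp (G ∘ₗ F) (G' ∘ₗ F') = tensorOp G G' ∘ₗ tensorOp F F' :=
  kronecker_ext fun A B => by simp

lemma tensorOp_zero_left (G : Matrix X' X' ℂ →ₗ[ℂ] Matrix Y' Y' ℂ) :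
    tensorOp (0 : Matrix X X ℂ →ₗ[ℂ] Matrix Y Y ℂ) G = 0 :=
  kronecker_ext fun A B => by simp

lemma tensorOp_zero_right (F : Matrix X X ℂ →ₗ[ℂ] Matrix Y Y ℂ) :
    tensorOp F (0 : Matrix X' X' ℂ →ₗ[ℂ] Matrix Y' Y' ℂ) = 0 :=
  kronecker_ext fun A B => by simp

lemma kronecker_sum {ι ι' : Type} (s : Finset ι) (t : Finset ι') (A : ι → Matrix X Y ℂ)
    (B : ι' → Matrix X' Y' ℂ) :
    (∑ i ∈ s, A i) ⊗ₖ (∑ j ∈ t, B j) = ∑ i ∈ s, ∑ j ∈ t, (A i ⊗ₖ B j) := by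
  change (Matrix.kroneckerBilinear : Matrix X Y ℂ →ₗ[ℂ] Matrix X' Y' ℂ →ₗ[ℂ] _) (∑ i ∈ s, A i) (∑ j ∈ t, B j) = _
  rw [LinearMap.map_sum₂]
  refine Finset.sum_congr rfl fun i _ => ?_
  rw [map_sum]
  rfl

lemma tensorOp_sum {ι ι' : Type} (s : Finset ι) (t : Finset ι')
    (F : ι → (Matrix X X ℂ →ₗ[ℂ] Matrix Y Y ℂ)) (G : ι' → (Matrix X' X' ℂ →ₗ[ℂ] Matrix Y' Y' ℂ)) :
    tensorOp (∑ i ∈ s, F i) (∑ j ∈ t, G j) = ∑ i ∈ s, ∑ j ∈ t, tensorOp (F i) (G j) :=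
  kronecker_ext fun A B => by
    simp only [tensorOp_kronecker, LinearMap.sum_apply]
    exact kronecker_sum s t _ _

/-- The map `ρ ↦ K * ρ * K†`. -/
def conjOp (K : Matrix Y X ℂ) : Matrix X X ℂ →ₗ[ℂ] Matrix Y Y ℂ where
  toFun ρ := K * ρ * Kᴴ
  map_add' _ _ := by simp [Matrix.mul_add, Matrix.add_mul]
  map_smul' _ _ := by simp

@[simp] lemma conjOp_apply (K : Matrix Y X ℂ) (ρ : Matrix X X ℂ) : conjOp K ρ = K * ρ * Kᴴ := rfl

lemma IsCompletelyPositive.tensorOp {F : Matrix X X ℂ →ₗ[ℂ] Matrix Y Y ℂ}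
    {G : Matrix X' X' ℂ →ₗ[ℂ] Matrix Y' Y' ℂ} (hF : IsCompletelyPositive F)
    (hG : IsCompletelyPositive G) : IsCompletelyPositive (tensorOp F G) := by
  obtain ⟨n, K, hK⟩ := hF
  obtain ⟨m, L, hL⟩ := hG
  have key : _root_.tensorOp F G = ∑ p : Fin n × Fin m,
      conjOp (K p.1 ⊗ₖ L p.2) :=
    kronecker_ext fun A B => by
      simp only [tensorOp_kronecker, hK, hL, kronecker_sum, LinearMap.sum_apply,
        Fintype.sum_prod_type]
      simp [Matrix.mul_kronecker_mul, Matrix.conjTranspose_kronecker]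
  exact .of_fintype (fun p : Fin n × Fin m => K p.1 ⊗ₖ L p.2) fun ρ => by
    rw [key]; simp

lemma IsTracePreserving.tensorOp {F : Matrix X X ℂ →ₗ[ℂ] Matrix Y Y ℂ}
    {G : Matrix X' X' ℂ →ₗ[ℂ] Matrix Y' Y' ℂ} (hF : IsTracePreserving F)
    (hG : IsTracePreserving G) : IsTracePreserving (tensorOp F G) := by
  have : Matrix.traceLinearMap (Y × Y') ℂ ℂ ∘ₗ _root_.tensorOp F G =
      Matrix.traceLinearMap (X × X') ℂ ℂ := kronecker_ext fun A B => by
    simp [Matrix.trace_kronecker, hF A, hG B]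
  exact fun ρ => LinearMap.congr_fun this ρ

end Tensor
end CompletelyPositive

section Discard
open Matrix
open scoped Kronecker ComplexOrder
variable {X Y Z X' Y' Z' : Type} [Fintype X] [Fintype Y] [Fintype Z] [Fintype X'] [Fintype Y']
  [Fintype Z'] [DecidableEq X] [DecidableEq Y] [DecidableEq Z]
  [DecidableEq X'] [DecidableEq Y'] [DecidableEq Z']

/-- The map `L(ℂ^X) → L(ℂ^Y)` that embeds `ℂ^X` into `ℂ^Y ⊗ ℂ^Z` by `|x⟩ ↦ |r x⟩ ⊗ |s x⟩`, and then
takes the partial trace over `ℂ^Z`. -/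
def discard (r : X → Y) (s : X → Z) : Matrix X X ℂ →ₗ[ℂ] Matrix Y Y ℂ where
  toFun ρ := Matrix.of fun y y' => ∑ x, ∑ x', if r x = y ∧ r x' = y' ∧ s x = s x' then ρ x x' else 0
  map_add' ρ σ := by
    ext y y'
    simp only [Matrix.of_apply, Matrix.add_apply, ← Finset.sum_add_distrib]
    refine Finset.sum_congr rfl fun x _ => Finset.sum_congr rfl fun x' _ => ?_
    split_ifs <;> simp
  map_smul' c ρ := by
    ext y y'
    simp only [Matrix.of_apply, Matrix.smul_apply, RingHom.id_apply, Finset.smul_sum]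
    refine Finset.sum_congr rfl fun x _ => Finset.sum_congr rfl fun x' _ => ?_
    split_ifs <;> simp

lemma discard_apply (r : X → Y) (s : X → Z) (ρ : Matrix X X ℂ) (y y' : Y) :
    discard r s ρ y y' =
      ∑ x, ∑ x', if r x = y ∧ r x' = y' ∧ s x = s x' then ρ x x' else 0 := rfl

lemma discard_isCompletelyPositive (r : X → Y) (s : X → Z) :
    IsCompletelyPositive (discard r s) := by
  refine .of_fintype (fun z : Z => Matrix.of fun y x => if r x = y ∧ s x = z then 1 else 0)
    fun ρ => ?_
  ext y y'
  simp only [discard_apply, Matrix.sum_apply, Matrix.mul_apply, Matrix.conjTranspose_apply,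
    Matrix.of_apply, Finset.sum_mul]
  rw [Finset.sum_comm, Finset.sum_comm (γ := Z)]
  refine Finset.sum_congr rfl fun x' _ => ?_
  rw [Finset.sum_comm (γ := Z)]
  refine Finset.sum_congr rfl fun x _ => ?_
  rw [Finset.sum_eq_single (s x)]
  · by_cases h : r x = y <;> by_cases h' : r x' = y' <;> by_cases h'' : s x' = s x <;>
      simp [h, h', h'', eq_comm]
  · intro z _ hz
    simp [Ne.symm hz]
  · simp

lemma discard_isTracePreserving (r : X → Y) (s : X → Z)
    (h : ∀ x x', r x = r x' → s x = s x' → x = x') : IsTracePreserving (discard r s) := by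
  intro ρ
  simp only [Matrix.trace, Matrix.diag_apply, discard_apply]
  rw [Finset.sum_comm]
  refine Finset.sum_congr rfl fun x _ => ?_
  rw [Finset.sum_eq_single (r x), Finset.sum_eq_single x]
  · simp
  · intro x' _ hx
    rw [if_neg]
    exact fun h' => hx (h x' x h'.2.1 h'.2.2.symm)
  · simp
  · intro y _ hy
    exact Finset.sum_eq_zero fun x' _ => if_neg fun h' => hy h'.1.symm
  · simp

lemma discard_comp (r : X → Y) (s : X → Z) (r' : Y → X') (s' : Y → Z') :
    discard r' s' ∘ₗ discard r s = discard (r' ∘ r) (fun x => (s x, s' (r x))) := by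
  ext1 ρ
  ext w w'
  simp only [LinearMap.comp_apply, discard_apply]
  rw [← Fintype.sum_prod_type', ← Fintype.sum_prod_type']
  have : ∀ q : Y × Y, (if r' q.1 = w ∧ r' q.2 = w' ∧ s' q.1 = s' q.2 then
      ∑ x, ∑ x', if r x = q.1 ∧ r x' = q.2 ∧ s x = s x' then ρ x x' else 0 else 0) =
      ∑ p : X × X, if (r p.1, r p.2) = q then (if r' (r p.1) = w ∧ r' (r p.2) = w' ∧
        (s p.1 = s p.2 ∧ s' (r p.1) = s' (r p.2)) then ρ p.1 p.2 else 0) else 0 := by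
    rintro ⟨y, y'⟩
    rw [Fintype.sum_prod_type]
    by_cases h : r' y = w ∧ r' y' = w' ∧ s' y = s' y'
    · rw [if_pos h]
      refine Finset.sum_congr rfl fun x _ => Finset.sum_congr rfl fun x' _ => ?_
      by_cases h1 : r x = y
      · by_cases h2 : r x' = y'
        · simp [h1, h2, h.1, h.2.1, h.2.2]
        · simp [h2]
      · simp [h1]
    · rw [if_neg h]
      refine (Finset.sum_eq_zero fun x _ => Finset.sum_eq_zero fun x' _ => ?_).symm
      by_cases h1 : r x = y
      · by_cases h2 : r x' = y'
        · rw [if_pos (by simp [h1, h2]), if_neg]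
          simp only [h1, h2]
          exact fun h' => h ⟨h'.1, h'.2.1, h'.2.2.2⟩
        · simp [h2]
      · simp [h1]
  simp only [this]
  rw [Finset.sum_comm]
  simp

lemma discard_congr {r r' : X → Y} {s : X → Z} {s' : X → Z'} (hr : ∀ x, r x = r' x)
    (hs : ∀ x x', s x = s x' ↔ s' x = s' x') : discard r s = discard r' s' := by
  obtain rfl : r = r' := funext hr
  ext1 ρ
  ext y y'
  simp only [discard_apply, hs]

lemma discard_equiv (e : X ≃ Y) (s : X → Z) (hs : ∀ x x', s x = s x') (ρ : Matrix X X ℂ) :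
    discard e s ρ = ρ.submatrix e.symm e.symm := by
  ext y y'
  simp only [discard_apply, ← Equiv.eq_symm_apply e]
  rw [Finset.sum_eq_single (e.symm y), Finset.sum_eq_single (e.symm y')]
  · simp [hs (e.symm y) (e.symm y')]
  all_goals simp +contextual

/-- The map `L(ℂ^X) → L(ℂ^Y)` given by the unitary that permutes the basis by `e`. -/
def relabel (e : X ≃ Y) : Matrix X X ℂ →ₗ[ℂ] Matrix Y Y ℂ :=
  (Matrix.reindexLinearEquiv ℂ ℂ e e).toLinearMap

lemma relabel_eq (e : X ≃ Y) : relabel e = discard e (fun _ => ()) := by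
  ext1 ρ
  rw [discard_equiv e _ (fun _ _ => rfl)]
  rfl

lemma relabel_isCompletelyPositive (e : X ≃ Y) : IsCompletelyPositive (relabel e) :=
  relabel_eq e ▸ discard_isCompletelyPositive _ _

lemma relabel_isTracePreserving (e : X ≃ Y) : IsTracePreserving (relabel e) :=
  relabel_eq e ▸ discard_isTracePreserving _ _ fun _ _ h _ => e.injective h

lemma discard_fst_kronecker (A : Matrix X X ℂ) (B : Matrix Y Y ℂ) :
    discard Prod.fst Prod.snd (A ⊗ₖ B) = B.trace • A := by
  ext x x'
  simp only [discard_apply, Fintype.sum_prod_type, Matrix.kroneckerMap_apply]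
  rw [Finset.sum_eq_single x (fun x₁ _ h => Finset.sum_eq_zero fun y _ => Finset.sum_eq_zero
    fun x₂ _ => Finset.sum_eq_zero fun y' _ => if_neg fun h' => h h'.1) (by simp)]
  simp only [Matrix.trace, Matrix.diag_apply, Matrix.smul_apply, smul_eq_mul, Finset.sum_mul]
  refine Finset.sum_congr rfl fun y _ => ?_
  rw [Finset.sum_eq_single x' (fun x₂ _ h => Finset.sum_eq_zero fun y' _ =>
    if_neg fun h' => h h'.2.1) (by simp)]
  simp [mul_comm]

lemma discard_snd_kronecker (A : Matrix X X ℂ) (B : Matrix Y Y ℂ) :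
    discard Prod.snd Prod.fst (A ⊗ₖ B) = A.trace • B := by
  ext y y'
  simp only [discard_apply, Fintype.sum_prod_type, Matrix.kroneckerMap_apply]
  simp only [Matrix.trace, Matrix.diag_apply, Matrix.smul_apply, smul_eq_mul, Finset.sum_mul]
  refine Finset.sum_congr rfl fun x _ => ?_
  rw [Finset.sum_eq_single y (fun y₁ _ h => Finset.sum_eq_zero
    fun x₂ _ => Finset.sum_eq_zero fun y' _ => if_neg fun h' => h h'.1) (by simp)]
  rw [Finset.sum_comm, Finset.sum_eq_single y' (fun y₂ _ h => Finset.sum_eq_zero fun x' _ =>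
    if_neg fun h' => h h'.2.1) (by simp)]
  simp

lemma trace_tensorOp (F : Matrix X X ℂ →ₗ[ℂ] Matrix Y Y ℂ)
    (G : Matrix X' X' ℂ →ₗ[ℂ] Matrix Y' Y' ℂ) (ρ : Matrix (X × X') (X × X') ℂ) :
    (tensorOp F G ρ).trace =
      (F (discard Prod.fst Prod.snd (tensorOp LinearMap.id G ρ))).trace := by
  have : Matrix.traceLinearMap (Y × Y') ℂ ℂ ∘ₗ tensorOp F G =
      Matrix.traceLinearMap Y ℂ ℂ ∘ₗ F ∘ₗ discard Prod.fst Prod.snd ∘ₗ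
        tensorOp LinearMap.id G := kronecker_ext fun A B => by
    simp [Matrix.trace_kronecker, discard_fst_kronecker, mul_comm]
  exact LinearMap.congr_fun this ρ

lemma trace_tensorOp_id (G : Matrix X' X' ℂ →ₗ[ℂ] Matrix Y' Y' ℂ)
    (ρ : Matrix (X × X') (X × X') ℂ) :
    (discard Prod.fst Prod.snd (tensorOp (LinearMap.id : Matrix X X ℂ →ₗ[ℂ] _) G ρ)).trace =
      (G (discard Prod.snd Prod.fst ρ)).trace := by
  have : Matrix.traceLinearMap X ℂ ℂ ∘ₗ discard Prod.fst Prod.snd ∘ₗ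
        tensorOp (LinearMap.id : Matrix X X ℂ →ₗ[ℂ] _) G =
      Matrix.traceLinearMap Y' ℂ ℂ ∘ₗ G ∘ₗ discard Prod.snd Prod.fst :=
    kronecker_ext fun A B => by
      simp [discard_snd_kronecker, discard_fst_kronecker, mul_comm]
  exact LinearMap.congr_fun this ρ

lemma trace_discard_snd (ρ : Matrix (X × X') (X × X') ℂ) :
    (discard Prod.snd Prod.fst ρ).trace = ρ.trace :=
  discard_isTracePreserving _ _ (fun _ _ h h' => Prod.ext h' h) ρ

end Discard

/-! ## Simple trace preserving superoperators -/

/-- An object of the category of simple trace preserving superoperators: a finite dimensional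
Hilbert space `ℂ^X`, given by its orthonormal basis `X`. Operators on it are matrices. -/
structure SimpleSuperop : Type where
  space : FinSet

namespace SimpleSuperop
open scoped Kronecker

section Coherence
open scoped Kronecker
variable {X X' Y Y' Z Z' W : Type} [Fintype X] [Fintype X'] [Fintype Y] [Fintype Y']
  [Fintype Z] [Fintype Z'] [DecidableEq X] [DecidableEq X'] [DecidableEq Y] [DecidableEq Y']
  [DecidableEq Z] [DecidableEq Z'] [Fintype W] [DecidableEq W]

lemma relabel_relabel (e : X ≃ Y) (f : Y ≃ Z) :
    relabel f ∘ₗ relabel e = relabel (e.trans f) := by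
  ext1 ρ; ext; simp [relabel]

lemma tensorOp_relabel (e : X ≃ Y) (f : X' ≃ Y') :
    tensorOp (relabel e) (relabel f) = relabel (e.prodCongr f) :=
  kronecker_ext fun A B => by
    rw [tensorOp_kronecker]
    ext; simp [relabel]

lemma relabel_refl : relabel (Equiv.refl X) = LinearMap.id := by
  ext1 ρ; ext; simp [relabel]

lemma assoc_nat (F : Matrix X X ℂ →ₗ[ℂ] Matrix X' X' ℂ) (G : Matrix Y Y ℂ →ₗ[ℂ] Matrix Y' Y' ℂ)
    (H : Matrix Z Z ℂ →ₗ[ℂ] Matrix Z' Z' ℂ) :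
    relabel (Equiv.prodAssoc X' Y' Z') ∘ₗ tensorOp (tensorOp F G) H =
      tensorOp F (tensorOp G H) ∘ₗ relabel (Equiv.prodAssoc X Y Z) :=
  kronecker_ext₃ fun A B C => by
    have h : ∀ (U V W : Type) (A : Matrix U U ℂ) (B : Matrix V V ℂ) (C : Matrix W W ℂ),
        relabel (Equiv.prodAssoc U V W) (A ⊗ₖ B ⊗ₖ C) = A ⊗ₖ (B ⊗ₖ C) := by
      intros
      ext; simp [relabel, mul_assoc]
    simp [h]

lemma left_nat (F : Matrix X X ℂ →ₗ[ℂ] Matrix X' X' ℂ) :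
    relabel (Equiv.punitProd X') ∘ₗ tensorOp LinearMap.id F =
      F ∘ₗ relabel (Equiv.punitProd X) :=
  kronecker_ext fun A B => by
    have h : ∀ (U : Type) (A : Matrix Unit Unit ℂ) (B : Matrix U U ℂ),
        relabel (Equiv.punitProd U) (A ⊗ₖ B) = A () () • B := by
      intros
      ext; simp [relabel]
    simp [h]

lemma right_nat (F : Matrix X X ℂ →ₗ[ℂ] Matrix X' X' ℂ) :
    relabel (Equiv.prodPUnit X') ∘ₗ tensorOp F LinearMap.id =
      F ∘ₗ relabel (Equiv.prodPUnit X) :=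
  kronecker_ext fun A B => by
    have h : ∀ (U : Type) (A : Matrix Unit Unit ℂ) (B : Matrix U U ℂ),
        relabel (Equiv.prodPUnit U) (B ⊗ₖ A) = A () () • B := by
      intros
      ext; simp [relabel, mul_comm]
    simp [h]

lemma swap_nat (F : Matrix X X ℂ →ₗ[ℂ] Matrix X' X' ℂ) (G : Matrix Y Y ℂ →ₗ[ℂ] Matrix Y' Y' ℂ) :
    relabel (Equiv.prodComm X' Y') ∘ₗ tensorOp F G =
      tensorOp G F ∘ₗ relabel (Equiv.prodComm X Y) :=
  kronecker_ext fun A B => by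
    have h : ∀ (U V : Type) (A : Matrix U U ℂ) (B : Matrix V V ℂ),
        relabel (Equiv.prodComm U V) (A ⊗ₖ B) = B ⊗ₖ A := by
      intros
      ext; simp [relabel, mul_comm]
    simp [h]

variable (W X Y Z)

lemma pent :
    (tensorOp LinearMap.id (relabel (Equiv.prodAssoc X Y Z)) ∘ₗ
      relabel (Equiv.prodAssoc W (X × Y) Z)) ∘ₗ
        tensorOp (relabel (Equiv.prodAssoc W X Y)) LinearMap.id =
      relabel (Equiv.prodAssoc W X (Y × Z)) ∘ₗ relabel (Equiv.prodAssoc (W × X) Y Z) := by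
  simp only [← relabel_refl, tensorOp_relabel, relabel_relabel]
  rfl

lemma tri :
    tensorOp LinearMap.id (relabel (Equiv.punitProd Y)) ∘ₗ relabel (Equiv.prodAssoc X Unit Y) =
      tensorOp (relabel (Equiv.prodPUnit X)) LinearMap.id := by
  simp only [← relabel_refl, tensorOp_relabel, relabel_relabel]
  rfl

lemma hex :
    (relabel (Equiv.prodAssoc Y Z X) ∘ₗ relabel (Equiv.prodComm X (Y × Z))) ∘ₗ
        relabel (Equiv.prodAssoc X Y Z) =
      (tensorOp LinearMap.id (relabel (Equiv.prodComm X Z)) ∘ₗ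
        relabel (Equiv.prodAssoc Y X Z)) ∘ₗ
        tensorOp (relabel (Equiv.prodComm X Y)) LinearMap.id := by
  simp only [← relabel_refl, tensorOp_relabel, relabel_relabel]
  rfl

lemma hex' :
    (relabel (Equiv.prodAssoc Z X Y).symm ∘ₗ relabel (Equiv.prodComm (X × Y) Z)) ∘ₗ
        relabel (Equiv.prodAssoc X Y Z).symm =
      (tensorOp (relabel (Equiv.prodComm X Z)) LinearMap.id ∘ₗ
        relabel (Equiv.prodAssoc X Z Y).symm) ∘ₗ
        tensorOp LinearMap.id (relabel (Equiv.prodComm Y Z)) := by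
  simp only [← relabel_refl, tensorOp_relabel, relabel_relabel]
  rfl

lemma swap_swap :
    relabel (Equiv.prodComm Y X) ∘ₗ relabel (Equiv.prodComm X Y) = LinearMap.id := by
  rw [relabel_relabel, ← relabel_refl]
  rfl

end Coherence

/-- A simple trace preserving superoperator. -/
@[ext]
structure Hom (H K : SimpleSuperop) : Type where
  lin : Matrix H.space H.space ℂ →ₗ[ℂ] Matrix K.space K.space ℂ
  isCompletelyPositive : IsCompletelyPositive lin
  isTracePreserving : IsTracePreserving lin

instance : SmallCategory SimpleSuperop where
  Hom := Hom
  id H := ⟨LinearMap.id, .id, fun _ => rfl⟩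
  comp f g := ⟨g.lin ∘ₗ f.lin, g.isCompletelyPositive.comp f.isCompletelyPositive,
    fun ρ => (g.isTracePreserving _).trans (f.isTracePreserving ρ)⟩

@[simp] lemma id_lin (H : SimpleSuperop) : Hom.lin (𝟙 H) = LinearMap.id := rfl
@[simp] lemma comp_lin {H K L : SimpleSuperop} (f : H ⟶ K) (g : K ⟶ L) :
    (f ≫ g).lin = g.lin ∘ₗ f.lin := rfl

lemma hom_ext {H K : SimpleSuperop} {f g : H ⟶ K} (h : f.lin = g.lin) : f = g := Hom.ext h

/-- `H ⊗ K`. -/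
def tensor (H K : SimpleSuperop) : SimpleSuperop := ⟨.prod H.space K.space⟩

def unit : SimpleSuperop := ⟨.unit⟩

def tensorMap {H H' K K' : SimpleSuperop} (f : H ⟶ K) (g : H' ⟶ K') : tensor H H' ⟶ tensor K K' :=
  ⟨tensorOp f.lin g.lin, f.isCompletelyPositive.tensorOp g.isCompletelyPositive,
    f.isTracePreserving.tensorOp g.isTracePreserving⟩

/-- A bijection of bases as an isomorphism. -/
def relabelIso {H K : SimpleSuperop} (e : H.space ≃ K.space) : H ≅ K where
  hom := ⟨relabel e, relabel_isCompletelyPositive e, relabel_isTracePreserving e⟩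
  inv := ⟨relabel e.symm, relabel_isCompletelyPositive e.symm, relabel_isTracePreserving e.symm⟩
  hom_inv_id := hom_ext (by ext1 ρ; ext; simp [relabel])
  inv_hom_id := hom_ext (by ext1 ρ; ext; simp [relabel])

instance : MonoidalCategoryStruct SimpleSuperop where
  tensorObj := tensor
  tensorUnit := unit
  tensorHom := tensorMap
  whiskerLeft H {_ _} g := tensorMap (𝟙 H) g
  whiskerRight f K := tensorMap f (𝟙 K)
  associator H K L := relabelIso (Equiv.prodAssoc H.space K.space L.space)
  leftUnitor H := relabelIso (Equiv.punitProd H.space)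
  rightUnitor H := relabelIso (Equiv.prodPUnit H.space)

@[simp] lemma relabelIso_hom_lin {H K : SimpleSuperop} (e : H.space ≃ K.space) :
    (relabelIso e).hom.lin = relabel e := rfl
@[simp] lemma tensorMap_lin {H H' K K' : SimpleSuperop} (f : H ⟶ K) (g : H' ⟶ K') :
    (tensorMap f g).lin = tensorOp f.lin g.lin := rfl

instance : MonoidalCategory SimpleSuperop := .ofTensorHom
  (id_tensorHom_id := fun _ _ => hom_ext tensorOp_id)
  (tensorHom_comp_tensorHom := fun f g h k => hom_ext (tensorOp_comp _ _ _ _).symm)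
  (associator_naturality := fun f g h => hom_ext (assoc_nat f.lin g.lin h.lin))
  (leftUnitor_naturality := fun f => hom_ext (left_nat f.lin))
  (rightUnitor_naturality := fun f => hom_ext (right_nat f.lin))
  (pentagon := fun H K L M => hom_ext (pent K.space L.space M.space H.space))
  (triangle := fun H K => hom_ext (tri H.space K.space))

instance : SymmetricCategory SimpleSuperop where
  braiding H K := relabelIso (Equiv.prodComm H.space K.space)
  braiding_naturality_right H _ _ f := hom_ext (swap_nat LinearMap.id f.lin)
  braiding_naturality_left f H := hom_ext (swap_nat f.lin LinearMap.id)
  hexagon_forward H K L := hom_ext (hex H.space K.space L.space)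
  hexagon_reverse H K L := hom_ext (hex' H.space K.space L.space)
  symmetry H K := hom_ext (swap_swap H.space K.space)

end SimpleSuperop

namespace Fwm

/-- The factors of a basis vector `⊗ x_i` of `⊗ V_i` that are kept by `f : V ⟶ W`, as a basis vector
of `⊗ W_j`. -/
def restrict {V W : Fwm FinSet} (f : V ⟶ W) (x : ∀ i, V.obj i) (j : Fin W.len) : W.obj j :=
  cast (congrArg FinSet.El (f.obj_map j)) (x (f.map j))

/-- The factors of a basis vector `⊗ x_i` of `⊗ V_i` that are not kept by `f : V ⟶ W`. -/
def rest {V W : Fwm FinSet} (f : V ⟶ W) (x : ∀ i, V.obj i) (i : {i // ∀ j, f.map j ≠ i}) :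
    V.obj i :=
  x i

lemma restrict_eq_iff {V W : Fwm FinSet} (f : V ⟶ W) (x x' : ∀ i, V.obj i) (j : Fin W.len) :
    restrict f x j = restrict f x' j ↔ x (f.map j) = x' (f.map j) :=
  cast_inj _

lemma restrict_comp {U V W : Fwm FinSet} (f : U ⟶ V) (g : V ⟶ W) (x : ∀ i, U.obj i) :
    restrict (f ≫ g) x = restrict g (restrict f x) := by
  funext j
  simp [restrict]

lemma rest_comp {U V W : Fwm FinSet} (f : U ⟶ V) (g : V ⟶ W) (x x' : ∀ i, U.obj i) :
    rest (f ≫ g) x = rest (f ≫ g) x' ↔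
      (rest f x, rest g (restrict f x)) = (rest f x', rest g (restrict f x')) := by
  simp only [Prod.mk.injEq, funext_iff, rest, Subtype.forall]
  constructor
  · intro h
    refine ⟨fun i hi => h i fun j => hi _, fun j hj => ?_⟩
    rw [restrict_eq_iff]
    exact h _ fun k hk => hj k (f.injective hk)
  · rintro ⟨h1, h2⟩ i hi
    by_cases hf : ∀ j, f.map j ≠ i
    · exact h1 i hf
    · push Not at hf
      obtain ⟨j, rfl⟩ := hf
      rw [← restrict_eq_iff]
      exact h2 j fun k hk => hi k (congrArg f.map hk)

/-- The strong monoidal functor that extends the inclusion of the discrete category of Hilbert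
spaces: `{V_1, …, V_n}` is sent to `V_1 ⊗ … ⊗ V_n`, and a morphism traces out the factors that it
does not keep and permutes the other ones. -/
def toSuperop : Fwm FinSet ⥤ SimpleSuperop where
  obj V := ⟨.pi V.len V.obj⟩
  map {V W} f := ⟨discard (X := ∀ i, V.obj i) (Y := ∀ j, W.obj j) (restrict f) (rest f),
    discard_isCompletelyPositive _ _,
    discard_isTracePreserving _ _ fun x x' h h' => by
      funext i
      by_cases hf : ∀ j, f.map j ≠ i
      · exact congrFun h' ⟨i, hf⟩
      · push Not at hf
        obtain ⟨j, rfl⟩ := hf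
        exact (restrict_eq_iff f x x' j).1 (congrFun h j)⟩
  map_id V := SimpleSuperop.hom_ext (by
    ext1 ρ
    refine (discard_equiv (Equiv.refl _) _ (fun x x' => ?_) ρ).trans (by ext; rfl)
    funext ⟨i, hi⟩
    exact absurd rfl (hi i))
  map_comp f g := SimpleSuperop.hom_ext (by
    refine Eq.trans ?_ (discard_comp (restrict f) (rest f) (restrict g) (rest g)).symm
    exact discard_congr (restrict_comp f g) (rest_comp f g))

end Fwm

/-! ## The category `Q` -/

/-- An object of the category `Q`: a finite family of finite dimensional Hilbert spaces. -/
structure Superop : Type where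
  index : FinSet
  space : index → FinSet

namespace Superop
open scoped ComplexOrder

/-- A trace non-increasing superoperator: a matrix of completely positive maps with
`∑ i, tr (F_{ij} ρ) ≤ tr ρ` for all `j` and all positive `ρ`. (The traces of positive operators are
real.) -/
@[ext]
structure Hom (H K : Superop) : Type where
  entry (i : K.index) (j : H.index) :
    Matrix (H.space j) (H.space j) ℂ →ₗ[ℂ] Matrix (K.space i) (K.space i) ℂ
  isCompletelyPositive (i : K.index) (j : H.index) : IsCompletelyPositive (entry i j)
  trace_le (j : H.index) (ρ : Matrix (H.space j) (H.space j) ℂ) :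
    ρ.PosSemidef → (∑ i, (entry i j ρ).trace).re ≤ ρ.trace.re

/-- The matrix of a family of maps `F_j : L(H_j) → L(K_{m j})`: its entry at `(m j, j)` is `F_j`, and
all other entries are `0`. -/
def matrixEntry {H K : Superop} (m : H.index → K.index)
    (F : ∀ j, Matrix (H.space j) (H.space j) ℂ →ₗ[ℂ] Matrix (K.space (m j)) (K.space (m j)) ℂ)
    (i : K.index) (j : H.index) :
    Matrix (H.space j) (H.space j) ℂ →ₗ[ℂ] Matrix (K.space i) (K.space i) ℂ :=
  if h : m j = i then h ▸ F j else 0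

section
variable {H K L : Superop} (m : H.index → K.index)
    (F : ∀ j, Matrix (H.space j) (H.space j) ℂ →ₗ[ℂ] Matrix (K.space (m j)) (K.space (m j)) ℂ)

lemma matrixEntry_self (j : H.index) : matrixEntry m F (m j) j = F j := by
  simp [matrixEntry]

lemma matrixEntry_ne {i : K.index} {j : H.index} (h : m j ≠ i) : matrixEntry m F i j = 0 := by
  simp [matrixEntry, h]

lemma comp_matrixEntry {i : L.index} {j : H.index}
    (G : ∀ k, Matrix (K.space k) (K.space k) ℂ →ₗ[ℂ] Matrix (L.space i) (L.space i) ℂ) :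
    ∑ k, G k ∘ₗ matrixEntry m F k j = G (m j) ∘ₗ F j := by
  rw [Finset.sum_eq_single (m j), matrixEntry_self]
  · intro k _ hk
    rw [matrixEntry_ne m F (Ne.symm hk), LinearMap.comp_zero]
  · simp

lemma matrixEntry_comp (hm : Function.Injective m) {i : H.index} {j : L.index}
    (G : ∀ k, Matrix (L.space j) (L.space j) ℂ →ₗ[ℂ] Matrix (H.space k) (H.space k) ℂ) :
    ∑ k, matrixEntry m F (m i) k ∘ₗ G k = F i ∘ₗ G i := by
  rw [Finset.sum_eq_single i, matrixEntry_self]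
  · intro k _ hk
    rw [matrixEntry_ne m F (fun h => hk (hm h)), LinearMap.zero_comp]
  · simp

/-- The morphism of `Q` given by a family of trace preserving maps `F_j : L(H_j) → L(K_{m j})`. -/
def ofFamily (hF : ∀ j, IsCompletelyPositive (F j)) (hF' : ∀ j, IsTracePreserving (F j)) :
    Hom H K where
  entry := matrixEntry m F
  isCompletelyPositive i j := by
    by_cases h : m j = i
    · subst h
      rw [matrixEntry_self]
      exact hF j
    · rw [matrixEntry_ne m F h]
      exact .zero
  trace_le j ρ _ := by
    rw [Finset.sum_eq_single (m j), matrixEntry_self, hF' j ρ]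
    · intro k _ hk
      rw [matrixEntry_ne m F (Ne.symm hk)]
      simp
    · simp

end

lemma comp_trace_le {H K L : Superop} (f : Hom H K) (g : Hom K L) (j : H.index)
    (ρ : Matrix (H.space j) (H.space j) ℂ) (hρ : ρ.PosSemidef) :
    (∑ i, ((∑ k, g.entry i k ∘ₗ f.entry k j) ρ).trace).re ≤ ρ.trace.re := by
  refine le_trans ?_ (f.trace_le j ρ hρ)
  simp only [LinearMap.sum_apply, Matrix.trace_sum, LinearMap.comp_apply]
  rw [Finset.sum_comm, Complex.re_sum, Complex.re_sum]
  exact Finset.sum_le_sum fun k _ =>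
    g.trace_le k _ ((f.isCompletelyPositive k j).posSemidef hρ)

lemma comp_sum' {ι A B C : Type} [AddCommMonoid A] [AddCommMonoid B] [AddCommMonoid C] [Module ℂ A]
    [Module ℂ B] [Module ℂ C] (s : Finset ι) (F : B →ₗ[ℂ] C) (G : ι → (A →ₗ[ℂ] B)) :
    F ∘ₗ (∑ i ∈ s, G i) = ∑ i ∈ s, F ∘ₗ G i := by
  ext1 x; simp

lemma sum_comp' {ι A B C : Type} [AddCommMonoid A] [AddCommMonoid B] [AddCommMonoid C] [Module ℂ A]
    [Module ℂ B] [Module ℂ C] (s : Finset ι) (F : A →ₗ[ℂ] B) (G : ι → (B →ₗ[ℂ] C)) :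
    (∑ i ∈ s, G i) ∘ₗ F = ∑ i ∈ s, G i ∘ₗ F := by
  ext1 x; simp

/-- Composition is matrix multiplication. The entries of the identity matrix are identities on the
diagonal and `0` elsewhere. -/
instance : SmallCategory Superop where
  Hom := Hom
  id H := ofFamily id (fun _ => LinearMap.id) (fun _ => .id) (fun _ _ => rfl)
  comp {H K L} f g :=
    { entry := fun i j => ∑ k, g.entry i k ∘ₗ f.entry k j
      isCompletelyPositive := fun i j => .sum _ fun k =>
        (g.isCompletelyPositive i k).comp (f.isCompletelyPositive k j)
      trace_le := comp_trace_le f g }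
  id_comp f := Hom.ext (funext fun i => funext fun j => comp_matrixEntry id _ _)
  comp_id f := Hom.ext (funext fun i => funext fun j =>
    matrixEntry_comp id (fun _ => LinearMap.id) Function.injective_id _)
  assoc f g h := Hom.ext (funext fun i => funext fun j => by
    simp only [comp_sum', sum_comp']
    rw [Finset.sum_comm]
    rfl)

lemma hom_ext {H K : Superop} {f g : H ⟶ K} (h : ∀ i j, f.entry i j = g.entry i j) : f = g :=
  Hom.ext (funext fun i => funext fun j => h i j)

lemma comp_entry {H K L : Superop} (f : H ⟶ K) (g : K ⟶ L) (i : L.index) (j : H.index) :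
    (f ≫ g).entry i j = ∑ k, g.entry i k ∘ₗ f.entry k j := rfl

/-- The same family, as an object of the coproduct completion of the category of simple trace
preserving superoperators. -/
abbrev fam (H : Superop) : FinFam SimpleSuperop := ⟨H.index, fun j => ⟨H.space j⟩⟩

/-- The morphism of `Q` given by a morphism of families. -/
def ofHom {H K : Superop} (f : H.fam ⟶ K.fam) : H ⟶ K :=
  ofFamily f.map (fun j => (f.app j).lin) (fun j => (f.app j).isCompletelyPositive)
    (fun j => (f.app j).isTracePreserving)

lemma ofHom_comp_entry {H K L : Superop} (f : H.fam ⟶ K.fam) (g : K ⟶ L) (i : L.index)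
    (j : H.index) : (ofHom f ≫ g).entry i j = g.entry i (f.map j) ∘ₗ (f.app j).lin :=
  comp_matrixEntry f.map (fun j => (f.app j).lin) (g.entry i)

lemma comp_ofHom_entry {H K L : Superop} (f : H.fam ⟶ K.fam) (hf : Function.Injective f.map)
    (g : L ⟶ H) (i : H.index) (j : L.index) :
    (g ≫ ofHom f).entry (f.map i) j = (f.app i).lin ∘ₗ g.entry i j :=
  matrixEntry_comp f.map (fun j => (f.app j).lin) hf (fun k => g.entry k j)

lemma ofHom_entry_self {H K : Superop} (f : H.fam ⟶ K.fam) (j : H.index) :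
    (ofHom f).entry (f.map j) j = (f.app j).lin :=
  matrixEntry_self f.map (fun j => (f.app j).lin) j

lemma ofHom_entry_ne {H K : Superop} (f : H.fam ⟶ K.fam) {i : K.index} {j : H.index}
    (h : f.map j ≠ i) : (ofHom f).entry i j = 0 :=
  matrixEntry_ne f.map (fun j => (f.app j).lin) h

lemma ofHom_id (H : Superop) : ofHom (𝟙 H.fam) = 𝟙 H := rfl

lemma ofHom_comp {H K L : Superop} (f : H.fam ⟶ K.fam) (g : K.fam ⟶ L.fam) :
    ofHom (f ≫ g) = ofHom f ≫ ofHom g := by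
  refine hom_ext fun i j => ?_
  rw [ofHom_comp_entry]
  by_cases h : g.map (f.map j) = i
  · subst h
    rw [ofHom_entry_self g]
    exact ofHom_entry_self (f ≫ g) j
  · rw [ofHom_entry_ne g h, LinearMap.zero_comp]
    exact ofHom_entry_ne (f ≫ g) h

/-- The functor that preserves finite coproducts and extends the inclusion of the simple trace
preserving superoperators into `Q`. -/
def ofFam : FinFam SimpleSuperop ⥤ Superop where
  obj V := ⟨V.index, fun a => (V.obj a).space⟩
  map {V W} f := ofHom (H := ⟨V.index, fun a => (V.obj a).space⟩)
    (K := ⟨W.index, fun a => (W.obj a).space⟩) f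
  map_id V := ofHom_id ⟨V.index, fun a => (V.obj a).space⟩
  map_comp {U V W} f g := ofHom_comp (H := ⟨U.index, fun a => (U.obj a).space⟩)
    (K := ⟨V.index, fun a => (V.obj a).space⟩) (L := ⟨W.index, fun a => (W.obj a).space⟩) f g

def ofIso {H K : Superop} (f : H.fam ≅ K.fam) : H ≅ K where
  hom := ofHom f.hom
  inv := ofHom f.inv
  hom_inv_id := by rw [← ofHom_comp, f.hom_inv_id, ofHom_id]
  inv_hom_id := by rw [← ofHom_comp, f.inv_hom_id, ofHom_id]

/-! The symmetric monoidal structure of `Q`. -/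

/-- `(V_i) ⊗ (W_j) = (V_i ⊗ W_j)_{(i, j)}`. -/
def tensor (H K : Superop) : Superop :=
  ⟨.prod H.index K.index, fun p => .prod (H.space p.1) (K.space p.2)⟩

def unit : Superop := ⟨.unit, fun _ => .unit⟩

lemma tensor_trace_le {H H' K K' : Superop} (f : H ⟶ K) (g : H' ⟶ K') (j : H.index)
    (j' : H'.index) (ρ : Matrix (H.space j × H'.space j') (H.space j × H'.space j') ℂ)
    (hρ : ρ.PosSemidef) :
    (∑ p : K.index × K'.index, (tensorOp (f.entry p.1 j) (g.entry p.2 j') ρ).trace).re ≤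
      ρ.trace.re := by
  rw [Fintype.sum_prod_type_right, ← trace_discard_snd ρ]
  refine le_trans ?_ (g.trace_le j' (discard Prod.snd Prod.fst ρ)
    ((discard_isCompletelyPositive _ _).posSemidef hρ))
  rw [Complex.re_sum, Complex.re_sum]
  refine Finset.sum_le_sum fun i' _ => ?_
  rw [← trace_tensorOp_id]
  simp only [trace_tensorOp]
  exact f.trace_le j _ ((discard_isCompletelyPositive _ _).posSemidef
    ((IsCompletelyPositive.id.tensorOp (g.isCompletelyPositive i' j')).posSemidef hρ))

/-- The tensor product of matrices, with entries `F_{ij} ⊗ G_{i'j'}`. -/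
def tensorMap {H H' K K' : Superop} (f : H ⟶ K) (g : H' ⟶ K') : tensor H H' ⟶ tensor K K' where
  entry i j := tensorOp (f.entry i.1 j.1) (g.entry i.2 j.2)
  isCompletelyPositive i j := (f.isCompletelyPositive i.1 j.1).tensorOp
    (g.isCompletelyPositive i.2 j.2)
  trace_le j ρ hρ := tensor_trace_le f g j.1 j.2 ρ hρ

lemma ofHom_tensor {H H' K K' : Superop} (f : H.fam ⟶ K.fam) (g : H'.fam ⟶ K'.fam) :
    ofHom (H := tensor H H') (K := tensor K K') (f ⊗ₘ g) = tensorMap (ofHom f) (ofHom g) := by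
  refine hom_ext fun i j => ?_
  obtain ⟨i, i'⟩ := i
  obtain ⟨j, j'⟩ := j
  change _ = tensorOp ((ofHom f).entry i j) ((ofHom g).entry i' j')
  by_cases h : f.map j = i
  · by_cases h' : g.map j' = i'
    · subst h h'
      rw [ofHom_entry_self, ofHom_entry_self]
      exact ofHom_entry_self (H := tensor H H') (K := tensor K K') (f ⊗ₘ g) (j, j')
    · rw [ofHom_entry_ne g h', tensorOp_zero_right]
      exact ofHom_entry_ne _ fun e => h' (congrArg Prod.snd e)
  · rw [ofHom_entry_ne f h, tensorOp_zero_left]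
    exact ofHom_entry_ne _ fun e => h (congrArg Prod.fst e)

lemma tensorMap_comp {H H' K K' L L' : Superop} (f : H ⟶ K) (f' : H' ⟶ K') (g : K ⟶ L)
    (g' : K' ⟶ L') : tensorMap f f' ≫ tensorMap g g' = tensorMap (f ≫ g) (f' ≫ g') := by
  refine hom_ext fun i j => ?_
  obtain ⟨i, i'⟩ := i
  obtain ⟨j, j'⟩ := j
  change ∑ k : K.index × K'.index, tensorOp (g.entry i k.1) (g'.entry i' k.2) ∘ₗ
    tensorOp (f.entry k.1 j) (f'.entry k.2 j') =
    tensorOp (∑ k, g.entry i k ∘ₗ f.entry k j) (∑ k, g'.entry i' k ∘ₗ f'.entry k j')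
  simp only [tensorOp_sum, Fintype.sum_prod_type, tensorOp_comp]

lemma tensorMap_id (H K : Superop) : tensorMap (𝟙 H) (𝟙 K) = 𝟙 (tensor H K) := by
  rw [← ofHom_id, ← ofHom_id, ← ofHom_tensor]
  exact (congrArg ofHom (id_tensorHom_id H.fam K.fam)).trans (ofHom_id (tensor H K))

/-- Naturality can be checked on a family. -/
lemma natural {H H' K K' : Superop} (e : H.fam ≅ H'.fam) (e' : K.fam ≅ K'.fam) (f : H ⟶ K)
    (g : H' ⟶ K') (h : ∀ i j, (e'.hom.app i).lin ∘ₗ f.entry i j =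
      g.entry (e'.hom.map i) (e.hom.map j) ∘ₗ (e.hom.app j).lin) :
    f ≫ ofHom e'.hom = ofHom e.hom ≫ g := by
  have h1 : ∀ i, e'.inv.map (e'.hom.map i) = i := fun i =>
    congrFun (congrArg FinFam.Hom.map e'.hom_inv_id) i
  have h2 : ∀ i, e'.hom.map (e'.inv.map i) = i := fun i =>
    congrFun (congrArg FinFam.Hom.map e'.inv_hom_id) i
  refine hom_ext fun i j => ?_
  obtain ⟨i, rfl⟩ : ∃ i', e'.hom.map i' = i := ⟨_, h2 i⟩
  rw [comp_ofHom_entry _ (Function.LeftInverse.injective h1), ofHom_comp_entry, h]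

instance : MonoidalCategoryStruct Superop where
  tensorObj := tensor
  tensorUnit := unit
  tensorHom := tensorMap
  whiskerLeft H {_ _} g := tensorMap (𝟙 H) g
  whiskerRight f K := tensorMap f (𝟙 K)
  associator H K L := ofIso (H := tensor (tensor H K) L) (K := tensor H (tensor K L))
    (α_ H.fam K.fam L.fam)
  leftUnitor H := ofIso (H := tensor unit H) (λ_ H.fam)
  rightUnitor H := ofIso (H := tensor H unit) (ρ_ H.fam)

section
variable (H K L M : Superop)

lemma whisker_ofFam {H K : Superop} (f : H.fam ⟶ K.fam) :
    tensorMap (ofHom f) (𝟙 L) = ofFam.map (f ⊗ₘ 𝟙 L.fam) :=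
  (ofHom_tensor f (𝟙 L.fam)).symm

lemma ofFam_whisker {H K : Superop} (f : H.fam ⟶ K.fam) :
    tensorMap (𝟙 L) (ofHom f) = ofFam.map (𝟙 L.fam ⊗ₘ f) :=
  (ofHom_tensor (𝟙 L.fam) f).symm

lemma pentagon' : (α_ H K L).hom ▷ M ≫ (α_ H (K ⊗ L) M).hom ≫ H ◁ (α_ K L M).hom =
    (α_ (H ⊗ K) L M).hom ≫ (α_ H K (L ⊗ M)).hom := by
  refine (congrArg₂ (fun x y => x ≫ (α_ H (K ⊗ L) M).hom ≫ y)
    (whisker_ofFam (H := tensor (tensor H K) L) (K := tensor H (tensor K L)) M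
      (α_ H.fam K.fam L.fam).hom)
    (ofFam_whisker (H := tensor (tensor K L) M) (K := tensor K (tensor L M)) H
      (α_ K.fam L.fam M.fam).hom)).trans ?_
  change ofFam.map ((α_ H.fam K.fam L.fam).hom ⊗ₘ 𝟙 M.fam) ≫
    ofFam.map (α_ H.fam (K.fam ⊗ L.fam) M.fam).hom ≫
      ofFam.map (𝟙 H.fam ⊗ₘ (α_ K.fam L.fam M.fam).hom) =
    ofFam.map (α_ (H.fam ⊗ K.fam) L.fam M.fam).hom ≫
      ofFam.map (α_ H.fam K.fam (L.fam ⊗ M.fam)).hom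
  rw [← Functor.map_comp, ← Functor.map_comp, ← Functor.map_comp]
  refine congrArg (CategoryTheory.Functor.map ofFam) ?_
  have := MonoidalCategory.pentagon H.fam K.fam L.fam M.fam
  rwa [← tensorHom_id, ← id_tensorHom] at this

lemma triangle' : (α_ H (𝟙_ Superop) K).hom ≫ H ◁ (λ_ K).hom = (ρ_ H).hom ▷ K := by
  refine (congrArg (fun y => (α_ H (𝟙_ Superop) K).hom ≫ y)
    (ofFam_whisker (H := tensor unit K) (K := K) H (λ_ K.fam).hom)).trans
    (Eq.trans ?_ (whisker_ofFam (H := tensor H unit) (K := H) K (ρ_ H.fam).hom).symm)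
  change ofFam.map (α_ H.fam (𝟙_ _) K.fam).hom ≫ ofFam.map (𝟙 H.fam ⊗ₘ (λ_ K.fam).hom) =
    ofFam.map ((ρ_ H.fam).hom ⊗ₘ 𝟙 K.fam)
  rw [← Functor.map_comp]
  refine congrArg (CategoryTheory.Functor.map ofFam) ?_
  have := MonoidalCategory.triangle H.fam K.fam
  rwa [← tensorHom_id, ← id_tensorHom] at this

end

instance : MonoidalCategory Superop := .ofTensorHom
  (id_tensorHom_id := tensorMap_id)
  (tensorHom_comp_tensorHom := tensorMap_comp)
  (associator_naturality := fun {H₁ H₂ H₃ K₁ K₂ K₃} f g h =>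
    natural (H := tensor (tensor H₁ H₂) H₃) (H' := tensor H₁ (tensor H₂ H₃))
      (K := tensor (tensor K₁ K₂) K₃) (K' := tensor K₁ (tensor K₂ K₃))
      (α_ H₁.fam H₂.fam H₃.fam) (α_ K₁.fam K₂.fam K₃.fam) _ _ fun i j =>
        SimpleSuperop.assoc_nat (f.entry i.1.1 j.1.1) (g.entry i.1.2 j.1.2) (h.entry i.2 j.2))
  (leftUnitor_naturality := fun {H K} f =>
    natural (H := tensor unit H) (H' := H) (K := tensor unit K) (K' := K)
      (λ_ H.fam) (λ_ K.fam) _ _ fun i j =>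
        SimpleSuperop.left_nat (f.entry i.2 j.2))
  (rightUnitor_naturality := fun {H K} f =>
    natural (H := tensor H unit) (H' := H) (K := tensor K unit) (K' := K)
      (ρ_ H.fam) (ρ_ K.fam) _ _ fun i j =>
        SimpleSuperop.right_nat (f.entry i.1 j.1))
  (pentagon := pentagon')
  (triangle := triangle')

section
variable (H K L : Superop)

def braid : H ⊗ K ≅ K ⊗ H := ofIso (H := tensor H K) (K := tensor K H) (β_ H.fam K.fam)

lemma hexagon : (α_ H K L).hom ≫ (braid H (K ⊗ L)).hom ≫ (α_ K L H).hom =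
    (braid H K).hom ▷ L ≫ (α_ K H L).hom ≫ K ◁ (braid H L).hom := by
  refine Eq.trans ?_ (congrArg₂ (fun x y => x ≫ (α_ K H L).hom ≫ y)
    (whisker_ofFam (H := tensor H K) (K := tensor K H) L (β_ H.fam K.fam).hom)
    (ofFam_whisker (H := tensor H L) (K := tensor L H) K (β_ H.fam L.fam).hom)).symm
  change ofFam.map (α_ H.fam K.fam L.fam).hom ≫ ofFam.map (β_ H.fam (K.fam ⊗ L.fam)).hom ≫
      ofFam.map (α_ K.fam L.fam H.fam).hom =
    ofFam.map ((β_ H.fam K.fam).hom ⊗ₘ 𝟙 L.fam) ≫ ofFam.map (α_ K.fam H.fam L.fam).hom ≫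
      ofFam.map (𝟙 K.fam ⊗ₘ (β_ H.fam L.fam).hom)
  rw [← Functor.map_comp, ← Functor.map_comp, ← Functor.map_comp, ← Functor.map_comp]
  refine congrArg (CategoryTheory.Functor.map ofFam) ?_
  have := BraidedCategory.hexagon_forward H.fam K.fam L.fam
  rwa [← tensorHom_id, ← id_tensorHom] at this

lemma hexagon' : (α_ H K L).inv ≫ (braid (H ⊗ K) L).hom ≫ (α_ L H K).inv =
    H ◁ (braid K L).hom ≫ (α_ H L K).inv ≫ (braid H L).hom ▷ K := by
  refine Eq.trans ?_ (congrArg₂ (fun x y => x ≫ (α_ H L K).inv ≫ y)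
    (ofFam_whisker (H := tensor K L) (K := tensor L K) H (β_ K.fam L.fam).hom)
    (whisker_ofFam (H := tensor H L) (K := tensor L H) K (β_ H.fam L.fam).hom)).symm
  change ofFam.map (α_ H.fam K.fam L.fam).inv ≫ ofFam.map (β_ (H.fam ⊗ K.fam) L.fam).hom ≫
      ofFam.map (α_ L.fam H.fam K.fam).inv =
    ofFam.map (𝟙 H.fam ⊗ₘ (β_ K.fam L.fam).hom) ≫ ofFam.map (α_ H.fam L.fam K.fam).inv ≫
      ofFam.map ((β_ H.fam L.fam).hom ⊗ₘ 𝟙 K.fam)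
  rw [← Functor.map_comp, ← Functor.map_comp, ← Functor.map_comp, ← Functor.map_comp]
  refine congrArg (CategoryTheory.Functor.map ofFam) ?_
  have := BraidedCategory.hexagon_reverse H.fam K.fam L.fam
  rwa [← tensorHom_id, ← id_tensorHom] at this

lemma symmetry' : (braid H K).hom ≫ (braid K H).hom = 𝟙 (H ⊗ K) := by
  change ofFam.map (β_ H.fam K.fam).hom ≫ ofFam.map (β_ K.fam H.fam).hom = _
  rw [← Functor.map_comp, SymmetricCategory.symmetry]
  exact ofFam.map_id _

end

instance : SymmetricCategory Superop where
  braiding := braid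
  braiding_naturality_right H K K' f :=
    natural (H := tensor H K) (H' := tensor K H) (K := tensor H K') (K' := tensor K' H)
      (β_ H.fam K.fam) (β_ H.fam K'.fam) _ _ fun i j =>
        SimpleSuperop.swap_nat (Hom.entry (𝟙 H) i.1 j.1) (f.entry i.2 j.2)
  braiding_naturality_left {K K'} f H :=
    natural (H := tensor K H) (H' := tensor H K) (K := tensor K' H) (K' := tensor H K')
      (β_ K.fam H.fam) (β_ K'.fam H.fam) _ _ fun i j =>
        SimpleSuperop.swap_nat (f.entry i.1 j.1) (Hom.entry (𝟙 H) i.2 j.2)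
  hexagon_forward := hexagon
  hexagon_reverse := hexagon'
  symmetry := symmetry'

/-- The coproduct `H ⊕ K`. -/
def sum (H K : Superop) : Superop := ⟨.sum H.index K.index, Sum.elim H.space K.space⟩

def inlFam (H K : Superop) : H.fam ⟶ (sum H K).fam :=
  ⟨Sum.inl, fun j => 𝟙 (⟨H.space j⟩ : SimpleSuperop)⟩

def inrFam (H K : Superop) : K.fam ⟶ (sum H K).fam :=
  ⟨Sum.inr, fun j => 𝟙 (⟨K.space j⟩ : SimpleSuperop)⟩

def inl (H K : Superop) : H ⟶ sum H K := ofHom (inlFam H K)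

def inr (H K : Superop) : K ⟶ sum H K := ofHom (inrFam H K)

def desc {H K L : Superop} (f : H ⟶ L) (g : K ⟶ L) : sum H K ⟶ L where
  entry i j := match j with
    | .inl j => f.entry i j
    | .inr j => g.entry i j
  isCompletelyPositive i j := match j with
    | .inl j => f.isCompletelyPositive i j
    | .inr j => g.isCompletelyPositive i j
  trace_le j := match j with
    | .inl j => f.trace_le j
    | .inr j => g.trace_le j

lemma inl_desc {H K L : Superop} (f : H ⟶ L) (g : K ⟶ L) : inl H K ≫ desc f g = f :=
  hom_ext fun i j => ofHom_comp_entry _ (desc f g) i j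

lemma inr_desc {H K L : Superop} (f : H ⟶ L) (g : K ⟶ L) : inr H K ≫ desc f g = g :=
  hom_ext fun i j => ofHom_comp_entry _ (desc f g) i j

lemma desc_unique {H K L : Superop} (f : H ⟶ L) (g : K ⟶ L) (m : sum H K ⟶ L)
    (h : inl H K ≫ m = f) (h' : inr H K ≫ m = g) : m = desc f g := by
  subst h h'
  refine hom_ext fun i j => ?_
  rcases j with j | j
  · exact (ofHom_comp_entry (inlFam H K) m i j).symm
  · exact (ofHom_comp_entry (inrFam H K) m i j).symm

/-- `H ⊕ K` is the coproduct. -/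
def sumIsColimit (H K : Superop) : IsColimit (BinaryCofan.mk (inl H K) (inr H K)) :=
  BinaryCofan.isColimitMk (fun s => desc s.inl s.inr) (fun s => inl_desc _ _)
    (fun s => inr_desc _ _) (fun s m h h' => desc_unique _ _ m h h')

instance : HasBinaryCoproducts Superop :=
  haveI (H K : Superop) : HasColimit (pair H K) := ⟨⟨⟨_, sumIsColimit H K⟩⟩⟩
  hasBinaryCoproducts_of_hasColimit_pair Superop

def empty : Superop := ⟨.fin 0, Fin.elim0⟩

def emptyIsInitial : IsInitial empty :=
  IsInitial.ofUniqueHom (fun K => ⟨fun _ j => j.elim0, fun _ j => j.elim0, fun j => j.elim0⟩)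
    fun K f => hom_ext fun _ j => j.elim0

instance : HasFiniteCoproducts Superop :=
  haveI : HasInitial Superop := emptyIsInitial.hasInitial
  hasFiniteCoproducts_of_has_binary_and_initial

end Superop

namespace FinFam

/-- The functor `C⁺ ⥤ D⁺` induced by a functor `C ⥤ D`. -/
def mapFamily {C : Type u} [Category.{v} C] {D : Type u'} [Category.{v'} D] (F : C ⥤ D) :
    FinFam C ⥤ FinFam D where
  obj X := ⟨X.index, fun a => F.obj (X.obj a)⟩
  map f := ⟨f.map, fun a => F.map (f.app a)⟩
  map_id _ := hom_ext fun _ => F.map_id _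
  map_comp _ _ := hom_ext fun _ => F.map_comp _ _

end FinFam

/-- The category `Q''`, that is, `(Fwm K)⁺` for `K` the discrete category of finite dimensional
Hilbert spaces `ℂ^X`. -/
abbrev QValue : Type := FinFam (Fwm FinSet)

/-- The functor `Φ`. -/
def functorΦ : FinSet ⥤ QValue := FinFam.unitFamily (Fwm FinSet)

/-- The functor `Ψ`: it sends `{{V_i^a}_i}_a` to `(⊗_i V_i^a)_a`. -/
def functorΨ : QValue ⥤ Superop := FinFam.mapFamily Fwm.toSuperop ⋙ Superop.ofFam

/-- Left Kan extension along `Φ`. -/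
noncomputable def lanΦ : (FinSetᵒᵖ ⥤ Type) ⥤ PSh QValue :=
  functorΦ.op.lan ⋙ (DayFunctor.equiv QValueᵒᵖ Type).inverse

/-- Precomposition with `Φ`. -/
def pullbackΦ : PSh QValue ⥤ (FinSetᵒᵖ ⥤ Type) :=
  (DayFunctor.equiv QValueᵒᵖ Type).functor ⋙ (Functor.whiskeringLeft _ _ _).obj functorΦ.op

/-- The adjunction between left Kan extension along `Φ` and precomposition with `Φ`. -/
noncomputable def adjΦ : lanΦ ⊣ pullbackΦ :=
  (functorΦ.op.lanAdjunction Type).comp (DayFunctor.equiv QValueᵒᵖ Type).symm.toAdjunction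

/-- Left Kan extension along `Ψ`. -/
noncomputable def lanΨ : PSh QValue ⥤ PSh Superop :=
  (DayFunctor.equiv QValueᵒᵖ Type).functor ⋙ functorΨ.op.lan ⋙ (DayFunctor.equiv Superopᵒᵖ Type).inverse

/-- Precomposition with `Ψ`. -/
def pullbackΨ : PSh Superop ⥤ PSh QValue :=
  ((DayFunctor.equiv Superopᵒᵖ Type).functor ⋙ (Functor.whiskeringLeft _ _ _).obj functorΨ.op) ⋙
    (DayFunctor.equiv QValueᵒᵖ Type).inverse

/-- The adjunction between left Kan extension along `Ψ` and precomposition with `Ψ`. -/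
noncomputable def adjΨ : lanΨ ⊣ pullbackΨ :=
  (DayFunctor.equiv QValueᵒᵖ Type).toAdjunction.comp
    ((functorΨ.op.lanAdjunction Type).comp (DayFunctor.equiv Superopᵒᵖ Type).symm.toAdjunction)

/-- The presheaves on `Q` that send the finite product cones of `Qᵒᵖ` to limit cones. -/
def productPreserving : ObjectProperty (PSh Superop) := fun P => PreservesFiniteProducts P.functor

/-- The full subcategory of the presheaves on `Q` that preserve the finite products of `Qᵒᵖ`. -/
abbrev ContPSh : Type 1 := productPreserving.FullSubcategory

/-- A pair of symmetric monoidal adjunctions `B ⇄ C ⇄ D` with `B` cartesian forms a concrete model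
(with respect to `Q`): the comonad `!` on `C` is that of the first adjunction, and the monad `T` on
`C` is that of the second one. -/
def AdjunctionModel (Q : Type u') [Category.{v'} Q] [MonoidalCategory Q] [SymmetricCategory Q]
    {B : Type*} [Category* B] [CartesianMonoidalCategory B] [SymmetricCategory B]
    {C : Type*} [Category* C] [MonoidalCategory C] [SymmetricCategory C]
    {D : Type*} [Category* D] [MonoidalCategory D] [SymmetricCategory D]
    {L : B ⥤ C} {I : C ⥤ B} {F : C ⥤ D} {G : D ⥤ C} (adj₁ : L ⊣ I) (adj₂ : F ⊣ G)
    [L.Braided] [F.Braided] :=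
  letI := adj₁.symmetricMonoidalComonad
  letI := adj₂.symmetricMonoidalMonad
  ConcreteModel Q adj₁.toComonad adj₂.toMonad

/-!
Presheaves are handled through their elements. The class `DayLike` says what the Day convolution
`P ⊗ Q` is in these terms: it is generated by elements `p ⊗ q`, and a morphism out of it is a
natural family of maps defined on pairs `(p, q)`. Presheaves on finite sets with the cartesian
product satisfy the same description, so both kinds of presheaf category are treated at once.

*Left Kan extension.* If `Φ` is strong symmetric monoidal, then so is the left adjoint of
precomposition with `Φ` (`PrecompData.braided`), because both `L P ⊗ L Q` and `L (P ⊗ Q)` are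
generated by the pairs of elements of `P` and `Q`. This applies to `Φ` and to `Ψ`. That `Ψ` is
strong symmetric monoidal reduces to identities between functions on basis vectors, since a partial
trace followed by a permutation is determined by where the basis vectors go and what is discarded
(`Fwm.IsDiscard.eq`).

*Presheaves that preserve finite products.* They are the objects local for the comparison maps
`y(x) ⨿ y(x') ⟶ y(x ⨿ x')` and `∅ ⟶ y(∅)` (`PSh.isLocal_comparison_iff`). These are maps between
finitely presentable objects, so that the subcategory is reflective
(`PSh.isRightAdjoint_ι_continuous`).
Since the tensor product of `Q` distributes over `⊕`, the subcategory is closed under internal homs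
(`PSh.preservesFiniteProducts_internalHom`). Hence the maps inverted by the reflection are stable
under tensor products, the reflection is strong symmetric monoidal for the reflected tensor product,
and the subcategory is monoidal closed.

*The comonad.* Objects of a cartesian category are commutative comonoids, hence so are their images
under the strong monoidal functor `Lan_Φ`; this makes `!` a linear exponential comonad
(`CategoryTheory.Adjunction.linearExponentialComonad`). It is idempotent because `Φ` is fully
faithful. It is strongly monoidal because `Φ^*` is: a morphism `Φ a ⟶ x ⊗ y` is a pair of morphisms
`Φ a ⟶ x` and `Φ a ⟶ y` (`functorΦ_hom_tensor`, `isIso_μ_pullbackΦ`). It preserves colimits because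
`Lan_Φ` and `Φ^*` do.

*The monad.* The strength comes from the monoidal structure of `T`, and `[B, T X]` is a Kleisli
exponential because the category of presheaves is closed. The tensor unit is the presheaf
represented by the terminal object of `Q''`, so it is terminal.

*The embedding.* The Kleisli category of `T` is equivalent to the full subcategory of the presheaves
of the form `F P` (`CategoryTheory.Adjunction.kleisliComparison`). It contains the representable
presheaves, because left Kan extension preserves these (`PrecompData.yonedaIso`) and every object of
`Q` is, up to isomorphism, a value of `Ψ` (`Superop.functorΨSingletons`). So the Yoneda embedding of
`Q` factors through the Kleisli category (`ContPSh.embedding`). It is strong symmetric monoidal, as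
the Yoneda embedding always is for the Day convolution, and it preserves finite coproducts because
the presheaves considered turn them into products.
-/

/-! ### Presheaf categories in terms of elements -/

/-- A category `D` of presheaves on `C` with a Day convolution tensor product, described by the
elements of the presheaves. The elements `pair p q` are the images of `(p, q)` under the universal
map `P x × Q y → (P ⊗ Q) (x ⊗ y)`: they generate `P ⊗ Q`, and morphisms from `P ⊗ Q` can be defined
on them. In the same way, the unit is generated by the element `one`. -/
class DayLike (C : Type) [SmallCategory C] [MonoidalCategory C] [BraidedCategory C]
    (D : Type 1) [Category.{0} D] [MonoidalCategory D] [BraidedCategory D] where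
  El : D → C → Type
  res {P : D} {x y : C} (f : x ⟶ y) : El P y → El P x
  app {P Q : D} (α : P ⟶ Q) {x : C} : El P x → El Q x
  res_id {P : D} {x : C} (p : El P x) : res (𝟙 x) p = p
  res_res {P : D} {x y z : C} (f : x ⟶ y) (g : y ⟶ z) (p : El P z) :
    res f (res g p) = res (f ≫ g) p
  app_res {P Q : D} (α : P ⟶ Q) {x y : C} (f : x ⟶ y) (p : El P y) :
    app α (res f p) = res f (app α p)
  app_id {P : D} {x : C} (p : El P x) : app (𝟙 P) p = p
  app_comp {P Q R : D} (α : P ⟶ Q) (β : Q ⟶ R) {x : C} (p : El P x) :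
    app (α ≫ β) p = app β (app α p)
  hom_ext {P Q : D} {α β : P ⟶ Q} (h : ∀ (x : C) (p : El P x), app α p = app β p) : α = β
  homMk {P Q : D} (φ : ∀ x : C, El P x → El Q x)
    (h : ∀ (x y : C) (f : x ⟶ y) (p : El P y), φ x (res f p) = res f (φ y p)) : P ⟶ Q
  app_homMk {P Q : D} (φ : ∀ x : C, El P x → El Q x)
    (h : ∀ (x y : C) (f : x ⟶ y) (p : El P y), φ x (res f p) = res f (φ y p)) {x : C}
    (p : El P x) : app (homMk φ h) p = φ x p
  pair {P Q : D} {x y : C} : El P x → El Q y → El (P ⊗ Q) (x ⊗ y)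
  pair_res {P Q : D} {x y x' y' : C} (f : x' ⟶ x) (g : y' ⟶ y) (p : El P x) (q : El Q y) :
    pair (res f p) (res g q) = res (f ⊗ₘ g) (pair p q)
  exists_pair {P Q : D} {z : C} (t : El (P ⊗ Q) z) :
    ∃ (x y : C) (f : z ⟶ x ⊗ y) (p : El P x) (q : El Q y), t = res f (pair p q)
  desc {P Q R : D} (φ : ∀ x y : C, El P x → El Q y → El R (x ⊗ y))
    (h : ∀ (x y x' y' : C) (f : x' ⟶ x) (g : y' ⟶ y) (p : El P x) (q : El Q y),
      φ x' y' (res f p) (res g q) = res (f ⊗ₘ g) (φ x y p q)) : P ⊗ Q ⟶ R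
  app_desc_pair {P Q R : D} (φ : ∀ x y : C, El P x → El Q y → El R (x ⊗ y))
    (h : ∀ (x y x' y' : C) (f : x' ⟶ x) (g : y' ⟶ y) (p : El P x) (q : El Q y),
      φ x' y' (res f p) (res g q) = res (f ⊗ₘ g) (φ x y p q)) {x y : C} (p : El P x)
    (q : El Q y) : app (desc φ h) (pair p q) = φ x y p q
  one : El (𝟙_ D) (𝟙_ C)
  exists_one {z : C} (t : El (𝟙_ D) z) : ∃ f : z ⟶ 𝟙_ C, t = res f one
  descOne {R : D} (r : El R (𝟙_ C)) : 𝟙_ D ⟶ R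
  app_descOne {R : D} (r : El R (𝟙_ C)) : app (descOne r) one = r
  app_tensorHom {P Q P' Q' : D} (α : P ⟶ P') (β : Q ⟶ Q') {x y : C} (p : El P x) (q : El Q y) :
    app (α ⊗ₘ β) (pair p q) = pair (app α p) (app β q)
  app_associator {P Q R : D} {x y z : C} (p : El P x) (q : El Q y) (r : El R z) :
    app (α_ P Q R).hom (pair (pair p q) r) = res (α_ x y z).hom (pair p (pair q r))
  app_leftUnitor {P : D} {x : C} (p : El P x) : app (λ_ P).hom (pair one p) = res (λ_ x).hom p
  app_rightUnitor {P : D} {x : C} (p : El P x) : app (ρ_ P).hom (pair p one) = res (ρ_ x).hom p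
  app_braiding {P Q : D} {x y : C} (p : El P x) (q : El Q y) :
    app (β_ P Q).hom (pair p q) = res (β_ x y).hom (pair q p)

namespace DayLike

section
variable {C : Type} [SmallCategory C] [MonoidalCategory C] [BraidedCategory C]
  {D : Type 1} [Category.{0} D] [MonoidalCategory D] [BraidedCategory D] [DayLike C D]

lemma pair_res_left {P Q : D} {x y x' : C} (f : x' ⟶ x) (p : El P x) (q : El Q y) :
    pair (res f p) q = res (f ▷ y) (pair p q) := by
  conv_lhs => rw [← res_id q]
  rw [pair_res, tensorHom_id]

lemma pair_res_right {P Q : D} {x y y' : C} (g : y' ⟶ y) (p : El P x) (q : El Q y) :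
    pair p (res g q) = res (x ◁ g) (pair p q) := by
  conv_lhs => rw [← res_id p]
  rw [pair_res, id_tensorHom]

lemma app_whiskerLeft {P Q Q' : D} (β : Q ⟶ Q') {x y : C} (p : El P x) (q : El Q y) :
    app (P ◁ β) (pair p q) = pair p (app β q) := by
  rw [← id_tensorHom, app_tensorHom, app_id]

lemma app_whiskerRight {P Q P' : D} (α : P ⟶ P') {x y : C} (p : El P x) (q : El Q y) :
    app (α ▷ Q) (pair p q) = pair (app α p) q := by
  rw [← tensorHom_id, app_tensorHom, app_id]

lemma tensor_hom_ext {P Q R : D} {α β : P ⊗ Q ⟶ R}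
    (h : ∀ (x y : C) (p : El P x) (q : El Q y), app α (pair p q) = app β (pair p q)) : α = β := by
  refine hom_ext (C := C) fun z t => ?_
  obtain ⟨x, y, f, p, q, rfl⟩ := exists_pair t
  rw [app_res, app_res, h]

variable (C) in
lemma unit_hom_ext {R : D} {α β : 𝟙_ D ⟶ R}
    (h : app α (one : El (𝟙_ D) (𝟙_ C)) = app β one) : α = β := by
  refine hom_ext (C := C) fun z t => ?_
  obtain ⟨f, rfl⟩ := exists_one t
  rw [app_res, app_res, h]

end

end DayLike

namespace PSh
open LawfulDayConvolutionMonoidalCategoryStruct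
open scoped DayConvolution
variable {C : Type} [SmallCategory C] [MonoidalCategory C]

lemma η_associator (P Q R : PSh C) {x y z : C} (p : P.functor.obj (op x)) (q : Q.functor.obj (op y))
    (r : R.functor.obj (op z)) :
    (α_ P Q R).hom.natTrans.app (op ((x ⊗ y) ⊗ z)) ((DayFunctor.η (P ⊗ Q) R).app (op (x ⊗ y), op z)
      ((DayFunctor.η P Q).app (op x, op y) (p, q), r)) =
    (P ⊗ (Q ⊗ R)).functor.map (α_ x y z).hom.op ((DayFunctor.η P (Q ⊗ R)).app (op x, op (y ⊗ z))
      (p, (DayFunctor.η Q R).app (op y, op z) (q, r))) :=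
  types_congr_hom (associator_hom_unit_unit (C := Cᵒᵖ) Type (D := PSh C) P Q R
    (op x) (op y) (op z)) (show (_ × _) × _ from ((p, q), r))

lemma η_leftUnitor (P : PSh C) {x : C} (p : P.functor.obj (op x)) :
    (λ_ P).hom.natTrans.app (op (𝟙_ C ⊗ x)) ((DayFunctor.η (𝟙_ (PSh C)) P).app (op (𝟙_ C), op x)
      (DayFunctor.ν Cᵒᵖ Type PUnit.unit, p)) = P.functor.map (λ_ x).hom.op p :=
  types_congr_hom (leftUnitor_hom_unit_app (C := Cᵒᵖ) Type (D := PSh C) P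
    (op x)) (show PUnit × _ from (PUnit.unit, p))

lemma η_rightUnitor (P : PSh C) {x : C} (p : P.functor.obj (op x)) :
    (ρ_ P).hom.natTrans.app (op (x ⊗ 𝟙_ C)) ((DayFunctor.η P (𝟙_ (PSh C))).app (op x, op (𝟙_ C))
      (p, DayFunctor.ν Cᵒᵖ Type PUnit.unit)) = P.functor.map (ρ_ x).hom.op p :=
  types_congr_hom (rightUnitor_hom_unit_app (C := Cᵒᵖ) Type (D := PSh C) P
    (op x)) (show _ × PUnit from (p, PUnit.unit))

lemma η_tensorHom {P Q P' Q' : PSh C} (α : P ⟶ P') (β : Q ⟶ Q') {x y : C}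
    (p : P.functor.obj (op x)) (q : Q.functor.obj (op y)) :
    (α ⊗ₘ β).natTrans.app (op (x ⊗ y)) ((DayFunctor.η P Q).app (op x, op y) (p, q)) =
      (DayFunctor.η P' Q').app (op x, op y) (α.natTrans.app _ p, β.natTrans.app _ q) :=
  types_congr_hom (convolutionExtensionUnit_comp_ι_map_tensorHom_app Cᵒᵖ Type (D := PSh C) α β
    (op x) (op y)) (show _ × _ from (p, q))

attribute [local instance] conv in
lemma η_braiding [SymmetricCategory C] (P Q : PSh C) {x y : C} (p : P.functor.obj (op x))
    (q : Q.functor.obj (op y)) :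
    (β_ P Q).hom.natTrans.app (op (x ⊗ y)) ((DayFunctor.η P Q).app (op x, op y) (p, q)) =
      (Q ⊗ P).functor.map (β_ x y).hom.op ((DayFunctor.η Q P).app (op y, op x) (q, p)) :=
  types_congr_hom (DayConvolution.unit_app_braiding_hom_app P.functor Q.functor (op x) (op y))
    (show _ × _ from (p, q))

lemma η_map (P Q : PSh C) {x y x' y' : C} (f : x' ⟶ x) (g : y' ⟶ y)
    (p : P.functor.obj (op x)) (q : Q.functor.obj (op y)) :
    (DayFunctor.η P Q).app (op x', op y') (P.functor.map f.op p, Q.functor.map g.op q) =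
      (P ⊗ Q).functor.map (f ⊗ₘ g).op ((DayFunctor.η P Q).app (op x, op y) (p, q)) :=
  types_congr_hom ((DayFunctor.η P Q).naturality
    (X := (op x, op y)) (Y := (op x', op y')) (f.op, g.op)) (show _ × _ from (p, q))

lemma exists_η (P Q : PSh C) {z : C} (t : (P ⊗ Q).functor.obj (op z)) :
    ∃ (x y : C) (f : z ⟶ x ⊗ y) (p : P.functor.obj (op x)) (q : Q.functor.obj (op y)),
      t = (P ⊗ Q).functor.map f.op ((DayFunctor.η P Q).app (op x, op y) (p, q)) := by
  obtain ⟨j, ⟨p, q⟩, h⟩ := Types.jointly_surjective_of_isColimit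
    (isPointwiseLeftKanExtensionConvolutionExtensionUnit (C := Cᵒᵖ) (V := Type) P Q (op z)) t
  exact ⟨j.left.1.unop, j.left.2.unop, j.hom.unop, p, q, h.symm⟩

lemma exists_ν {z : C} (t : (𝟙_ (PSh C)).functor.obj (op z)) :
    ∃ f : z ⟶ 𝟙_ C, t = (𝟙_ (PSh C)).functor.map f.op (DayFunctor.ν Cᵒᵖ Type PUnit.unit) := by
  obtain ⟨j, ⟨⟩, h⟩ := Types.jointly_surjective_of_isColimit
    (isPointwiseLeftKanExtensionUnitUnit Cᵒᵖ Type (PSh C) (op z)) t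
  exact ⟨j.hom.unop, h.symm⟩

noncomputable instance [SymmetricCategory C] : DayLike C (PSh C) where
  El P x := P.functor.obj (op x)
  res {P _ _} f p := P.functor.map f.op p
  app α _ p := α.natTrans.app _ p
  res_id {P _} p := P.functor.map_id_apply _ p
  res_res {P _ _ _} f g p := (P.functor.map_comp_apply g.op f.op p).symm
  app_res α _ _ f p := NatTrans.naturality_apply α.natTrans f.op p
  app_id p := rfl
  app_comp α β _ p := rfl
  hom_ext h := DayFunctor.hom_ext (NatTrans.ext (funext fun x => by ext p; exact h x.unop p))
  homMk φ h := ⟨{ app := fun x => ↾(φ x.unop), naturality := fun _ _ f => by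
    { ext p; exact h _ _ f.unop p } }⟩
  app_homMk φ h _ p := rfl
  pair {P Q x y} p q := (DayFunctor.η P Q).app (op x, op y) (p, q)
  pair_res {P Q _ _ _ _} f g p q := η_map P Q f g p q
  exists_pair {P Q _} t := exists_η P Q t
  desc φ h := DayFunctor.tensorDesc
    { app := fun x => ↾fun p => φ x.1.unop x.2.unop p.1 p.2
      naturality := fun x y f => by
        ext p
        exact h _ _ _ _ f.1.unop f.2.unop p.1 p.2 }
  app_desc_pair φ h _ _ p q := types_congr_hom
    (DayFunctor.η_comp_tensorDesc_app (C := Cᵒᵖ) (V := Type) _ (op _) (op _))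
    (show _ × _ from (p, q))
  one := DayFunctor.ν Cᵒᵖ Type PUnit.unit
  exists_one t := exists_ν t
  descOne r := DayFunctor.unitDesc (↾fun _ => r)
  app_descOne {R} r := types_congr_hom
    (DayFunctor.ν_comp_unitDesc (C := Cᵒᵖ) (V := Type) (F := R) (↾fun _ => r)) PUnit.unit
  app_tensorHom α β _ _ p q := η_tensorHom α β p q
  app_associator {P Q R _ _ _} p q r := η_associator P Q R p q r
  app_leftUnitor {P _} p := η_leftUnitor P p
  app_rightUnitor {P _} p := η_rightUnitor P p
  app_braiding {P Q _ _} p q := η_braiding P Q p q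

end PSh

/-! ### Morphisms out of a tensor product of presheaves -/

namespace PSh
open DayLike
variable {C : Type} [SmallCategory C] [MonoidalCategory C] [SymmetricCategory C]

/-- The presheaf `x ↦ R (x ⊗ y)`. -/
def shiftRight (R : PSh C) (y : C) : PSh C := ⟨(tensorRight y).op ⋙ R.functor⟩

/-- The presheaf `y ↦ R (x ⊗ y)`. -/
def shiftLeft (R : PSh C) (x : C) : PSh C := ⟨(tensorLeft x).op ⋙ R.functor⟩

/-- The functoriality of `shiftRight` in the element of `C`. -/
def shiftRightMap (R : PSh C) {y y' : C} (g : y' ⟶ y) : shiftRight R y ⟶ shiftRight R y' :=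
  ⟨Functor.whiskerRight (NatTrans.op ((tensoringRight C).map g)) R.functor⟩

/-- The functoriality of `shiftLeft` in the element of `C`. -/
def shiftLeftMap (R : PSh C) {x x' : C} (f : x' ⟶ x) : shiftLeft R x ⟶ shiftLeft R x' :=
  ⟨Functor.whiskerRight (NatTrans.op ((tensoringLeft C).map f)) R.functor⟩

lemma app_shiftRightMap (R : PSh C) (x : C) {y y' : C} (g : y' ⟶ y) (r : El R (x ⊗ y)) :
    app (shiftRightMap R g) (x := x) r = res (P := R) (x ◁ g) r := rfl

/-- The morphism `p ↦ g (p ⊗ q)` for a fixed element `q`. -/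
noncomputable def curryRight {P Q R : PSh C} (g : P ⊗ Q ⟶ R) {y : C} (q : El Q y) :
    P ⟶ shiftRight R y :=
  homMk (C := C) (fun x p => (app g (pair p q) : El R (x ⊗ y))) fun x x' f p => by
    rw [pair_res_left, app_res]; rfl

/-- The morphism `q ↦ g (p ⊗ q)` for a fixed element `p`. -/
noncomputable def curryLeft {P Q R : PSh C} (g : P ⊗ Q ⟶ R) {x : C} (p : El P x) :
    Q ⟶ shiftLeft R x :=
  homMk (C := C) (fun y q => (app g (pair p q) : El R (x ⊗ y))) fun x x' f p => by
    rw [pair_res_right, app_res]; rfl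

lemma app_curryRight {P Q R : PSh C} (g : P ⊗ Q ⟶ R) {x y : C} (p : El P x) (q : El Q y) :
    (app (curryRight g q) p : El R (x ⊗ y)) = app g (pair p q) := rfl

lemma app_curryLeft {P Q R : PSh C} (g : P ⊗ Q ⟶ R) {x y : C} (p : El P x) (q : El Q y) :
    (app (curryLeft g p) q : El R (x ⊗ y)) = app g (pair p q) := rfl

end PSh

/-! ### Left Kan extension along a symmetric monoidal functor is symmetric monoidal -/

/-- A functor `I` between categories of presheaves is precomposition with `Φ`. -/
structure PrecompData {C : Type} [SmallCategory C] [MonoidalCategory C] [BraidedCategory C]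
    {D : Type 1} [Category.{0} D] [MonoidalCategory D] [BraidedCategory D] [DayLike C D]
    {C' : Type} [SmallCategory C'] [MonoidalCategory C'] [BraidedCategory C']
    {D' : Type 1} [Category.{0} D'] [MonoidalCategory D'] [BraidedCategory D'] [DayLike C' D']
    (Φ : C ⥤ C') (I : D' ⥤ D) where
  equiv (R : D') (x : C) : DayLike.El (I.obj R) x ≃ DayLike.El R (Φ.obj x)
  equiv_res {R : D'} {x y : C} (f : x ⟶ y) (r : DayLike.El (I.obj R) y) :
    equiv R x (DayLike.res f r) = DayLike.res (Φ.map f) (equiv R y r)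
  equiv_app {R S : D'} (α : R ⟶ S) {x : C} (r : DayLike.El (I.obj R) x) :
    equiv S x (DayLike.app (I.map α) r) = DayLike.app α (equiv R x r)

namespace PrecompData
open DayLike
variable {C : Type} [SmallCategory C] [MonoidalCategory C] [BraidedCategory C]
    {D : Type 1} [Category.{0} D] [MonoidalCategory D] [BraidedCategory D] [DayLike C D]
    {C' : Type} [SmallCategory C'] [MonoidalCategory C'] [SymmetricCategory C']
    {Φ : C ⥤ C'} {L : D ⥤ PSh C'} {I : PSh C' ⥤ D} (h : PrecompData Φ I) (adj : L ⊣ I)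

/-- The element of `L P` given by an element of `P`, where `L` is left adjoint to precomposition. -/
def ins {P : D} {a : C} (p : El P a) : El (L.obj P) (Φ.obj a) :=
  h.equiv _ a (app (adj.unit.app P) p)

lemma ins_res {P : D} {a b : C} (f : a ⟶ b) (p : El P b) :
    h.ins adj (res f p) = res (Φ.map f) (h.ins adj p) := by
  rw [ins, app_res, equiv_res, ins]

lemma app_ins {P Q : D} (α : P ⟶ Q) {a : C} (p : El P a) :
    app (L.map α) (h.ins adj p) = h.ins adj (app α p) := by
  rw [ins, ins, ← equiv_app, ← app_comp, ← app_comp]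
  congr 2
  exact (adj.unit.naturality α).symm

lemma hom_ext {P : D} {R : PSh C'} {g g' : L.obj P ⟶ R}
    (w : ∀ (a : C) (p : El P a), app g (h.ins adj p) = app g' (h.ins adj p)) : g = g' := by
  refine (adj.homEquiv P R).injective ?_
  rw [adj.homEquiv_unit, adj.homEquiv_unit]
  refine DayLike.hom_ext (C := C) fun a p => (h.equiv _ _).injective ?_
  rw [app_comp, app_comp, equiv_app, equiv_app]
  exact w a p

lemma app_homEquiv_symm {P : D} {R : PSh C'} (k : P ⟶ I.obj R) {a : C} (p : El P a) :
    app ((adj.homEquiv P R).symm k) (h.ins adj p) = h.equiv R a (app k p) := by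
  rw [ins, ← equiv_app, ← app_comp]
  have := (adj.homEquiv P R).apply_symm_apply k
  rw [adj.homEquiv_unit] at this
  exact congrArg (fun k => h.equiv R a (app k p)) this

/-- The universal property of the left Kan extension. -/
def lift {P : D} {R : PSh C'} (φ : ∀ a : C, El P a → El R (Φ.obj a))
    (w : ∀ (a b : C) (f : a ⟶ b) (p : El P b), φ a (res f p) = res (Φ.map f) (φ b p)) :
    L.obj P ⟶ R :=
  (adj.homEquiv P R).symm (homMk (C := C) (fun a p => (h.equiv R a).symm (φ a p))
    fun a b f p => (h.equiv R a).injective (by simp [w, equiv_res]))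

lemma app_lift {P : D} {R : PSh C'} (φ : ∀ a : C, El P a → El R (Φ.obj a))
    (w : ∀ (a b : C) (f : a ⟶ b) (p : El P b), φ a (res f p) = res (Φ.map f) (φ b p)) {a : C}
    (p : El P a) : app (h.lift adj φ w) (h.ins adj p) = φ a p := by
  rw [lift, app_homEquiv_symm, app_homMk, Equiv.apply_symm_apply]

open PSh

/-- The elements `p ⊗ q` generate `L P ⊗ L Q`: vary one of the two factors at a time, the other
being fixed in a shift of `R`. -/
lemma hom_ext₂ {P Q : D} {R : PSh C'} {g g' : L.obj P ⊗ L.obj Q ⟶ R}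
    (w : ∀ (a b : C) (p : El P a) (q : El Q b), app g (pair (h.ins adj p) (h.ins adj q)) =
      app g' (pair (h.ins adj p) (h.ins adj q))) : g = g' := by
  have key (a : C) (p : El P a) : curryLeft g (h.ins adj p) = curryLeft g' (h.ins adj p) :=
    h.hom_ext adj fun b q => w a b p q
  refine tensor_hom_ext (C := C') fun x y u v => ?_
  have : curryRight g v = curryRight g' v := h.hom_ext adj fun a p => by
    exact congrArg (fun k : L.obj Q ⟶ shiftLeft R (Φ.obj a) => app k v) (key a p)
  exact congrArg (fun k : L.obj P ⟶ shiftRight R y => app k u) this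

lemma hom_ext₃ {P Q S : D} {R : PSh C'} {g g' : (L.obj P ⊗ L.obj Q) ⊗ L.obj S ⟶ R}
    (w : ∀ (a b c : C) (p : El P a) (q : El Q b) (s : El S c),
      app g (pair (pair (h.ins adj p) (h.ins adj q)) (h.ins adj s)) =
      app g' (pair (pair (h.ins adj p) (h.ins adj q)) (h.ins adj s))) : g = g' := by
  have key (c : C) (s : El S c) : curryRight g (h.ins adj s) = curryRight g' (h.ins adj s) :=
    h.hom_ext₂ adj fun a b p q => w a b c p q s
  refine tensor_hom_ext (C := C') fun x y u v => ?_
  have : curryLeft g u = curryLeft g' u := h.hom_ext adj fun a s => by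
    exact congrArg (fun k : L.obj P ⊗ L.obj Q ⟶ shiftRight R (Φ.obj a) => app k u) (key a s)
  exact congrArg (fun k : L.obj S ⟶ shiftLeft R x => app k v) this

section
variable {P Q : D} {R : PSh C'} (φ : ∀ a b : C, El P a → El Q b → El R (Φ.obj a ⊗ Φ.obj b))
    (w : ∀ (a b a' b' : C) (f : a' ⟶ a) (g : b' ⟶ b) (p : El P a) (q : El Q b),
      φ a' b' (res f p) (res g q) = res (Φ.map f ⊗ₘ Φ.map g) (φ a b p q))

/-- Auxiliary definition for `lift₂`: the extension in the second variable. -/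
def liftAux {a : C} (p : El P a) : L.obj Q ⟶ shiftLeft R (Φ.obj a) :=
  h.lift adj (fun b q => (φ a b p q : El R (Φ.obj a ⊗ Φ.obj b))) fun b b' g q => by
    have := w a b' a b (𝟙 a) g p q
    rwa [res_id, Φ.map_id, id_tensorHom] at this

lemma app_liftAux {a b : C} (p : El P a) (q : El Q b) :
    (app (h.liftAux adj φ w p) (h.ins adj q) : El R (Φ.obj a ⊗ Φ.obj b)) = φ a b p q :=
  h.app_lift adj _ _ q

lemma liftAux_res {a a' : C} (f : a' ⟶ a) (p : El P a) :
    h.liftAux adj φ w (res f p) = h.liftAux adj φ w p ≫ shiftLeftMap R (Φ.map f) :=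
  h.hom_ext adj fun b q => by
    rw [app_comp]
    refine (h.app_liftAux adj φ w _ q).trans ?_
    refine Eq.trans ?_ (congrArg (app (shiftLeftMap R (Φ.map f))) (h.app_liftAux adj φ w p q)).symm
    have := w a b a' b f (𝟙 b) p q
    rw [res_id, Φ.map_id, tensorHom_id] at this
    exact this

/-- Auxiliary definition for `lift₂`. -/
noncomputable def liftAux' {y : C'} (v : El (L.obj Q) y) : L.obj P ⟶ shiftRight R y :=
  h.lift adj (fun a p => (app (h.liftAux adj φ w p) v : El R (Φ.obj a ⊗ y)))
    fun a b f p => congrArg (fun k => app k v) (h.liftAux_res adj φ w f p)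

lemma app_liftAux' {a : C} (p : El P a) {y : C'} (v : El (L.obj Q) y) :
    (app (h.liftAux' adj φ w v) (h.ins adj p) : El R (Φ.obj a ⊗ y)) =
      app (h.liftAux adj φ w p) v :=
  h.app_lift adj _ _ p

lemma liftAux'_res {y y' : C'} (f : y' ⟶ y) (v : El (L.obj Q) y) :
    h.liftAux' adj φ w (res f v) = h.liftAux' adj φ w v ≫ shiftRightMap R f :=
  h.hom_ext adj fun a p => by
    rw [app_comp]
    refine (h.app_liftAux' adj φ w p _).trans ?_
    refine Eq.trans ?_ (congrArg (app (shiftRightMap R f)) (h.app_liftAux' adj φ w p v)).symm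
    exact app_res _ _ _

/-- The universal property of the tensor product of two left Kan extensions. -/
noncomputable def lift₂ : L.obj P ⊗ L.obj Q ⟶ R :=
  desc (C := C') (fun x y u v => (app (h.liftAux' adj φ w v) u : El R (x ⊗ y)))
    fun x y x' y' f g u v => by
      rw [liftAux'_res, app_comp]
      refine (congrArg (app (shiftRightMap R g)) (app_res (h.liftAux' adj φ w v) f u)).trans ?_
      refine (res_res (P := R) (x' ◁ g) (f ▷ y) _).trans ?_
      rw [tensorHom_def']

lemma app_lift₂ {a b : C} (p : El P a) (q : El Q b) :
    app (h.lift₂ adj φ w) (pair (h.ins adj p) (h.ins adj q)) = φ a b p q := by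
  refine (app_desc_pair (R := R) _ _ _ _).trans ?_
  rw [app_liftAux', app_liftAux]

end

section Monoidal
open Functor.LaxMonoidal Functor.OplaxMonoidal Functor.Monoidal
variable [Φ.Braided]

/-- The tensorator of a left Kan extension: it sends `p ⊗ q` to `p ⊗ q`. -/
noncomputable def tensorator (P Q : D) : L.obj P ⊗ L.obj Q ⟶ L.obj (P ⊗ Q) :=
  h.lift₂ adj (fun a b p q => res (μ Φ a b) (h.ins adj (pair p q))) fun a b a' b' f g p q => by
    rw [pair_res, ins_res, res_res, res_res, μ_natural]

lemma app_tensorator {P Q : D} {a b : C} (p : El P a) (q : El Q b) :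
    app (h.tensorator adj P Q) (pair (h.ins adj p) (h.ins adj q)) =
      res (μ Φ a b) (h.ins adj (pair p q)) :=
  h.app_lift₂ adj _ _ p q

/-- The inverse of the tensorator. -/
noncomputable def tensoratorInv (P Q : D) : L.obj (P ⊗ Q) ⟶ L.obj P ⊗ L.obj Q :=
  (adj.homEquiv _ _).symm (desc (C := C) (fun a b p q => (h.equiv _ _).symm
    (res (δ Φ a b) (pair (h.ins adj p) (h.ins adj q)))) fun a b a' b' f g p q =>
    (h.equiv _ _).injective (by
      rw [equiv_res, Equiv.apply_symm_apply, Equiv.apply_symm_apply, ins_res, ins_res, pair_res,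
        res_res, res_res, δ_natural]))

lemma app_tensoratorInv {P Q : D} {a b : C} (p : El P a) (q : El Q b) :
    app (h.tensoratorInv adj P Q) (h.ins adj (pair p q)) =
      res (δ Φ a b) (pair (h.ins adj p) (h.ins adj q)) := by
  rw [tensoratorInv, app_homEquiv_symm, app_desc_pair, Equiv.apply_symm_apply]

lemma hom_ext_tensor {P Q : D} {R : PSh C'} {g g' : L.obj (P ⊗ Q) ⟶ R}
    (w : ∀ (a b : C) (p : El P a) (q : El Q b), app g (h.ins adj (pair p q)) =
      app g' (h.ins adj (pair p q))) : g = g' := by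
  refine h.hom_ext adj fun c t => ?_
  obtain ⟨a, b, f, p, q, rfl⟩ := exists_pair t
  rw [ins_res, app_res, app_res, w]

/-- The tensorator as an isomorphism. -/
noncomputable def tensoratorIso (P Q : D) : L.obj P ⊗ L.obj Q ≅ L.obj (P ⊗ Q) where
  hom := h.tensorator adj P Q
  inv := h.tensoratorInv adj P Q
  hom_inv_id := h.hom_ext₂ adj fun a b p q => by
    rw [app_comp, app_tensorator, app_res, app_tensoratorInv, res_res, μ_δ, res_id, app_id]
  inv_hom_id := h.hom_ext_tensor adj fun a b p q => by
    rw [app_comp, app_tensoratorInv, app_res, app_tensorator, res_res, δ_μ, res_id, app_id]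

/-- The unit comparison of a left Kan extension. -/
noncomputable def unitIso : 𝟙_ (PSh C') ≅ L.obj (𝟙_ D) where
  hom := descOne (C := C') (res (ε Φ) (h.ins adj one))
  inv := (adj.homEquiv _ _).symm (descOne (C := C) ((h.equiv _ _).symm (res (η Φ) one)))
  hom_inv_id := unit_hom_ext C' (by
    rw [app_comp, app_descOne, app_res, app_homEquiv_symm, app_descOne, Equiv.apply_symm_apply,
      res_res, ε_η, res_id, app_id])
  inv_hom_id := h.hom_ext adj fun a p => by
    obtain ⟨f, rfl⟩ := exists_one p
    rw [app_comp, ins_res, app_res, app_res, app_res, app_homEquiv_symm, app_descOne,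
      Equiv.apply_symm_apply, app_res, app_descOne, res_res (η Φ), η_ε, res_id, app_id]

lemma app_unitIso : app (h.unitIso adj).hom (one : El _ (𝟙_ C')) =
    res (ε Φ) (h.ins adj (one : El (𝟙_ D) (𝟙_ C))) :=
  app_descOne _

/-- The left adjoint of precomposition with a strong monoidal functor is strong monoidal. -/
noncomputable def coreMonoidal : L.CoreMonoidal where
  εIso := h.unitIso adj
  μIso := h.tensoratorIso adj
  μIso_hom_natural_left α Q := h.hom_ext₂ adj fun a b p q => by
    simp only [tensoratorIso, app_comp, app_whiskerRight, app_ins, app_tensorator, app_res]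
  μIso_hom_natural_right P α := h.hom_ext₂ adj fun a b p q => by
    simp only [tensoratorIso, app_comp, app_whiskerLeft, app_ins, app_tensorator, app_res]
  associativity P Q S := h.hom_ext₃ adj fun a b c p q s => by
    simp only [tensoratorIso, app_comp, app_whiskerLeft, app_whiskerRight, app_ins, app_tensorator,
      app_res, pair_res_left, pair_res_right, app_associator, ins_res, res_res,
      Functor.LaxMonoidal.associativity]
  left_unitality P := tensor_hom_ext (C := C') fun x y u v => by
    obtain ⟨f, rfl⟩ := exists_one u
    rw [pair_res_left, app_res, app_res]
    congr 1
    have : curryLeft (λ_ (L.obj P)).hom one = curryLeft ((h.unitIso adj).hom ▷ L.obj P ≫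
        (h.tensoratorIso adj (𝟙_ D) P).hom ≫ L.map (λ_ P).hom) one := h.hom_ext adj fun a p => by
      refine (app_curryLeft _ _ _).trans (Eq.trans ?_ (app_curryLeft _ _ _).symm)
      simp only [tensoratorIso, app_comp, app_whiskerRight, app_unitIso, pair_res_left, app_res,
        app_tensorator, app_ins, app_leftUnitor, ins_res, res_res,
        Functor.LaxMonoidal.left_unitality]
      rfl
    exact congrArg (fun k : L.obj P ⟶ shiftLeft (L.obj P) (𝟙_ C') => app k v) this
  right_unitality P := tensor_hom_ext (C := C') fun x y u v => by
    obtain ⟨f, rfl⟩ := exists_one v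
    rw [pair_res_right, app_res, app_res]
    congr 1
    have : curryRight (ρ_ (L.obj P)).hom one = curryRight (L.obj P ◁ (h.unitIso adj).hom ≫
        (h.tensoratorIso adj P (𝟙_ D)).hom ≫ L.map (ρ_ P).hom) one := h.hom_ext adj fun a p => by
      refine (app_curryRight _ _ _).trans (Eq.trans ?_ (app_curryRight _ _ _).symm)
      simp only [tensoratorIso, app_comp, app_whiskerLeft, app_unitIso, pair_res_right, app_res,
        app_tensorator, app_ins, app_rightUnitor, ins_res, res_res,
        Functor.LaxMonoidal.right_unitality]
      rfl
    exact congrArg (fun k : L.obj P ⟶ shiftRight (L.obj P) (𝟙_ C') => app k u) this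

/-- The left adjoint of precomposition with a strong symmetric monoidal functor is strong symmetric
monoidal. -/
@[reducible]
noncomputable def braided : L.Braided :=
  { (h.coreMonoidal adj).toMonoidal with
    braided := fun P Q => h.hom_ext₂ adj fun a b p q => by
      change app ((h.tensorator adj P Q) ≫ _) _ = app (_ ≫ (h.tensorator adj Q P)) _
      simp only [app_comp, app_tensorator, app_res, app_ins, app_braiding, ins_res, res_res,
        Functor.LaxBraided.braided] }

end Monoidal
end PrecompData

/-! ### Internal homs of presheaves -/

namespace PSh
open DayLike
variable {C : Type} [SmallCategory C] [MonoidalCategory C] [SymmetricCategory C]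

lemma shiftRightMap_id (R : PSh C) (y : C) : shiftRightMap R (𝟙 y) = 𝟙 _ :=
  hom_ext (C := C) fun x r => by
    refine (app_shiftRightMap R x (𝟙 y) r).trans ?_
    exact (congrArg (fun k => res (P := R) k r) (whiskerLeft_id x y)).trans
      (res_id (P := R) (x := x ⊗ y) r)

lemma shiftRightMap_comp (R : PSh C) {y y' y'' : C} (g : y'' ⟶ y') (f : y' ⟶ y) :
    shiftRightMap R (g ≫ f) = shiftRightMap R f ≫ shiftRightMap R g :=
  hom_ext (C := C) fun x r => by
    refine (app_shiftRightMap R x (g ≫ f) r).trans ?_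
    exact (congrArg (fun k => res (P := R) k r) (whiskerLeft_comp x g f)).trans
      (res_res (P := R) (x ◁ g) (x ◁ f) r).symm

/-- The internal hom: the elements of `[A, R] y` are the natural families of maps
`A x → R (x ⊗ y)`. -/
def internalHom (A R : PSh C) : PSh C :=
  ⟨{ obj := fun y => A ⟶ shiftRight R y.unop
     map := fun f => ↾fun g => g ≫ shiftRightMap R f.unop
     map_id := fun y => by
      refine ConcreteCategory.hom_ext _ _ fun g => ?_
      exact (congrArg (g ≫ ·) (shiftRightMap_id R y.unop)).trans (Category.comp_id g)
     map_comp := fun f f' => by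
      refine ConcreteCategory.hom_ext _ _ fun g => ?_
      exact (congrArg (g ≫ ·) (shiftRightMap_comp R f'.unop f.unop)).trans
        (Category.assoc _ _ _).symm }⟩

lemma curryRight_res {P Q R : PSh C} (g : P ⊗ Q ⟶ R) {y y' : C} (f : y' ⟶ y) (q : El Q y) :
    curryRight g (res f q) = curryRight g q ≫ shiftRightMap R f :=
  hom_ext (C := C) fun x p => by
    refine (app_curryRight g p _).trans ?_
    rw [pair_res_right, app_res]
    rfl

/-- The universal property of the internal hom. -/
noncomputable def internalHomEquiv (A B R : PSh C) : (A ⊗ B ⟶ R) ≃ (B ⟶ internalHom A R) where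
  toFun g := homMk (C := C) (fun y q => (curryRight g q : A ⟶ shiftRight R y))
    fun y y' f q => curryRight_res g f q
  invFun k := desc (C := C) (fun x y p q =>
      (app (show A ⟶ shiftRight R y from app k q) p : El R (x ⊗ y)))
    fun x y x' y' f g p q => by
      rw [app_res k g q]
      refine (congrArg (app (shiftRightMap R g)) (app_res (show A ⟶ shiftRight R y from app k q)
        f p)).trans ?_
      refine (res_res (P := R) (x' ◁ g) (f ▷ y) _).trans ?_
      rw [tensorHom_def']
  left_inv g := tensor_hom_ext (C := C) fun x y p q => app_desc_pair (R := R) _ _ p q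
  right_inv k := hom_ext (C := C) fun y q => hom_ext (C := C) (P := A) (Q := shiftRight R y)
    fun x p => app_desc_pair (R := R) _ _ p q

lemma internalHomEquiv_naturality {A B B' R : PSh C} (f : B' ⟶ B) (g : A ⊗ B ⟶ R) :
    internalHomEquiv A B' R (A ◁ f ≫ g) = f ≫ internalHomEquiv A B R g :=
  DayLike.hom_ext (C := C) fun y q => DayLike.hom_ext (C := C) (P := A)
    (Q := shiftRight R y) fun x p =>
      (app_comp (A ◁ f) g (pair p q)).trans (congrArg (app g) (app_whiskerLeft f p q))

noncomputable instance : MonoidalClosed (PSh C) where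
  closed A :=
    { rightAdj := _
      adj := Adjunction.adjunctionOfEquivRight (F := tensorLeft A)
        (fun B R => internalHomEquiv A B R) fun B' B R f g => internalHomEquiv_naturality f g }

end PSh

/-! ### Presheaves that preserve finite products -/

lemma Types.nonempty_isLimit_binaryFan_iff {A B Z : Type} (f : Z ⟶ A) (g : Z ⟶ B) :
    Nonempty (IsLimit (BinaryFan.mk f g)) ↔ Function.Bijective (fun z => (f z, g z)) := by
  constructor
  · rintro ⟨h⟩
    let e := (h.conePointUniqueUpToIso (Types.binaryProductLimit A B)).toEquiv
    have he : (fun z => (f z, g z)) = e := by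
      funext z
      exact Prod.ext
        (types_congr_hom (h.conePointUniqueUpToIso_hom_comp (Types.binaryProductLimit A B)
          ⟨.left⟩) z).symm
        (types_congr_hom (h.conePointUniqueUpToIso_hom_comp (Types.binaryProductLimit A B)
          ⟨.right⟩) z).symm
    rw [he]
    exact e.bijective
  · intro h
    exact ⟨(Types.binaryProductLimit A B).ofIsoLimit (BinaryFan.ext
      (Equiv.ofBijective _ h).toIso rfl rfl).symm⟩

section
variable {D : Type u} [Category.{v} D]

lemma bijective_of_preservesFiniteProducts (P : D ⥤ Type) [PreservesFiniteProducts P] {X Y Z : D}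
    {f : Z ⟶ X} {g : Z ⟶ Y} (h : IsLimit (BinaryFan.mk f g)) :
    Function.Bijective (fun z => (P.map f z, P.map g z)) :=
  (Types.nonempty_isLimit_binaryFan_iff _ _).1 ⟨mapIsLimitOfPreservesOfIsLimit P f g h⟩

lemma unique_of_preservesFiniteProducts (P : D ⥤ Type) [PreservesFiniteProducts P] {Z : D}
    (h : IsTerminal Z) : Nonempty (Unique (P.obj Z)) :=
  ⟨(Types.isTerminalEquivUnique _ (IsTerminal.isTerminalObj P Z h))⟩

/-- The preservation of finite products can be checked on one product cone for each pair of objects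
and one terminal object. -/
lemma preservesFiniteProducts_of_bijective [HasFiniteProducts D] (P : D ⥤ Type)
    (h : ∀ X Y : D, ∃ (Z : D) (f : Z ⟶ X) (g : Z ⟶ Y), Nonempty (IsLimit (BinaryFan.mk f g)) ∧
      Function.Bijective (fun z => (P.map f z, P.map g z)))
    (h' : ∃ Z : D, Nonempty (IsTerminal Z) ∧ Nonempty (Unique (P.obj Z))) :
    PreservesFiniteProducts P := by
  have : PreservesLimitsOfShape (Discrete WalkingPair) P := ⟨fun {K} => by
    obtain ⟨Z, f, g, ⟨hl⟩, hb⟩ := h (K.obj ⟨.left⟩) (K.obj ⟨.right⟩)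
    have : PreservesLimit (pair (K.obj ⟨.left⟩) (K.obj ⟨.right⟩)) P :=
      preservesLimit_of_preserves_limit_cone hl ((isLimitMapConeBinaryFanEquiv P f g).symm
        ((Types.nonempty_isLimit_binaryFan_iff _ _).2 hb).some)
    exact preservesLimit_of_iso_diagram P (diagramIsoPair K).symm⟩
  have : PreservesLimitsOfShape (Discrete PEmpty.{1}) P := by
    obtain ⟨Z, ⟨hZ⟩, ⟨hu⟩⟩ := h'
    refine ⟨fun {K} => ?_⟩
    have : PreservesLimit (Functor.empty.{0} D) P :=
      preservesLimit_of_preserves_limit_cone hZ ((isLimitMapConeEmptyConeEquiv P Z).symm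
        ((Types.isTerminalEquivUnique _).symm hu))
    exact preservesLimit_of_iso_diagram P (Functor.emptyExt (Functor.empty.{0} D) K)
  exact PreservesFiniteProducts.of_preserves_binary_and_terminal P

end

namespace PSh
variable {C : Type} [SmallCategory C] [MonoidalCategory C]

/-- The Yoneda embedding. -/
def yoneda : C ⥤ PSh C := CategoryTheory.yoneda ⋙ (DayFunctor.equiv Cᵒᵖ Type).inverse

/-- The Yoneda lemma. -/
def yonedaEquiv {x : C} {P : PSh C} : (yoneda.obj x ⟶ P) ≃ P.functor.obj (op x) :=
  ((DayFunctor.equiv Cᵒᵖ Type).symm.toAdjunction.homEquiv _ _).trans CategoryTheory.yonedaEquiv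

lemma map_yonedaEquiv {x y : C} {P : PSh C} (f : y ⟶ x) (g : yoneda.obj x ⟶ P) :
    P.functor.map f.op (yonedaEquiv g) = yonedaEquiv (yoneda.map f ≫ g) :=
  CategoryTheory.yonedaEquiv_naturality g.natTrans f

instance : HasColimitsOfSize.{0, 0} (PSh C) :=
  Adjunction.has_colimits_of_equivalence (DayFunctor.equiv Cᵒᵖ Type).functor

instance : yoneda (C := C).Full := inferInstanceAs (CategoryTheory.yoneda ⋙ _).Full
instance : yoneda (C := C).Faithful := inferInstanceAs (CategoryTheory.yoneda ⋙ _).Faithful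

/-- Representable presheaves are finitely presentable, because evaluation preserves colimits. -/
lemma isCardinalPresentable_yoneda (x : C) (κ : Cardinal.{0}) [Fact κ.IsRegular] :
    IsCardinalPresentable (yoneda.obj x) κ where
  preservesColimitOfShape J _ _ := by
    let e : coyoneda.obj (op (yoneda.obj x)) ≅
        (DayFunctor.equiv Cᵒᵖ Type).functor ⋙ (evaluation _ _).obj (op x) :=
      NatIso.ofComponents (fun P => yonedaEquiv.toIso)
    exact preservesColimitsOfShape_of_natIso e.symm

variable (C) in
/-- The presheaves that preserve finite products. -/
def continuous : ObjectProperty (PSh C) := fun P => PreservesFiniteProducts P.functor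

variable [HasFiniteCoproducts C]

/-- The comparison morphisms `y(x) ⨿ y(y) ⟶ y(x ⨿ y)` and `∅ ⟶ y(∅)`. -/
noncomputable def comparison : (i : Option (C × C)) →
    Σ (P Q : PSh C), (P ⟶ Q)
  | none => ⟨⊥_ _, yoneda.obj (⊥_ C), initial.to _⟩
  | some (x, y) => ⟨yoneda.obj x ⨿ yoneda.obj y, yoneda.obj (x ⨿ y),
      coprod.desc (yoneda.map coprod.inl) (yoneda.map coprod.inr)⟩

/-- By the Yoneda lemma, being local with respect to the comparison morphisms means that the
canonical maps `P (x ⨿ y) → P x × P y` and `P ∅ → 1` are bijective. -/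
lemma isLocal_comparison_iff (P : PSh C) :
    (MorphismProperty.ofHoms fun i : Option (C × C) => (comparison i).2.2).isLocal P ↔
      PreservesFiniteProducts P.functor := by
  have h0 : Function.Bijective (fun g : yoneda.obj (⊥_ C) ⟶ P => initial.to _ ≫ g) ↔
      Nonempty (Unique (P.functor.obj (op (⊥_ C)))) := by
    have : Unique (⊥_ PSh C ⟶ P) := uniqueFromInitial P
    refine ⟨fun h => ⟨(yonedaEquiv.symm.trans (Equiv.ofBijective _ h)).unique⟩, fun ⟨v⟩ => ?_⟩
    have := yonedaEquiv.unique (α := yoneda.obj (⊥_ C) ⟶ P)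
    exact ⟨fun _ _ _ => Subsingleton.elim _ _, fun g => ⟨default, Subsingleton.elim _ _⟩⟩
  have h1 (x y : C) : Function.Bijective (fun g : yoneda.obj (x ⨿ y) ⟶ P =>
      coprod.desc (yoneda.map coprod.inl) (yoneda.map coprod.inr) ≫ g) ↔
      Function.Bijective (fun z : P.functor.obj (op (x ⨿ y)) =>
        (P.functor.map coprod.inl.op z, P.functor.map coprod.inr.op z)) := by
    let e : (yoneda.obj x ⨿ yoneda.obj y ⟶ P) ≃ P.functor.obj (op x) × P.functor.obj (op y) :=
      { toFun := fun g => (yonedaEquiv (coprod.inl ≫ g), yonedaEquiv (coprod.inr ≫ g))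
        invFun := fun p => coprod.desc (yonedaEquiv.symm p.1) (yonedaEquiv.symm p.2)
        left_inv := fun g => coprod.hom_ext
          ((coprod.inl_desc _ _).trans (Equiv.symm_apply_apply _ _))
          ((coprod.inr_desc _ _).trans (Equiv.symm_apply_apply _ _))
        right_inv := fun p => Prod.ext
          ((congrArg yonedaEquiv (coprod.inl_desc _ _)).trans (Equiv.apply_symm_apply _ _))
          ((congrArg yonedaEquiv (coprod.inr_desc _ _)).trans (Equiv.apply_symm_apply _ _)) }
    rw [← Function.Bijective.of_comp_iff' e.bijective,
      ← Function.Bijective.of_comp_iff _ (yonedaEquiv (x := x ⨿ y) (P := P)).bijective]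
    refine iff_of_eq (congrArg _ (funext fun g => ?_))
    refine Prod.ext ?_ ?_
    · refine Eq.trans ?_ (map_yonedaEquiv _ _).symm
      exact congrArg yonedaEquiv (coprod.inl_desc_assoc _ _ _)
    · refine Eq.trans ?_ (map_yonedaEquiv _ _).symm
      exact congrArg yonedaEquiv (coprod.inr_desc_assoc _ _ _)
  constructor
  · intro h
    refine preservesFiniteProducts_of_bijective _ (fun X Y => ?_) ?_
    · exact ⟨_, _, _, ⟨BinaryCofan.IsColimit.op (coprodIsCoprod X.unop Y.unop)⟩,
        (h1 _ _).1 (h _ ⟨some (X.unop, Y.unop)⟩)⟩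
    · exact ⟨_, ⟨terminalOpOfInitial initialIsInitial⟩, h0.1 (h _ ⟨none⟩)⟩
  · rintro h _ _ _ ⟨i⟩
    rcases i with _ | ⟨x, y⟩
    · exact h0.2 (unique_of_preservesFiniteProducts _ (terminalOpOfInitial initialIsInitial))
    · have := bijective_of_preservesFiniteProducts P.functor
        (BinaryCofan.IsColimit.op (c := .mk coprod.inl coprod.inr) (coprodIsCoprod x y))
      exact (h1 x y).2 this

variable (C) in
/-- The presheaves that preserve finite products form a reflective subcategory: they are the objects
that are local for a set of morphisms between finitely presentable objects. -/
lemma isRightAdjoint_ι_continuous : (continuous C).ι.IsRightAdjoint := by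
  have e : (MorphismProperty.ofHoms fun i : Option (C × C) => (comparison i).2.2).isLocal =
      continuous C :=
    funext fun P => propext (isLocal_comparison_iff P)
  have := Cardinal.fact_isRegular_aleph0
  rw [← e]
  refine MorphismProperty.isRightAdjoint_ι_isLocal _ Cardinal.aleph0.{0} ?_
  have h0 : IsCardinalPresentable (⊥_ PSh C) Cardinal.aleph0.{0} :=
    have (k : Discrete PEmpty.{1}) : IsCardinalPresentable ((Functor.empty (PSh C)).obj k)
      Cardinal.aleph0.{0} := k.as.elim
    isCardinalPresentable_of_isColimit' _ (colimit.isColimit (Functor.empty (PSh C))) _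
      (hasCardinalLT_aleph0_iff _ |>.2 inferInstance)
  have h1 (x y : C) :
      IsCardinalPresentable (yoneda.obj x ⨿ yoneda.obj y) Cardinal.aleph0.{0} :=
    have (k : Discrete WalkingPair) : IsCardinalPresentable
        ((pair (yoneda.obj x) (yoneda.obj y)).obj k) Cardinal.aleph0.{0} := by
      rcases k with ⟨_ | _⟩
      · exact isCardinalPresentable_yoneda _ _
      · exact isCardinalPresentable_yoneda _ _
    isCardinalPresentable_of_isColimit' _ (colimit.isColimit (pair (yoneda.obj x) (yoneda.obj y))) _
      (hasCardinalLT_aleph0_iff _ |>.2 inferInstance)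
  rintro _ _ _ ⟨_ | ⟨x, y⟩⟩
  · exact ⟨h0, isCardinalPresentable_yoneda _ _⟩
  · exact ⟨h1 x y, isCardinalPresentable_yoneda _ _⟩

end PSh

/-! ### The presheaves that preserve finite products form an exponential ideal -/

namespace PSh
open DayLike
variable {C : Type} [SmallCategory C] [MonoidalCategory C] [SymmetricCategory C]
  [HasFiniteCoproducts C] [∀ x : C, PreservesFiniteCoproducts (tensorLeft x)]

/-- Since `a ⊗ -` preserves finite
coproducts, so do the shifts `L (a ⊗ -)`, and an element of `[A, L] y` is a natural family of
elements of `L (a ⊗ y)`. -/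
lemma preservesFiniteProducts_internalHom (A L : PSh C) [PreservesFiniteProducts L.functor] :
    PreservesFiniteProducts (internalHom A L).functor := by
  have key (a X Y : C) : Function.Bijective (fun r : El L (a ⊗ (X ⨿ Y)) =>
      (res (a ◁ coprod.inl) r, res (a ◁ coprod.inr) r)) :=
    bijective_of_preservesFiniteProducts L.functor (BinaryCofan.IsColimit.op
      (c := .mk (a ◁ coprod.inl) (a ◁ coprod.inr))
      (mapIsColimitOfPreservesOfIsColimit (tensorLeft a) _ _ (coprodIsCoprod X Y)))
  have key' (a : C) : Nonempty (Unique (El L (a ⊗ ⊥_ C))) :=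
    unique_of_preservesFiniteProducts L.functor (terminalOpOfInitial
      (IsInitial.isInitialObj (tensorLeft a) _ initialIsInitial))
  refine preservesFiniteProducts_of_bijective _ (fun X Y => ⟨_, _, _,
    ⟨BinaryCofan.IsColimit.op (coprodIsCoprod X.unop Y.unop)⟩, ?_⟩)
    ⟨_, ⟨terminalOpOfInitial initialIsInitial⟩, ?_⟩
  · let X := X.unop
    let Y := Y.unop
    change Function.Bijective (fun g : A ⟶ shiftRight L (X ⨿ Y) =>
      (g ≫ shiftRightMap L coprod.inl, g ≫ shiftRightMap L coprod.inr))
    constructor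
    · intro g g' h
      rw [Prod.mk.injEq] at h
      refine DayLike.hom_ext (C := C) fun a p => (key a X Y).injective (Prod.ext ?_ ?_)
      · exact congrArg (fun k : A ⟶ shiftRight L X => app k p) h.1
      · exact congrArg (fun k : A ⟶ shiftRight L Y => app k p) h.2
    · rintro ⟨g, g'⟩
      let e (a : C) := Equiv.ofBijective _ (key a X Y)
      have h1 (a : C) (t : El L (a ⊗ X) × El L (a ⊗ Y)) :
          res (a ◁ coprod.inl) ((e a).symm t) = t.1 :=
        congrArg Prod.fst ((e a).apply_symm_apply t)
      have h2 (a : C) (t : El L (a ⊗ X) × El L (a ⊗ Y)) :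
          res (a ◁ coprod.inr) ((e a).symm t) = t.2 :=
        congrArg Prod.snd ((e a).apply_symm_apply t)
      refine ⟨homMk (C := C) (fun a p => ((e a).symm (app g p, app g' p) : El L (a ⊗ (X ⨿ Y))))
        fun a b f p => (key a X Y).injective (Prod.ext ?_ ?_), Prod.ext ?_ ?_⟩
      · refine (h1 a _).trans ((app_res g f p).trans ?_)
        refine Eq.trans ?_ (res_res (P := L) (a ◁ coprod.inl) (f ▷ (X ⨿ Y)) _).symm
        rw [whisker_exchange, ← res_res, h1]
        rfl
      · refine (h2 a _).trans ((app_res g' f p).trans ?_)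
        refine Eq.trans ?_ (res_res (P := L) (a ◁ coprod.inr) (f ▷ (X ⨿ Y)) _).symm
        rw [whisker_exchange, ← res_res, h2]
        rfl
      · exact DayLike.hom_ext (C := C) (Q := shiftRight L X) fun a p => h1 a _
      · exact DayLike.hom_ext (C := C) (Q := shiftRight L Y) fun a p => h2 a _
  · change Nonempty (Unique (A ⟶ shiftRight L (⊥_ C)))
    have u (a : C) : Unique (El L (a ⊗ ⊥_ C)) := (key' a).some
    exact ⟨⟨⟨homMk (C := C) (fun a _ => (default : El L (a ⊗ ⊥_ C)))
      fun a b f p => (u a).eq_default _ |>.symm⟩, fun g => DayLike.hom_ext (C := C) fun a p =>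
        ((u a).eq_default _).trans ((u a).eq_default _).symm⟩⟩

/-- By adjunction, `X ◁ g` is inverted by `Hom(-, L)` if `g` is inverted by `Hom(-, [X, L])`. -/
lemma isLocal_whiskerLeft (X : PSh C) {Y₁ Y₂ : PSh C} (g : Y₁ ⟶ Y₂)
    (hg : (continuous C).isLocal g) : (continuous C).isLocal (X ◁ g) := by
  intro L hL
  have hL' : PreservesFiniteProducts L.functor := hL
  have h := hg _ (preservesFiniteProducts_internalHom X L)
  have e : (fun k : X ⊗ Y₂ ⟶ L => X ◁ g ≫ k) = (internalHomEquiv X Y₁ L).symm ∘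
      (fun k => g ≫ k) ∘ internalHomEquiv X Y₂ L := by
    funext k
    rw [Function.comp_apply, Equiv.eq_symm_apply]
    exact internalHomEquiv_naturality _ _
  rw [e]
  exact (Equiv.bijective _).comp (h.comp (Equiv.bijective _))

lemma isLocal_whiskerRight {Y₁ Y₂ : PSh C} (g : Y₁ ⟶ Y₂)
    (hg : (continuous C).isLocal g) (X : PSh C) : (continuous C).isLocal (g ▷ X) := by
  have := BraidedCategory.braiding_naturality_left g X
  rw [← Iso.eq_comp_inv] at this
  rw [this]
  exact MorphismProperty.RespectsIso.postcomp _ _ _ <|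
    MorphismProperty.RespectsIso.precomp _ _ _ <| isLocal_whiskerLeft X g hg

variable (C) in
/-- The morphisms that are inverted by the reflection into the presheaves that preserve finite
products are stable under the tensor product. -/
lemma isMonoidal_isLocal : (continuous C).isLocal.IsMonoidal where
  whiskerLeft X _ _ g hg := isLocal_whiskerLeft X g hg
  whiskerRight f hf Y := isLocal_whiskerRight f hf Y

end PSh

/-! ### The tensor product of `Q` distributes over `⊕` -/

namespace Superop

/-- Precomposition with the inclusion of a summand selects columns of a matrix. -/
lemma whiskerLeft_inl_comp_entry {H K L M : Superop} (m : H ⊗ sum K L ⟶ M) (i : M.index)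
    (j : (H ⊗ K).index) : (H ◁ inl K L ≫ m).entry i j = m.entry i (j.1, Sum.inl j.2) := by
  have := ofFam_whisker H (inlFam K L)
  refine (congrArg (fun f : H ⊗ K ⟶ H ⊗ sum K L => (f ≫ m).entry i j) this).trans ?_
  refine (ofHom_comp_entry (H := tensor H K) (K := tensor H (sum K L))
    (𝟙 H.fam ⊗ₘ inlFam K L) m i j).trans ?_
  exact (congrArg (fun f => Hom.entry m i _ ∘ₗ f) tensorOp_id).trans (LinearMap.comp_id _)

lemma whiskerLeft_inr_comp_entry {H K L M : Superop} (m : H ⊗ sum K L ⟶ M) (i : M.index)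
    (j : (H ⊗ L).index) : (H ◁ inr K L ≫ m).entry i j = m.entry i (j.1, Sum.inr j.2) := by
  have := ofFam_whisker H (inrFam K L)
  refine (congrArg (fun f : H ⊗ L ⟶ H ⊗ sum K L => (f ≫ m).entry i j) this).trans ?_
  refine (ofHom_comp_entry (H := tensor H L) (K := tensor H (sum K L))
    (𝟙 H.fam ⊗ₘ inrFam K L) m i j).trans ?_
  exact (congrArg (fun f => Hom.entry m i _ ∘ₗ f) tensorOp_id).trans (LinearMap.comp_id _)

/-- The tensor product distributes over `⊕`. -/
def whiskerLeftSumIsColimit (H K L : Superop) :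
    IsColimit (BinaryCofan.mk (H ◁ inl K L) (H ◁ inr K L)) :=
  BinaryCofan.isColimitMk
    (fun s =>
      { entry := fun i j => match j with
          | (j, .inl k) => s.inl.entry i (j, k)
          | (j, .inr k) => s.inr.entry i (j, k)
        isCompletelyPositive := fun i j => match j with
          | (j, .inl k) => s.inl.isCompletelyPositive i (j, k)
          | (j, .inr k) => s.inr.isCompletelyPositive i (j, k)
        trace_le := fun j => match j with
          | (j, .inl k) => s.inl.trace_le (j, k)
          | (j, .inr k) => s.inr.trace_le (j, k) })
    (fun s => hom_ext fun i j => whiskerLeft_inl_comp_entry _ i j)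
    (fun s => hom_ext fun i j => whiskerLeft_inr_comp_entry _ i j)
    (fun s m h h' => hom_ext fun i j => match j with
      | (j, .inl k) => (whiskerLeft_inl_comp_entry m i (j, k)).symm.trans
          (congrArg (fun f => Hom.entry f i (j, k)) h)
      | (j, .inr k) => (whiskerLeft_inr_comp_entry m i (j, k)).symm.trans
          (congrArg (fun f => Hom.entry f i (j, k)) h'))

/-- The tensor product preserves the empty family in the second variable. -/
def tensorEmptyIsInitial (H : Superop) : IsInitial (H ⊗ empty) :=
  IsInitial.ofUniqueHom
    (fun K => ⟨fun _ j => j.2.elim0, fun _ j => j.2.elim0, fun j => j.2.elim0⟩)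
    fun K f => hom_ext fun _ j => j.2.elim0

instance (H : Superop) : PreservesFiniteCoproducts (tensorLeft H) := by
  have : PreservesColimitsOfShape (Discrete WalkingPair) (tensorLeft H) := ⟨fun {K} => by
    have : PreservesColimit (pair (K.obj ⟨.left⟩) (K.obj ⟨.right⟩)) (tensorLeft H) :=
      preservesColimit_of_preserves_colimit_cocone (sumIsColimit _ _)
        ((isColimitMapCoconeBinaryCofanEquiv (tensorLeft H) _ _).symm
          (whiskerLeftSumIsColimit H _ _))
    exact preservesColimit_of_iso_diagram (tensorLeft H) (diagramIsoPair K).symm⟩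
  have : PreservesColimitsOfShape (Discrete PEmpty.{1}) (tensorLeft H) := ⟨fun {K} => by
    have : PreservesColimit (Functor.empty.{0} Superop) (tensorLeft H) :=
      preservesColimit_of_preserves_colimit_cocone emptyIsInitial
        ((isColimitMapCoconeEmptyCoconeEquiv (tensorLeft H) _).symm (tensorEmptyIsInitial H))
    exact preservesColimit_of_iso_diagram (tensorLeft H) (Functor.emptyExt (Functor.empty.{0} _) K)⟩
  exact ⟨fun n => PreservesFiniteCoproducts.of_preserves_binary_and_initial _ _⟩

end Superop

/-! ### The reflection into the presheaves that preserve finite products -/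

namespace ContPSh

instance : productPreserving.ι.IsRightAdjoint := PSh.isRightAdjoint_ι_continuous Superop

/-- The reflection. -/
noncomputable abbrev refl : PSh Superop ⥤ ContPSh := productPreserving.ι.leftAdjoint

/-- The adjunction of the reflection and the inclusion. -/
noncomputable abbrev adj : refl ⊣ productPreserving.ι := .ofIsRightAdjoint productPreserving.ι

instance : productPreserving.isLocal.IsMonoidal := PSh.isMonoidal_isLocal Superop

instance : refl.IsLocalization productPreserving.isLocal := by
  have e : (· ∈ Set.range productPreserving.ι.obj) = productPreserving :=
    funext fun P => propext ⟨fun ⟨Q, hQ⟩ => hQ ▸ Q.2, fun h => ⟨⟨P, h⟩, rfl⟩⟩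
  have := ObjectProperty.isLocalization_isLocal adj
  rwa [e] at this

/-- The tensor product of presheaves that preserve finite products is the reflection of the Day
convolution. -/
noncomputable instance : MonoidalCategory ContPSh :=
  inferInstanceAs (MonoidalCategory
    (LocalizedMonoidal refl productPreserving.isLocal (Iso.refl _)))

noncomputable instance : SymmetricCategory ContPSh :=
  inferInstanceAs (SymmetricCategory
    (LocalizedMonoidal refl productPreserving.isLocal (Iso.refl _)))

noncomputable instance : refl.Braided :=
  inferInstanceAs (Localization.Monoidal.toMonoidalCategory refl productPreserving.isLocal
    (Iso.refl _)).Braided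

noncomputable instance : MonoidalClosed ContPSh := Monoidal.Reflective.monoidalClosed adj

end ContPSh

/-! ### Day convolution on presheaves on finite sets -/

namespace FinSet

/-- A bijection of finite sets as an isomorphism. -/
def isoOfEquiv {a b : FinSet} (e : a ≃ b) : a ≅ b :=
  ⟨e, e.symm, funext e.symm_apply_apply, funext e.apply_symm_apply⟩

/-- The cartesian monoidal structure. -/
instance : MonoidalCategoryStruct FinSet where
  tensorObj := prod
  tensorUnit := unit
  tensorHom f g := Prod.map f g
  whiskerLeft a {_ _} g := Prod.map id g
  whiskerRight f b := Prod.map f id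
  associator a b c := isoOfEquiv (Equiv.prodAssoc a b c)
  leftUnitor a := isoOfEquiv (Equiv.punitProd a)
  rightUnitor a := isoOfEquiv (Equiv.prodPUnit a)

instance : MonoidalCategory FinSet := .ofTensorHom
  (id_tensorHom_id := fun _ _ => rfl)
  (tensorHom_comp_tensorHom := fun _ _ _ _ => rfl)
  (associator_naturality := fun _ _ _ => rfl)
  (leftUnitor_naturality := fun _ => rfl)
  (rightUnitor_naturality := fun _ => rfl)
  (pentagon := fun _ _ _ _ => rfl)
  (triangle := fun _ _ => rfl)

instance : SymmetricCategory FinSet where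
  braiding a b := isoOfEquiv (Equiv.prodComm a b)
  braiding_naturality_right _ _ _ _ := rfl
  braiding_naturality_left _ _ := rfl
  hexagon_forward _ _ _ := rfl
  hexagon_reverse _ _ _ := rfl
  symmetry _ _ := rfl

/-- The first projection. -/
def fst (a b : FinSet) : a ⊗ b ⟶ a := Prod.fst

/-- The second projection. -/
def snd (a b : FinSet) : a ⊗ b ⟶ b := Prod.snd

/-- The diagonal. -/
def diag (a : FinSet) : a ⟶ a ⊗ a := fun x => (x, x)

/-- The map to the one-element set. -/
def toUnit (a : FinSet) : a ⟶ 𝟙_ FinSet := fun _ => ()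

/-- Day convolution is the cartesian product: a pair of elements of `P x` and `Q y` gives an element
of `P × Q` at `x × y` by restriction along the projections. -/
instance : DayLike FinSet (FinSetᵒᵖ ⥤ Type) where
  El P x := P.obj (op x)
  res {P _ _} f p := P.map f.op p
  app α _ p := α.app _ p
  res_id {P _} p := P.map_id_apply _ p
  res_res {P _ _ _} f g p := (P.map_comp_apply g.op f.op p).symm
  app_res α _ _ f p := NatTrans.naturality_apply α f.op p
  app_id p := rfl
  app_comp α β _ p := rfl
  hom_ext h := NatTrans.ext (funext fun x => by ext p; exact h x.unop p)
  homMk φ h := { app := fun x => ↾(φ x.unop), naturality := fun _ _ f => by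
    { ext p; exact h _ _ f.unop p } }
  app_homMk φ h _ p := rfl
  pair {P Q x y} p q := (P.map (fst x y).op p, Q.map (snd x y).op q)
  pair_res {P Q _ _ _ _} f g p q := by
    refine Prod.ext ?_ ?_
    · change P.map _ (P.map _ _) = P.map _ (P.map _ _)
      rw [← P.map_comp_apply, ← P.map_comp_apply]
      rfl
    · change Q.map _ (Q.map _ _) = Q.map _ (Q.map _ _)
      rw [← Q.map_comp_apply, ← Q.map_comp_apply]
      rfl
  exists_pair {P Q z} t := by
    refine ⟨z, z, diag z, t.1, t.2, ?_⟩
    refine Prod.ext ?_ ?_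
    · change _ = P.map (diag z).op (P.map _ t.1)
      rw [← P.map_comp_apply]
      exact (P.map_id_apply _ _).symm
    · change _ = Q.map (diag z).op (Q.map _ t.2)
      rw [← Q.map_comp_apply]
      exact (Q.map_id_apply _ _).symm
  desc {P Q R} φ h :=
    { app := fun x => ↾fun p => R.map (diag x.unop).op (φ _ _ p.1 p.2)
      naturality := fun x y f => by
        ext p
        change R.map (diag y.unop).op (φ _ _ (P.map f p.1) (Q.map f p.2)) =
          R.map f (R.map (diag x.unop).op (φ _ _ p.1 p.2))
        refine (congrArg (R.map (diag y.unop).op) (h _ _ _ _ f.unop f.unop p.1 p.2)).trans ?_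
        rw [← R.map_comp_apply, ← R.map_comp_apply]
        rfl }
  app_desc_pair {P Q R} φ h x y p q := by
    refine (congrArg (R.map (diag (x ⊗ y)).op) (h _ _ _ _ (fst x y) (snd x y) p q)).trans ?_
    rw [← R.map_comp_apply]
    exact R.map_id_apply _ _
  one := PUnit.unit
  exists_one {z} t := ⟨toUnit z, rfl⟩
  descOne {R} r :=
    { app := fun x => ↾fun _ => R.map (toUnit x.unop).op r
      naturality := fun x y f => by
        ext p
        change R.map _ r = R.map f (R.map _ r)
        rw [← R.map_comp_apply]
        rfl }
  app_descOne {R} r := R.map_id_apply _ _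
  app_tensorHom {P Q P' Q'} α β x y p q := by
    refine Prod.ext ?_ ?_
    · change α.app _ (P.map (fst x y).op p) = P'.map (fst x y).op (α.app _ p)
      exact NatTrans.naturality_apply α _ p
    · change β.app _ (Q.map (snd x y).op q) = Q'.map (snd x y).op (β.app _ q)
      exact NatTrans.naturality_apply β _ q
  app_associator {P Q R x y z} p q r := by
    refine Prod.ext ?_ (Prod.ext ?_ ?_)
    · change P.map _ (P.map _ p) = P.map _ (P.map _ p)
      rw [← P.map_comp_apply, ← P.map_comp_apply]
      rfl
    · change Q.map _ (Q.map _ q) = Q.map _ (Q.map _ (Q.map _ q))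
      rw [← Q.map_comp_apply, ← Q.map_comp_apply, ← Q.map_comp_apply]
      rfl
    · change R.map _ r = R.map _ (R.map _ (R.map _ r))
      rw [← R.map_comp_apply, ← R.map_comp_apply]
      rfl
  app_leftUnitor {P x} p := rfl
  app_rightUnitor {P x} p := rfl
  app_braiding {P Q x y} p q := by
    refine Prod.ext ?_ ?_
    · change Q.map _ q = Q.map _ (Q.map _ q)
      rw [← Q.map_comp_apply]
      rfl
    · change P.map _ p = P.map _ (P.map _ p)
      rw [← P.map_comp_apply]
      rfl

end FinSet

/-! ### The functor `Φ` is symmetric monoidal -/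

namespace FinFam
variable {C : Type u} [Category.{v} C] [MonoidalCategory C]

/-- A family of isomorphisms with the same index sets. -/
def isoOfIndex {a : FinSet} {X Y : a → C} (e : ∀ i, X i ≅ Y i) : (⟨a, X⟩ : FinFam C) ≅ ⟨a, Y⟩ where
  hom := ⟨id, fun i => (e i).hom⟩
  inv := ⟨id, fun i => (e i).inv⟩
  hom_inv_id := hom_ext fun i => (e i).hom_inv_id
  inv_hom_id := hom_ext fun i => (e i).inv_hom_id

/-- The functor `A ↦ {I}_{a ∈ A}` is strong symmetric monoidal. -/
def unitFamilyCoreMonoidal : (unitFamily C).CoreMonoidal where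
  εIso := Iso.refl _
  μIso A B := isoOfIndex fun _ => λ_ (𝟙_ C)
  μIso_hom_natural_left f B := hom_ext fun _ =>
    show 𝟙 (𝟙_ C) ▷ 𝟙_ C ≫ (λ_ (𝟙_ C)).hom = (λ_ (𝟙_ C)).hom ≫ 𝟙 _ by simp
  μIso_hom_natural_right A f := hom_ext fun _ =>
    show 𝟙_ C ◁ 𝟙 (𝟙_ C) ≫ (λ_ (𝟙_ C)).hom = (λ_ (𝟙_ C)).hom ≫ 𝟙 _ by simp
  associativity A B D := hom_ext fun _ =>
    show (λ_ (𝟙_ C)).hom ▷ 𝟙_ C ≫ (λ_ (𝟙_ C)).hom ≫ 𝟙 (𝟙_ C) =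
      (α_ _ _ _).hom ≫ 𝟙_ C ◁ (λ_ (𝟙_ C)).hom ≫ (λ_ (𝟙_ C)).hom by simp [unitors_equal]
  left_unitality A := hom_ext fun _ =>
    show (λ_ (𝟙_ C)).hom = 𝟙 (𝟙_ C) ▷ 𝟙_ C ≫ (λ_ (𝟙_ C)).hom ≫ 𝟙 (𝟙_ C) by simp
  right_unitality A := hom_ext fun _ =>
    show (ρ_ (𝟙_ C)).hom = 𝟙_ C ◁ 𝟙 (𝟙_ C) ≫ (λ_ (𝟙_ C)).hom ≫ 𝟙 (𝟙_ C) by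
      simp [unitors_equal]

instance [SymmetricCategory C] : (unitFamily C).Braided :=
  { unitFamilyCoreMonoidal.toMonoidal with
    braided := fun A B => hom_ext fun _ =>
      show (λ_ (𝟙_ C)).hom ≫ 𝟙 (𝟙_ C) = (β_ (𝟙_ C) (𝟙_ C)).hom ≫ (λ_ (𝟙_ C)).hom by
        rw [Category.comp_id, braiding_leftUnitor, unitors_equal] }

/-! ### The functor `Ψ` is symmetric monoidal -/

variable {D : Type u'} [Category.{v'} D] [MonoidalCategory D] (F : C ⥤ D)

open Functor.LaxMonoidal in
/-- The functor `C⁺ ⥤ D⁺` induced by a strong monoidal functor is strong monoidal. -/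
def mapFamilyCoreMonoidal [F.Monoidal] : (mapFamily F).CoreMonoidal where
  εIso := isoOfIndex fun _ => Functor.Monoidal.εIso F
  μIso X Y := isoOfIndex fun p => Functor.Monoidal.μIso F (X.obj p.1) (Y.obj p.2)
  μIso_hom_natural_left f Y := hom_ext fun p => μ_natural_left F _ _
  μIso_hom_natural_right X f := hom_ext fun p => μ_natural_right F _ _
  associativity X Y Z := hom_ext fun p => Functor.LaxMonoidal.associativity F _ _ _
  left_unitality X := hom_ext fun p => Functor.LaxMonoidal.left_unitality F _
  right_unitality X := hom_ext fun p => Functor.LaxMonoidal.right_unitality F _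

instance [SymmetricCategory C] [SymmetricCategory D] [F.Braided] : (mapFamily F).Braided :=
  { (mapFamilyCoreMonoidal F).toMonoidal with
    braided := fun X Y => hom_ext fun _ => Functor.LaxBraided.braided _ _ }

end FinFam

namespace Superop

/-- The functor `ofFam` is strict monoidal. -/
def ofFamCoreMonoidal : ofFam.CoreMonoidal where
  εIso := Iso.refl _
  μIso X Y := Iso.refl _
  μIso_hom_natural_left {X Y} f Z := (Category.comp_id _).trans
    ((whisker_ofFam (H := ofFam.obj X) (K := ofFam.obj Y) (ofFam.obj Z) f).trans
      (Category.id_comp _).symm)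
  μIso_hom_natural_right {X Y} Z f := (Category.comp_id _).trans
    ((ofFam_whisker (H := ofFam.obj X) (K := ofFam.obj Y) (ofFam.obj Z) f).trans
      (Category.id_comp _).symm)
  associativity X Y Z :=
    have h {X Y Z : Superop} : 𝟙 (X ⊗ Y) ▷ Z ≫ 𝟙 ((X ⊗ Y) ⊗ Z) ≫ (α_ X Y Z).hom =
      (α_ X Y Z).hom ≫ X ◁ 𝟙 (Y ⊗ Z) ≫ 𝟙 (X ⊗ Y ⊗ Z) := by simp
    h (X := ofFam.obj X) (Y := ofFam.obj Y) (Z := ofFam.obj Z)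
  left_unitality X :=
    have h {X : Superop} : (λ_ X).hom = 𝟙 (𝟙_ _) ▷ X ≫ 𝟙 (𝟙_ _ ⊗ X) ≫ (λ_ X).hom := by simp
    h (X := ofFam.obj X)
  right_unitality X :=
    have h {X : Superop} : (ρ_ X).hom = X ◁ 𝟙 (𝟙_ _) ≫ 𝟙 (X ⊗ 𝟙_ _) ≫ (ρ_ X).hom := by simp
    h (X := ofFam.obj X)

instance : ofFam.Braided :=
  { ofFamCoreMonoidal.toMonoidal with
    braided := fun X Y => (Category.id_comp _).trans
      (Category.comp_id (β_ (ofFam.obj X) (ofFam.obj Y)).hom).symm }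

end Superop

section Discard
open Matrix
open scoped Kronecker
variable {X Y Z X' Y' Z' : Type} [Fintype X] [Fintype Y] [Fintype Z] [Fintype X'] [Fintype Y']
  [Fintype Z'] [DecidableEq X] [DecidableEq Y] [DecidableEq Z]
  [DecidableEq X'] [DecidableEq Y'] [DecidableEq Z']

/-- The tensor product of two maps that relabel and discard basis vectors is of the same form. -/
lemma tensorOp_discard (r : X → Y) (s : X → Z) (r' : X' → Y') (s' : X' → Z') :
    tensorOp (discard r s) (discard r' s') = discard (Prod.map r r') (Prod.map s s') :=
  kronecker_ext fun A B => by
    ext ⟨y, y'⟩ ⟨w, w'⟩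
    simp only [tensorOp_kronecker, Matrix.kroneckerMap_apply, discard_apply,
      Fintype.sum_prod_type, Prod.map, Prod.mk.injEq]
    rw [Finset.sum_mul_sum]
    refine Finset.sum_congr rfl fun x _ => Finset.sum_congr rfl fun x' _ => ?_
    rw [Finset.sum_mul_sum]
    refine Finset.sum_congr rfl fun x₁ _ => Finset.sum_congr rfl fun x₁' _ => ?_
    by_cases h : r x = y ∧ r x₁ = w ∧ s x = s x₁
    · by_cases h' : r' x' = y' ∧ r' x₁' = w' ∧ s' x' = s' x₁'
      · simp [h, h']
      · rw [if_neg h', mul_zero, if_neg]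
        tauto
    · rw [if_neg h, zero_mul, if_neg]
      tauto

lemma id_eq_discard : (LinearMap.id : Matrix X X ℂ →ₗ[ℂ] _) = discard id (fun _ => ()) := by
  ext1 ρ
  exact (discard_equiv (Equiv.refl X) _ (fun _ _ => rfl) ρ).symm

end Discard

namespace Fwm

/-- The basis vectors of `(⊗ V_i) ⊗ (⊗ W_j)` are those of `⊗ (V, W)_k`. -/
noncomputable def splitEquiv (V W : Fwm FinSet) :
    (∀ i, (tensor V W).obj i) ≃ (∀ i, V.obj i) × (∀ i, W.obj i) where
  toFun x := (fun i => cast (congrArg FinSet.El (tensor_obj_inl i)) (x (inl i)),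
    fun i => cast (congrArg FinSet.El (tensor_obj_inr i)) (x (inr i)))
  invFun p := Fin.addCases (motive := fun i => ((tensor V W).obj i).El)
    (fun i => cast (congrArg FinSet.El (tensor_obj_inl i)).symm (p.1 i))
    (fun i => cast (congrArg FinSet.El (tensor_obj_inr i)).symm (p.2 i))
  left_inv x := by
    funext i
    refine Fin.addCases (fun i => ?_) (fun i => ?_) i
    · simp only [inl, Fin.addCases_left]
      exact (cast_cast _ _ _).trans (cast_eq _ _)
    · simp only [inr, Fin.addCases_right]
      exact (cast_cast _ _ _).trans (cast_eq _ _)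
  right_inv p := by
    refine Prod.ext (funext fun i => ?_) (funext fun i => ?_)
    · simp only [inl, Fin.addCases_left]
      exact (cast_cast _ _ _).trans (cast_eq _ _)
    · simp only [inr, Fin.addCases_right]
      exact (cast_cast _ _ _).trans (cast_eq _ _)

/-- The projection that discards `W`. -/
def fst (V W : Fwm FinSet) : V ⊗ W ⟶ V := homOf (X := tensor V W) inl (by simp) (by simp)

/-- The projection that discards `V`. -/
def snd (V W : Fwm FinSet) : V ⊗ W ⟶ W := homOf (X := tensor V W) inr (by simp) (by simp)

/-- `⊗ (V, W) ≅ (⊗ V) ⊗ (⊗ W)`. -/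
noncomputable def splitIso (V W : Fwm FinSet) :
    toSuperop.obj (V ⊗ W) ≅ toSuperop.obj V ⊗ toSuperop.obj W :=
  SimpleSuperop.relabelIso (H := toSuperop.obj (V ⊗ W))
    (K := .tensor (toSuperop.obj V) (toSuperop.obj W)) (splitEquiv V W)

/-- The tensor product of the empty sequence is the one-dimensional space. -/
noncomputable def unitIso : toSuperop.obj (𝟙_ _) ≅ 𝟙_ SimpleSuperop :=
  SimpleSuperop.relabelIso (H := toSuperop.obj (𝟙_ _)) (K := .unit)
    ⟨fun _ => (), fun _ i => i.elim0, fun _ => funext fun i => i.elim0, fun _ => rfl⟩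

lemma rest_eq_iff {V W : Fwm FinSet} (f : V ⟶ W) (x x' : ∀ i, V.obj i) :
    rest f x = rest f x' ↔ ∀ i, (∀ j, f.map j ≠ i) → x i = x' i :=
  ⟨fun h i hi => congrFun h ⟨i, hi⟩, fun h => funext fun i => h i.1 i.2⟩

/-- The morphism `f` is `discard r s`: it maps the basis vector `x` to `r x` and discards `s x`. -/
def IsDiscard {H K : SimpleSuperop} (f : H ⟶ K) {Z : Type} (r : H.space → K.space)
    (s : H.space → Z) : Prop :=
  ∃ (_ : Fintype Z) (_ : DecidableEq Z), f.lin = discard r s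

namespace IsDiscard
variable {H H' K K' L : SimpleSuperop} {Z Z' : Type}

/-- A morphism `discard r s` depends only on `r` and on the equivalence relation that `s` defines,
so that an equation between such morphisms is an equation between functions of basis vectors. -/
lemma eq {f g : H ⟶ K} {r r' : H.space → K.space} {s : H.space → Z} {s' : H.space → Z'}
    (hf : IsDiscard f r s) (hg : IsDiscard g r' s') (h : ∀ x, r x = r' x)
    (h' : ∀ x x', s x = s x' ↔ s' x = s' x') : f = g := by
  obtain ⟨_, _, hf⟩ := hf
  obtain ⟨_, _, hg⟩ := hg
  exact SimpleSuperop.hom_ext (hf.trans ((discard_congr h h').trans hg.symm))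

lemma comp {f : H ⟶ K} {g : K ⟶ L} {r : H.space → K.space} {r' : K.space → L.space}
    {s : H.space → Z} {s' : K.space → Z'} (hf : IsDiscard f r s) (hg : IsDiscard g r' s') :
    IsDiscard (f ≫ g) (fun x => r' (r x)) (fun x => (s x, s' (r x))) := by
  obtain ⟨_, _, hf⟩ := hf
  obtain ⟨_, _, hg⟩ := hg
  refine ⟨inferInstance, inferInstance, ?_⟩
  rw [SimpleSuperop.comp_lin, hf, hg, discard_comp]
  rfl

lemma tensor {f : H ⟶ K} {g : H' ⟶ K'} {r : H.space → K.space} {r' : H'.space → K'.space}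
    {s : H.space → Z} {s' : H'.space → Z'} (hf : IsDiscard f r s) (hg : IsDiscard g r' s') :
    IsDiscard (H := H ⊗ H') (K := K ⊗ K') (f ⊗ₘ g) (Prod.map r r') (Prod.map s s') := by
  obtain ⟨_, _, hf⟩ := hf
  obtain ⟨_, _, hg⟩ := hg
  refine ⟨inferInstance, inferInstance, ?_⟩
  refine Eq.trans ?_ (tensorOp_discard _ _ _ _)
  rw [← hf, ← hg]
  rfl

lemma relabelIso (e : H.space ≃ K.space) :
    IsDiscard (SimpleSuperop.relabelIso e).hom e (fun _ => ()) :=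
  ⟨inferInstance, inferInstance, relabel_eq e⟩

lemma relabelIso_inv (e : H.space ≃ K.space) :
    IsDiscard (SimpleSuperop.relabelIso e).inv e.symm (fun _ => ()) :=
  ⟨inferInstance, inferInstance, relabel_eq e.symm⟩

lemma id (H : SimpleSuperop) : IsDiscard (𝟙 H) _root_.id (fun _ => ()) :=
  ⟨inferInstance, inferInstance, id_eq_discard⟩

lemma map {V W : Fwm FinSet} (f : V ⟶ W) : IsDiscard (toSuperop.map f) (restrict f) (rest f) :=
  ⟨inferInstance, inferInstance, rfl⟩

lemma map_iso {V W : Fwm FinSet} (f : V ≅ W) :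
    IsDiscard (toSuperop.map f.hom) (restrict f.hom) (fun _ => ()) := by
  refine ⟨inferInstance, inferInstance, discard_congr (fun _ => rfl) fun x x' => ?_⟩
  simp only [rest_eq_iff, iff_true]
  intro i hi
  exact absurd (congrFun (congrArg Hom.map f.hom_inv_id) i) (hi (f.inv.map i))

lemma splitIso (V W : Fwm FinSet) : IsDiscard (splitIso V W).hom
    (fun x => (restrict (fst V W) x, restrict (snd V W) x)) (fun _ => ()) := relabelIso _

lemma unitIso : IsDiscard unitIso.hom (fun _ => ()) (fun _ => ()) := relabelIso _

end IsDiscard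

lemma restrict_restrict {U V V' W : Fwm FinSet} {f : U ⟶ V} {g : V ⟶ W} {f' : U ⟶ V'} {g' : V' ⟶ W}
    (h : ∀ i, f.map (g.map i) = f'.map (g'.map i)) (x : ∀ i, U.obj i) :
    restrict g (restrict f x) = restrict g' (restrict f' x) := by
  rw [← restrict_comp, hom_ext (f := f ≫ g) (g := f' ≫ g') h, restrict_comp]

lemma restrict_restrict_eq {U V W : Fwm FinSet} {f : U ⟶ V} {g : V ⟶ W} {h : U ⟶ W}
    (w : ∀ i, f.map (g.map i) = h.map i) (x : ∀ i, U.obj i) :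
    restrict g (restrict f x) = restrict h x := by
  rw [← restrict_comp, hom_ext (f := f ≫ g) (g := h) w]

lemma associator_hom_map_inl (U V W : Fwm FinSet) (i : Fin U.len) :
    (α_ U V W).hom.map (inl (Y := tensor V W) i) = inl (inl i) := by
  change Hom.map (assoc U V W).hom _ = _
  simp [assoc]

lemma associator_hom_map_inr_inl (U V W : Fwm FinSet) (i : Fin V.len) :
    (α_ U V W).hom.map (inr (inl (X := V) (Y := W) i)) = inl (inr i) := by
  change Hom.map (assoc U V W).hom _ = _
  simp [assoc]

lemma associator_hom_map_inr_inr (U V W : Fwm FinSet) (i : Fin W.len) :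
    (α_ U V W).hom.map (inr (inr (X := V) (Y := W) i)) = inr i := by
  change Hom.map (assoc U V W).hom _ = _
  simp [assoc]

lemma braiding_hom_map_inl (V W : Fwm FinSet) (i : Fin W.len) :
    (β_ V W).hom.map (inl i) = inr i := cases_inl (X := W) (Y := V) _ _ i

lemma braiding_hom_map_inr (V W : Fwm FinSet) (i : Fin V.len) :
    (β_ V W).hom.map (inr i) = inl i := cases_inr (X := W) (Y := V) _ _ i

lemma tensorHom_map_inl {V V' W W' : Fwm FinSet} (f : V ⟶ V') (g : W ⟶ W') (i : Fin V'.len) :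
    (f ⊗ₘ g).map (inl i) = inl (f.map i) :=
  cases_inl (X := V') (Y := W') (fun i => (inl (f.map i) : Fin (tensor V W).len))
    (fun i => inr (g.map i)) i

lemma tensorHom_map_inr {V V' W W' : Fwm FinSet} (f : V ⟶ V') (g : W ⟶ W') (i : Fin W'.len) :
    (f ⊗ₘ g).map (inr i) = inr (g.map i) :=
  cases_inr (X := V') (Y := W') (fun i => (inl (f.map i) : Fin (tensor V W).len))
    (fun i => inr (g.map i)) i

/-- Both sides discard the factors outside the images of `f` and `g` and permute the others. -/
lemma splitIso_natural {V V' W W' : Fwm FinSet} (f : V ⟶ V') (g : W ⟶ W') :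
    (splitIso V W).hom ≫ (toSuperop.map f ⊗ₘ toSuperop.map g) =
      toSuperop.map (f ⊗ₘ g) ≫ (splitIso V' W').hom := by
  refine ((IsDiscard.splitIso V W).comp ((IsDiscard.map f).tensor (IsDiscard.map g))).eq
    ((IsDiscard.map (f ⊗ₘ g)).comp (IsDiscard.splitIso V' W')) (fun x => ?_) fun x x' => ?_
  · exact Prod.ext (restrict_restrict (fun i => (tensorHom_map_inl f g i).symm) x)
      (restrict_restrict (fun i => (tensorHom_map_inr f g i).symm) x)
  · have h1 (i : Fin V.len) : restrict (fst V W) x i = restrict (fst V W) x' i ↔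
      x (inl i) = x' (inl i) := restrict_eq_iff (fst V W) x x' i
    have h2 (i : Fin W.len) : restrict (snd V W) x i = restrict (snd V W) x' i ↔
      x (inr i) = x' (inr i) := restrict_eq_iff (snd V W) x x' i
    rw [Prod.mk.injEq, Prod.mk.injEq]
    simp only [Prod.map, Prod.mk.injEq, true_and, and_true]
    rw [rest_eq_iff, rest_eq_iff]
    simp only [h1, h2]
    refine Iff.trans ?_ (rest_eq_iff (V := V ⊗ W) (f ⊗ₘ g) x x').symm
    refine Iff.trans ?_ (forall_tensor (X := V) (Y := W) (p := fun i =>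
      (∀ j, (f ⊗ₘ g).map j ≠ i) → x i = x' i)).symm
    have h3 (i : Fin (V ⊗ W).len) : (∀ j, (f ⊗ₘ g).map j ≠ i) ↔
        (∀ j, (inl (f.map j) : Fin (tensor V W).len) ≠ i) ∧
          ∀ j, (inr (g.map j) : Fin (tensor V W).len) ≠ i :=
      (forall_tensor (X := V') (Y := W')).trans (and_congr
        (forall_congr' fun j => by rw [tensorHom_map_inl])
        (forall_congr' fun j => by rw [tensorHom_map_inr]))
    simp only [h3]
    simp

/-- Each coherence condition is an equation between permutations of tensor factors, which is checked
on basis vectors. -/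
noncomputable instance : toSuperop.OplaxMonoidal where
  η := unitIso.hom
  δ V W := (splitIso V W).hom
  δ_natural_left f W := by
    have := splitIso_natural f (𝟙 W)
    rwa [toSuperop.map_id, tensorHom_id, tensorHom_id] at this
  δ_natural_right W f := by
    have := splitIso_natural (𝟙 W) f
    rwa [toSuperop.map_id, id_tensorHom, id_tensorHom] at this
  oplax_associativity U V W := by
    rw [← tensorHom_id, ← id_tensorHom]
    refine ((IsDiscard.splitIso _ _).comp (((IsDiscard.splitIso _ _).tensor (.id _)).comp
      (.relabelIso _))).eq ((IsDiscard.map_iso (α_ U V W)).comp ((IsDiscard.splitIso _ _).comp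
        ((IsDiscard.id _).tensor (.splitIso _ _)))) (fun x => ?_) fun x x' => iff_of_true rfl rfl
    have h1 : restrict (fst U V) (restrict (fst (U ⊗ V) W) x) =
        restrict (fst U (V ⊗ W)) (restrict (α_ U V W).hom x) :=
      restrict_restrict (fun i => (associator_hom_map_inl U V W i).symm) x
    have h2 : restrict (snd U V) (restrict (fst (U ⊗ V) W) x) =
        restrict (fst V W) (restrict (snd U (V ⊗ W)) (restrict (α_ U V W).hom x)) :=
      (restrict_restrict (f' := (α_ U V W).hom) (g' := snd U (V ⊗ W) ≫ fst V W)
        (fun i => (associator_hom_map_inr_inl U V W i).symm) x).trans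
        (restrict_comp _ (fst V W) _)
    have h3 : restrict (snd (U ⊗ V) W) x =
        restrict (snd V W) (restrict (snd U (V ⊗ W)) (restrict (α_ U V W).hom x)) :=
      (restrict_restrict_eq (g := snd U (V ⊗ W) ≫ snd V W)
        (fun i => associator_hom_map_inr_inr U V W i) x).symm.trans
        (restrict_comp _ (snd V W) _)
    exact Prod.ext h1 (Prod.ext h2 h3)
  oplax_left_unitality V := by
    rw [← tensorHom_id]
    refine (IsDiscard.relabelIso_inv _).eq ((IsDiscard.map_iso (λ_ V).symm).comp
      ((IsDiscard.splitIso _ _).comp (IsDiscard.unitIso.tensor (.id _)))) (fun x => ?_)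
      fun x x' => iff_of_true rfl rfl
    have : x = restrict (snd _ V) (restrict (λ_ V).inv x) :=
      (restrict_restrict_eq (h := 𝟙 V)
        (fun i => cases_inr (X := unit) (Y := V) unitElim id i) x).symm
    exact Prod.ext rfl this
  oplax_right_unitality V := by
    rw [← id_tensorHom]
    refine (IsDiscard.relabelIso_inv _).eq ((IsDiscard.map_iso (ρ_ V).symm).comp
      ((IsDiscard.splitIso _ _).comp ((IsDiscard.id _).tensor .unitIso))) (fun x => ?_)
      fun x x' => iff_of_true rfl rfl
    have : x = restrict (fst V _) (restrict (ρ_ V).inv x) :=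
      (restrict_restrict_eq (h := 𝟙 V)
        (fun i => cases_inl (X := V) (Y := unit) id unitElim i) x).symm
    exact Prod.ext this rfl

lemma splitIso_braiding (V W : Fwm FinSet) :
    toSuperop.map (β_ V W).hom ≫ (splitIso W V).hom = (splitIso V W).hom ≫ (β_ _ _).hom := by
  refine ((IsDiscard.map_iso (β_ V W)).comp (IsDiscard.splitIso W V)).eq
    ((IsDiscard.splitIso V W).comp (IsDiscard.relabelIso _)) (fun x => ?_)
    fun x x' => iff_of_true rfl rfl
  have h1 : restrict (fst W V) (restrict (β_ V W).hom x) = restrict (snd V W) x :=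
    restrict_restrict_eq (fun i => braiding_hom_map_inl V W i) x
  have h2 : restrict (snd W V) (restrict (β_ V W).hom x) = restrict (fst V W) x :=
    restrict_restrict_eq (fun i => braiding_hom_map_inr V W i) x
  exact Prod.ext h1 h2

noncomputable instance : toSuperop.Braided :=
  haveI : IsIso (Functor.OplaxMonoidal.η toSuperop) := inferInstanceAs (IsIso unitIso.hom)
  haveI (V W : Fwm FinSet) : IsIso (Functor.OplaxMonoidal.δ toSuperop V W) :=
    inferInstanceAs (IsIso (splitIso V W).hom)
  { Functor.Monoidal.ofOplaxMonoidal toSuperop with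
    braided := fun V W => by
      change inv (splitIso V W).hom ≫ _ = _ ≫ inv (splitIso W V).hom
      rw [IsIso.inv_comp_eq, ← Category.assoc, IsIso.eq_comp_inv]
      exact splitIso_braiding V W }

end Fwm

instance : functorΦ.Braided := inferInstanceAs (FinFam.unitFamily (Fwm FinSet)).Braided

noncomputable instance : functorΨ.Braided :=
  inferInstanceAs (FinFam.mapFamily Fwm.toSuperop ⋙ Superop.ofFam).Braided

/-! ### The left Kan extensions along `Φ` and `Ψ` are symmetric monoidal -/

/-- `pullbackΦ` is precomposition with `Φ`. -/
def precompΦ : PrecompData functorΦ pullbackΦ where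
  equiv R x := Equiv.refl _
  equiv_res f r := rfl
  equiv_app α _ r := rfl

/-- `pullbackΨ` is precomposition with `Ψ`. -/
def precompΨ : PrecompData functorΨ pullbackΨ where
  equiv R x := Equiv.refl _
  equiv_res f r := rfl
  equiv_app α _ r := rfl

noncomputable instance : lanΦ.Braided := precompΦ.braided adjΦ

noncomputable instance : lanΨ.Braided := precompΨ.braided adjΨ

/-! ### The linear exponential comonad of an adjunction with a cartesian category -/

namespace CategoryTheory.Functor
open LaxMonoidal OplaxMonoidal Monoidal CartesianMonoidalCategory
variable {B : Type u'} [Category.{v'} B] [CartesianMonoidalCategory B] [SymmetricCategory B]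
  {C : Type u} [Category.{v} C] [MonoidalCategory C] [SymmetricCategory C] (L : B ⥤ C) [L.Braided]

/-- The comultiplication of `L X`: the image of the diagonal of `X`. -/
def dup (X : B) : L.obj X ⟶ L.obj X ⊗ L.obj X := L.map (lift (𝟙 X) (𝟙 X)) ≫ δ L X X

/-- The counit of `L X`: the image of `X ⟶ 𝟙_ B`. -/
def del (X : B) : L.obj X ⟶ 𝟙_ C := L.map (toUnit X) ≫ η L

lemma map_dup {X Y : B} (f : X ⟶ Y) : L.map f ≫ L.dup Y = L.dup X ≫ (L.map f ⊗ₘ L.map f) := by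
  simp only [dup, Category.assoc, δ_natural, ← L.map_comp_assoc]
  congr 2
  ext <;> simp

lemma map_del {X Y : B} (f : X ⟶ Y) : L.map f ≫ L.del Y = L.del X := by
  simp only [del, ← L.map_comp_assoc, comp_toUnit]

lemma dup_del_left (X : B) : L.dup X ≫ L.del X ▷ L.obj X = (λ_ (L.obj X)).inv :=
  letI : ComonObj X := ((cartesianComon B).obj X).comon
  letI := obj.instComonObj X L
  ComonObj.counit_comul (L.obj X)

lemma dup_del_right (X : B) : L.dup X ≫ L.obj X ◁ L.del X = (ρ_ (L.obj X)).inv :=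
  letI : ComonObj X := ((cartesianComon B).obj X).comon
  letI := obj.instComonObj X L
  ComonObj.comul_counit (L.obj X)

lemma dup_assoc (X : B) : L.dup X ≫ L.obj X ◁ L.dup X =
    L.dup X ≫ L.dup X ▷ L.obj X ≫ (α_ _ _ _).hom :=
  letI : ComonObj X := ((cartesianComon B).obj X).comon
  letI := obj.instComonObj X L
  ComonObj.comul_assoc (L.obj X)

lemma lift_id_braiding (X : B) : lift (𝟙 X) (𝟙 X) ≫ (β_ X X).hom = lift (𝟙 X) (𝟙 X) := by
  ext <;> simp

lemma dup_braiding (X : B) : L.dup X ≫ (β_ _ _).hom = L.dup X := by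
  have h : δ L X X ≫ (β_ (L.obj X) (L.obj X)).hom = L.map (β_ X X).hom ≫ δ L X X := by
    rw [Functor.map_braiding]
    simp
  rw [dup, Category.assoc, h, ← L.map_comp_assoc, lift_id_braiding]

/-- The comultiplication of `L (X ⊗ Y)` is that of the tensor product of the comonoids `L X` and
`L Y`, because the same holds for the diagonals in the cartesian category `B`. -/
lemma μ_dup (X Y : B) : μ L X Y ≫ L.dup (X ⊗ Y) =
    (L.dup X ⊗ₘ L.dup Y) ≫ tensorμ _ _ _ _ ≫ (μ L X Y ⊗ₘ μ L X Y) := by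
  have e : lift (𝟙 (X ⊗ Y)) (𝟙 (X ⊗ Y)) =
      (lift (𝟙 X) (𝟙 X) ⊗ₘ lift (𝟙 Y) (𝟙 Y)) ≫ tensorμ X X Y Y := by
    ext <;> simp
  have h := tensorμ_comp_μ_tensorHom_μ_comp_μ L X X Y Y
  rw [← cancel_mono (μ L (X ⊗ Y) (X ⊗ Y))]
  simp only [dup, Category.assoc, h, Monoidal.δ_μ, Category.comp_id]
  rw [tensorHom_comp_tensorHom_assoc, Category.assoc, Category.assoc, Monoidal.δ_μ,
    Monoidal.δ_μ, Category.comp_id, Category.comp_id, e, L.map_comp, ← μ_natural_assoc]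

lemma ε_dup : ε L ≫ L.dup (𝟙_ B) = (λ_ (𝟙_ C)).inv ≫ (ε L ⊗ₘ ε L) := by
  have e : lift (𝟙 (𝟙_ B)) (𝟙 (𝟙_ B)) = (λ_ (𝟙_ B)).inv := by
    ext
  rw [dup, e, ← cancel_mono (μ L _ _)]
  simp [MonoidalCategory.tensorHom_def']

lemma μ_del (X Y : B) : μ L X Y ≫ L.del (X ⊗ Y) = (L.del X ⊗ₘ L.del Y) ≫ (λ_ (𝟙_ C)).hom := by
  have e : toUnit (X ⊗ Y) = (toUnit X ⊗ₘ toUnit Y) ≫ (λ_ (𝟙_ B)).hom := toUnit_unique _ _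
  have h : μ L (𝟙_ B) (𝟙_ B) ≫ L.map (λ_ (𝟙_ B)).hom ≫ η L = (η L ⊗ₘ η L) ≫ (λ_ (𝟙_ C)).hom := by
    rw [← cancel_epi (ε L ⊗ₘ ε L), tensorHom_comp_tensorHom_assoc]
    simp [MonoidalCategory.tensorHom_def']
  simp only [del, e, L.map_comp, Category.assoc, ← μ_natural_assoc, h,
    tensorHom_comp_tensorHom_assoc]

lemma ε_del : ε L ≫ L.del (𝟙_ B) = 𝟙 (𝟙_ C) := by
  simp [del]

end CategoryTheory.Functor

namespace CategoryTheory.Adjunction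
open CategoryTheory.Functor CategoryTheory.Functor.LaxMonoidal CategoryTheory.Functor.OplaxMonoidal
open CartesianMonoidalCategory
variable {B : Type u'} [Category.{v'} B] [CartesianMonoidalCategory B] [SymmetricCategory B]
  {C : Type u} [Category.{v} C] [MonoidalCategory C] [SymmetricCategory C] {L : B ⥤ C}
  {I : C ⥤ B} (adj : L ⊣ I) [L.Braided]

/-- Every object `L X` is a commutative comonoid, because every object of a cartesian category
is one, and every morphism `L f` is a morphism of comonoids. -/
def linearExponentialComonad :
    letI := adj.symmetricMonoidalComonad
    LinearExponentialComonad adj.toComonad :=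
  letI := adj.rightLaxBraided
  letI := adj.symmetricMonoidalComonad
  { d A := L.dup (I.obj A)
    e A := L.del (I.obj A)
    counit_comul A := L.dup_del_left _
    comul_counit A := L.dup_del_right _
    comul_assoc A := L.dup_assoc _
    comul_comm A := L.dup_braiding _
    d_natural f := L.map_dup _
    e_natural f := L.map_del _
    d_tensor A A' := by
      change (μ L _ _ ≫ L.map (μ I A A')) ≫ L.dup (I.obj (A ⊗ A')) = _ ≫ _ ≫
        ((μ L _ _ ≫ L.map (μ I A A')) ⊗ₘ (μ L _ _ ≫ L.map (μ I A A')))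
      rw [Category.assoc, map_dup, reassoc_of% μ_dup]
      simp only [tensorHom_comp_tensorHom]
      rfl
    d_unit := by
      change (ε L ≫ L.map (ε I)) ≫ L.dup (I.obj (𝟙_ C)) = _ ≫
        ((ε L ≫ L.map (ε I)) ⊗ₘ (ε L ≫ L.map (ε I)))
      rw [Category.assoc, map_dup, reassoc_of% ε_dup]
      simp only [tensorHom_comp_tensorHom]
    e_tensor A A' := by
      change (μ L _ _ ≫ L.map (μ I A A')) ≫ L.del (I.obj (A ⊗ A')) = _
      rw [Category.assoc, map_del, μ_del]
      rfl
    e_unit := by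
      change (ε L ≫ L.map (ε I)) ≫ L.del (I.obj (𝟙_ C)) = _
      rw [Category.assoc, map_del, ε_del]
    d_coalgebra A := by
      have : adj.IsMonoidal := inferInstance
      -- Both sides are images under `L`; the equation holds in `B` before `L` is applied, by
      -- naturality of the unit of the adjunction, which is monoidal.
      change L.map (adj.unit.app (I.obj A)) ≫ L.map (I.map (L.dup (I.obj A))) = L.dup (I.obj A) ≫
        (L.map (adj.unit.app (I.obj A)) ⊗ₘ L.map (adj.unit.app (I.obj A))) ≫
          μ L _ _ ≫ L.map (μ I _ _)
      generalize I.obj A = X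
      have h : adj.unit.app X ≫ I.map (L.dup X) = lift (𝟙 X) (𝟙 X) ≫
          (adj.unit.app X ⊗ₘ adj.unit.app X) ≫ μ I _ _ := by
        rw [← adj.unit_app_tensor_comp_map_δ, ← adj.unit_naturality_assoc, ← I.map_comp]
        rfl
      rw [← L.map_comp, h, dup, L.map_comp, L.map_comp, Category.assoc, δ_natural_assoc]
      erw [Monoidal.δ_μ_assoc]
    e_coalgebra A := by
      have : adj.IsMonoidal := inferInstance
      change L.map (adj.unit.app (I.obj A)) ≫ L.map (I.map (L.del (I.obj A))) = L.del (I.obj A) ≫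
        ε L ≫ L.map (ε I)
      generalize I.obj A = X
      have h : adj.unit.app X ≫ I.map (L.del X) = toUnit X ≫ ε I := by
        rw [← adj.unit_app_unit_comp_map_η, ← adj.unit_naturality_assoc, ← I.map_comp]
        rfl
      rw [← L.map_comp, h, del, L.map_comp, Category.assoc, Monoidal.η_ε_assoc]
    δ_comul A := L.map_dup _
    δ_counit A := L.map_del _ }

end CategoryTheory.Adjunction

/-! ### Strength and Kleisli exponentials -/

/-- The strength `A ⊗ TB ⟶ TA ⊗ TB ⟶ T (A ⊗ B)` of a symmetric monoidal monad. -/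
def SymmetricMonoidalMonad.strength {C : Type u} [Category.{v} C] [MonoidalCategory C]
    [SymmetricCategory C] (T : Monad C) [SymmetricMonoidalMonad T] : MonadStrength T where
  t A B := T.η.app A ▷ T.obj B ≫ Functor.LaxMonoidal.μ T.toFunctor A B
  natural {A A' B B'} f g := by
    have h : f ≫ T.η.app A' = T.η.app A ≫ T.map f := T.η.naturality f
    rw [Category.assoc, ← Functor.LaxMonoidal.μ_natural, ← tensorHom_id, ← tensorHom_id,
      tensorHom_comp_tensorHom_assoc, tensorHom_comp_tensorHom_assoc, h, Category.comp_id,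
      Category.id_comp]
  unitality A := by
    rw [← KleisliTensor.η_unit, Category.assoc]
    exact (Functor.LaxMonoidal.left_unitality T.toFunctor A).symm
  associativity A B D := by
    rw [← KleisliTensor.η_tensor, comp_whiskerRight, Category.assoc, Category.assoc,
      Functor.LaxMonoidal.associativity, ← tensorHom_id, associator_naturality_assoc]
    congr 1
    rw [tensorHom_id, MonoidalCategory.whiskerLeft_comp, Category.assoc, whisker_exchange_assoc,
      MonoidalCategory.tensorHom_def'_assoc]
    rfl
  t_η A B := by
    rw [← KleisliTensor.η_tensor, MonoidalCategory.tensorHom_def'_assoc]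
    rfl
  t_μ A B := by
    have h : T.μ.app B = 𝟙 _ ≫ T.map (𝟙 _) ≫ T.μ.app B := by simp
    have h' : T.η.app A = T.η.app A ≫ T.map (T.η.app A) ≫ T.μ.app A := by simp
    rw [← MonoidalCategory.tensorHom_def'_assoc, h, h']
    simp only [← tensorHom_id, Functor.map_comp, Category.assoc]
    rw [← Functor.LaxMonoidal.μ_natural_assoc, ← KleisliTensor.μ_tensor]
    simp only [tensorHom_comp_tensorHom_assoc]
    simp

/-- In a closed symmetric monoidal category, `[B, T X]` is a Kleisli exponential of `X` by `B`. -/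
noncomputable def KleisliExponentials.ofClosed {C : Type u} [Category.{v} C] [MonoidalCategory C]
    [SymmetricCategory C] [MonoidalClosed C] (T : Monad C) : KleisliExponentials T where
  expo := MonoidalClosed.internalHom ⋙ (Functor.whiskeringLeft _ _ _).obj T.toFunctor
  equiv A B X := (β_ A B).homFromEquiv.trans ((ihom.adjunction B).homEquiv A (T.obj X))
  natural_left {A A'} B X f g := by
    change MonoidalClosed.curry ((β_ A' B).inv ≫ f ▷ B ≫ g) =
      f ≫ MonoidalClosed.curry ((β_ A B).inv ≫ g)
    rw [← MonoidalClosed.curry_natural_left, ← BraidedCategory.braiding_inv_naturality_right_assoc]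
  natural_middle A {B B'} X f g := by
    change MonoidalClosed.curry ((β_ A B').inv ≫ A ◁ f ≫ g) =
      MonoidalClosed.curry ((β_ A B).inv ≫ g) ≫ (MonoidalClosed.pre f).app (T.obj X)
    rw [MonoidalClosed.curry_pre_app, ← BraidedCategory.braiding_inv_naturality_left_assoc]
  natural_right A B {X X'} f g := by
    change MonoidalClosed.curry ((β_ A B).inv ≫ g ≫ T.map f) =
      MonoidalClosed.curry ((β_ A B).inv ≫ g) ≫ (ihom B).map (T.map f)
    rw [← MonoidalClosed.curry_natural_right, Category.assoc]

/-! ### The comonad `!` -/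

section
open DayLike Functor.LaxMonoidal Functor.OplaxMonoidal

/-- The lax structure of precomposition with `Φ` sends `p ⊗ q` to the restriction of `p ⊗ q`. -/
lemma PrecompData.app_μ {C : Type} [SmallCategory C] [MonoidalCategory C] [SymmetricCategory C]
    {D : Type 1} [Category.{0} D] [MonoidalCategory D] [SymmetricCategory D] [DayLike C D]
    {C' : Type} [SmallCategory C'] [MonoidalCategory C'] [SymmetricCategory C']
    {Φ : C ⥤ C'} [Φ.Braided] {L : D ⥤ PSh C'} {I : PSh C' ⥤ D} (h : PrecompData Φ I)
    (adj : L ⊣ I) {P Q : PSh C'} {a b : C} (p : El (I.obj P) a) (q : El (I.obj Q) b) :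
    letI := h.braided adj
    letI := adj.rightLaxBraided
    h.equiv _ _ (app (μ I P Q) (pair p q)) =
      res (δ Φ a b) (pair (h.equiv _ _ p) (h.equiv _ _ q)) := by
  let _ := h.braided adj
  let _ := adj.rightLaxBraided
  have counit {P : PSh C'} {a : C} (p : El (I.obj P) a) :
      app (adj.counit.app P) (h.ins adj p) = h.equiv _ _ p := by
    have := h.app_homEquiv_symm adj (𝟙 (I.obj P)) p
    rwa [adj.homEquiv_counit, L.map_id, Category.id_comp, app_id] at this
  have e : μ I P Q = adj.homEquiv _ _ (δ L _ _ ≫ (adj.counit.app P ⊗ₘ adj.counit.app Q)) := rfl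
  rw [← h.app_homEquiv_symm adj (μ I P Q) (pair p q), e]
  refine (congrArg (fun k => app k _) (Equiv.symm_apply_apply (adj.homEquiv _ _) _)).trans ?_
  rw [app_comp]
  refine (congrArg _ (h.app_tensoratorInv adj p q)).trans ?_
  rw [app_res, app_tensorHom, counit, counit]

end

namespace PSh
open DayLike
variable {C : Type} [SmallCategory C] [MonoidalCategory C] [SymmetricCategory C]

/-- The tensor unit of presheaves is represented by the tensor unit, hence is terminal with it. -/
noncomputable def isTerminalUnit (h : IsTerminal (𝟙_ C)) : IsTerminal (𝟙_ (PSh C)) :=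
  IsTerminal.ofUniqueHom
    (fun P => homMk (C := C) (fun x _ => res (h.from x) one) fun x y f p => by
      rw [res_res]
      congr 1
      exact h.hom_ext _ _)
    fun P m => DayLike.hom_ext (C := C) fun x p => by
      obtain ⟨f, hf⟩ := exists_one (app m p)
      rw [hf, app_homMk, h.hom_ext f (h.from x)]

end PSh

open Functor.LaxMonoidal CartesianMonoidalCategory in
/-- If the unit of `C` is terminal, a tensor product in `C` has projections. They provide a
retraction of the structure map of a lax monoidal functor to a cartesian category that preserves the
terminal object. -/
lemma CategoryTheory.Functor.LaxMonoidal.μ_comp_lift {B C : Type*} [Category* B] [Category* C]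
    [CartesianMonoidalCategory B] [MonoidalCategory C] (I : C ⥤ B) [I.LaxMonoidal]
    (h : IsTerminal (𝟙_ C)) (k : IsTerminal (I.obj (𝟙_ C))) (P Q : C) :
    μ I P Q ≫ lift (I.map (P ◁ h.from Q ≫ (ρ_ P).hom)) (I.map (h.from P ▷ Q ≫ (λ_ Q).hom)) =
      𝟙 _ := by
  have hε {X : B} (f : X ⟶ I.obj (𝟙_ C)) : f = toUnit X ≫ ε I := k.hom_ext _ _
  ext
  · rw [Category.assoc, lift_fst, I.map_comp, ← μ_natural_right_assoc, hε (I.map _),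
      MonoidalCategory.whiskerLeft_comp, Category.assoc, ← Functor.LaxMonoidal.right_unitality,
      whiskerLeft_toUnit_comp_rightUnitor_hom, Category.id_comp]
  · rw [Category.assoc, lift_snd, I.map_comp, ← μ_natural_left_assoc, hε (I.map _),
      comp_whiskerRight, Category.assoc, ← Functor.LaxMonoidal.left_unitality,
      whiskerRight_toUnit_comp_leftUnitor_hom, Category.id_comp]

namespace Fwm
variable {K : Type}

/-- `Fwm K` is affine: the empty sequence is terminal. -/
instance uniqueHomUnit (V : Fwm K) : Unique (V ⟶ 𝟙_ (Fwm K)) where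
  default := homOf unitElim (fun i => i.elim0) fun i => i.elim0
  uniq f := by
    ext i
    exact i.elim0

/-- There is at most one morphism from the empty sequence. -/
instance subsingletonUnitHom (V : Fwm K) : Subsingleton (𝟙_ (Fwm K) ⟶ V) :=
  ⟨fun f g => hom_ext fun i => (f.map i).elim0⟩

end Fwm

namespace FinFam
variable {C : Type u} [Category.{v} C] [MonoidalCategory C]

/-- If the unit of `C` is terminal, then so is the unit of `C⁺`. -/
def isTerminalUnit [∀ X : C, Unique (X ⟶ 𝟙_ C)] : IsTerminal (𝟙_ (FinFam C)) :=
  IsTerminal.ofUniqueHom (fun X => ⟨fun _ => (), fun _ => default⟩) fun X m =>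
    hom_ext fun _ => Subsingleton.elim _ _

instance : (unitFamily C).Faithful where
  map_injective h := congrArg Hom.map h

lemma full_unitFamily [Subsingleton (𝟙_ C ⟶ 𝟙_ C)] : (unitFamily C).Full where
  map_surjective f := ⟨f.map, hom_ext fun _ => Subsingleton.elim _ _⟩

end FinFam

instance : functorΦ.Faithful := inferInstanceAs (FinFam.unitFamily (Fwm FinSet)).Faithful
instance : functorΦ.Full := FinFam.full_unitFamily

/-- The unit of the left Kan extension along a fully faithful functor is invertible. -/
instance (P : FinSetᵒᵖ ⥤ Type) : IsIso (adjΦ.unit.app P) := by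
  rw [adjΦ, Adjunction.comp_unit_app]
  have : IsIso ((DayFunctor.equiv QValueᵒᵖ Type).symm.toAdjunction.unit.app
    (functorΦ.op.lan.obj P)) :=
    inferInstanceAs (IsIso ((DayFunctor.equiv QValueᵒᵖ Type).symm.unit.app _))
  exact IsIso.comp_isIso' inferInstance (Functor.map_isIso _ _)

/-- A morphism `Φ a ⟶ x ⊗ y` is a pair of morphisms `Φ a ⟶ x` and `Φ a ⟶ y`: the components of
`Φ a` are empty sequences, out of which there is at most one morphism. -/
lemma functorΦ_hom_tensor {a : FinSet} {x y : QValue} (f : functorΦ.obj a ⟶ x ⊗ y) :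
    ∃ (f₁ : functorΦ.obj a ⟶ x) (f₂ : functorΦ.obj a ⟶ y),
      f = functorΦ.map (FinSet.diag a) ≫ Functor.OplaxMonoidal.δ functorΦ a a ≫ (f₁ ⊗ₘ f₂) :=
  ⟨⟨fun i => (f.map i).1, fun i => f.app i ≫ Fwm.fst _ _⟩,
    ⟨fun i => (f.map i).2, fun i => f.app i ≫ Fwm.snd _ _⟩,
    FinFam.hom_ext fun i => Fwm.subsingletonUnitHom _ |>.elim _ _⟩

section
open DayLike Functor.LaxMonoidal

/-- Both units are terminal. -/
lemma isIso_ε_pullbackΦ :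
    letI := adjΦ.rightLaxBraided
    IsIso (ε pullbackΦ) :=
  letI := adjΦ.rightLaxBraided
  have := adjΦ.rightAdjoint_preservesLimits
  isIso_of_isTerminal CartesianMonoidalCategory.isTerminalTensorUnit
    ((PSh.isTerminalUnit FinFam.isTerminalUnit).isTerminalObj pullbackΦ _) _

/-- The structure map is injective because projections split it, and surjective because an element
of `P ⊗ Q` at `Φ a` is the restriction of some `p ⊗ q` along a morphism `Φ a ⟶ x ⊗ y`, hence along a
pair of morphisms `Φ a ⟶ x` and `Φ a ⟶ y`. -/
lemma isIso_μ_pullbackΦ (P Q : PSh QValue) :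
    letI := adjΦ.rightLaxBraided
    IsIso (μ pullbackΦ P Q) := by
  let _ := adjΦ.rightLaxBraided
  have h1 (a : FinSetᵒᵖ) : Function.Bijective ((μ pullbackΦ P Q).app a) := by
    refine ⟨?_, ?_⟩
    · have := adjΦ.rightAdjoint_preservesLimits
      have h := PSh.isTerminalUnit (C := QValue) FinFam.isTerminalUnit
      have : IsSplitMono (μ pullbackΦ P Q) :=
        ⟨⟨⟨_, μ_comp_lift pullbackΦ h (h.isTerminalObj pullbackΦ _) P Q⟩⟩⟩
      exact (mono_iff_injective _).1 inferInstance
    · intro t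
      obtain ⟨x, y, f, p, q, rfl⟩ := exists_pair (C := QValue) (P := P) (Q := Q) t
      obtain ⟨f₁, f₂, rfl⟩ := functorΦ_hom_tensor f
      let p' : El (pullbackΦ.obj P) a.unop :=
        (DayLike.res f₁ p : El (C := QValue) P (functorΦ.obj a.unop))
      let q' : El (pullbackΦ.obj Q) a.unop :=
        (DayLike.res f₂ q : El (C := QValue) Q (functorΦ.obj a.unop))
      let t' : El (pullbackΦ.obj P ⊗ pullbackΦ.obj Q) a.unop :=
        DayLike.res (FinSet.diag a.unop) (DayLike.pair p' q')
      refine ⟨t', ?_⟩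
      refine (app_res (C := FinSet) (μ pullbackΦ P Q) _ _).trans ?_
      refine (congrArg (DayLike.res (P := P ⊗ Q) (functorΦ.map (FinSet.diag a.unop)))
        (precompΦ.app_μ adjΦ p' q')).trans ?_
      refine (congrArg (fun k => DayLike.res (P := P ⊗ Q) (functorΦ.map (FinSet.diag a.unop))
        (DayLike.res (P := P ⊗ Q) (Functor.OplaxMonoidal.δ functorΦ a.unop a.unop) k))
        (pair_res f₁ f₂ p q)).trans ?_
      rw [res_res, res_res]
      rfl
  have (a : FinSetᵒᵖ) : IsIso ((μ pullbackΦ P Q).app a) := (isIso_iff_bijective _).2 (h1 a)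
  exact NatIso.isIso_of_isIso_app _

end

instance : PreservesColimitsOfSize.{0, 0} pullbackΦ :=
  comp_preservesColimits _ _

/-- The comonad of the first adjunction and any symmetric monoidal monad on presheaves over `QValue`
form an abstract model. -/
noncomputable def abstractModel (T : Monad (PSh QValue)) [SymmetricMonoidalMonad T] :
    letI := adjΦ.symmetricMonoidalComonad
    AbstractModel adjΦ.toComonad T :=
  letI := adjΦ.rightLaxBraided
  letI := adjΦ.symmetricMonoidalComonad
  { linearExponential := adjΦ.linearExponentialComonad
    idempotent A := inferInstanceAs (IsIso (lanΦ.map (adjΦ.unit.app (pullbackΦ.obj A))))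
    strong_unit :=
      have := isIso_ε_pullbackΦ
      inferInstanceAs (IsIso (Functor.LaxMonoidal.ε lanΦ ≫
        lanΦ.map (Functor.LaxMonoidal.ε pullbackΦ)))
    strong_tensor A B :=
      have := isIso_μ_pullbackΦ A B
      inferInstanceAs (IsIso (Functor.LaxMonoidal.μ lanΦ _ _ ≫
        lanΦ.map (Functor.LaxMonoidal.μ pullbackΦ A B)))
    strength := SymmetricMonoidalMonad.strength T
    kleisliExponentials := KleisliExponentials.ofClosed T
    affine := PSh.isTerminalUnit FinFam.isTerminalUnit
    hasFiniteCoproducts := inferInstance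
    preservesFiniteCoproducts := by
      have := adjΦ.leftAdjoint_preservesColimits
      have : PreservesColimitsOfSize.{0, 0} (pullbackΦ ⋙ lanΦ) := inferInstance
      exact inferInstanceAs (PreservesFiniteCoproducts (pullbackΦ ⋙ lanΦ)) }

/-! ### The Yoneda embedding is symmetric monoidal -/

namespace PSh
open DayLike Functor.LaxMonoidal
variable {C : Type} [SmallCategory C] [MonoidalCategory C] [SymmetricCategory C]

/-- The elements of a representable presheaf are morphisms. -/
def ofHom {a x : C} : (a ⟶ x) ≃ El (yoneda.obj x) a := Equiv.refl _

lemma res_ofHom {a b x : C} (f : a ⟶ b) (g : b ⟶ x) : res f (ofHom g) = ofHom (f ≫ g) := rfl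

lemma app_yoneda_map {a x y : C} (f : a ⟶ x) (g : x ⟶ y) :
    app (yoneda.map g) (ofHom f) = ofHom (f ≫ g) := rfl

lemma app_yonedaEquiv_symm {P : PSh C} {a x : C} (r : El P x) (f : a ⟶ x) :
    app (yonedaEquiv.symm r) (ofHom f) = res f r := rfl

lemma yoneda_hom_ext {P : PSh C} {x : C} {g h : yoneda.obj x ⟶ P}
    (w : app g (ofHom (𝟙 x)) = app h (ofHom (𝟙 x))) : g = h :=
  yonedaEquiv.injective w

/-- The tensor product of two representable presheaves is generated by the element `𝟙 x ⊗ 𝟙 y`. -/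
lemma yoneda_tensor_hom_ext {P : PSh C} {x y : C} {g h : yoneda.obj x ⊗ yoneda.obj y ⟶ P}
    (w : app g (pair (ofHom (𝟙 x)) (ofHom (𝟙 y))) = app h (pair (ofHom (𝟙 x)) (ofHom (𝟙 y)))) :
    g = h :=
  tensor_hom_ext (C := C) fun a b p q => by
    obtain ⟨p, rfl⟩ := ofHom.surjective p
    obtain ⟨q, rfl⟩ := ofHom.surjective q
    have e : pair (ofHom p) (ofHom q) = res (p ⊗ₘ q) (pair (ofHom (𝟙 x)) (ofHom (𝟙 y))) := by
      rw [← pair_res, res_ofHom, res_ofHom, Category.comp_id, Category.comp_id]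
    rw [e, app_res, app_res, w]

lemma yoneda_tensor_hom_ext₃ {P : PSh C} {x y z : C}
    {g h : (yoneda.obj x ⊗ yoneda.obj y) ⊗ yoneda.obj z ⟶ P}
    (w : app g (pair (pair (ofHom (𝟙 x)) (ofHom (𝟙 y))) (ofHom (𝟙 z))) =
      app h (pair (pair (ofHom (𝟙 x)) (ofHom (𝟙 y))) (ofHom (𝟙 z)))) : g = h := by
  have key : curryRight g (ofHom (𝟙 z)) = curryRight h (ofHom (𝟙 z)) := yoneda_tensor_hom_ext w
  refine tensor_hom_ext (C := C) fun a b p q => ?_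
  obtain ⟨q, rfl⟩ := ofHom.surjective q
  have e : pair p (ofHom q) = res (a ◁ q) (pair p (ofHom (𝟙 z))) := by
    rw [← pair_res_right, res_ofHom, Category.comp_id]
  rw [e, app_res, app_res]
  exact congrArg _ (congrArg (fun k => app k p) key)

/-- The structure map of the Yoneda embedding: it sends `f ⊗ g` to `f ⊗ₘ g`. -/
noncomputable def yonedaTensorHom (x y : C) :
    yoneda.obj x ⊗ yoneda.obj y ⟶ yoneda.obj (x ⊗ y) :=
  desc (C := C) (fun _ _ f g => ofHom (ofHom.symm f ⊗ₘ ofHom.symm g)) fun _ _ _ _ f g p q =>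
    congrArg ofHom (tensorHom_comp_tensorHom f g (ofHom.symm p) (ofHom.symm q)).symm

lemma app_yonedaTensorHom {a b x y : C} (f : a ⟶ x) (g : b ⟶ y) :
    app (yonedaTensorHom x y) (pair (ofHom f) (ofHom g)) = ofHom (f ⊗ₘ g) :=
  app_desc_pair _ _ _ _

/-- The structure isomorphism of the Yoneda embedding. -/
noncomputable def yonedaTensor (x y : C) :
    yoneda.obj x ⊗ yoneda.obj y ≅ yoneda.obj (x ⊗ y) where
  hom := yonedaTensorHom x y
  inv := yonedaEquiv.symm (pair (ofHom (𝟙 x)) (ofHom (𝟙 y)))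
  hom_inv_id := yoneda_tensor_hom_ext (by
    rw [app_comp, app_yonedaTensorHom, id_tensorHom_id, app_yonedaEquiv_symm, app_id, res_id])
  inv_hom_id := yoneda_hom_ext (by
    rw [app_comp, app_yonedaEquiv_symm, app_res, app_yonedaTensorHom, id_tensorHom_id, app_id,
      res_id])

lemma app_yonedaTensor {a b x y : C} (f : a ⟶ x) (g : b ⟶ y) :
    app (yonedaTensor x y).hom (pair (ofHom f) (ofHom g)) = ofHom (f ⊗ₘ g) :=
  app_yonedaTensorHom f g

/-- The tensor unit is represented by the tensor unit. -/
noncomputable def yonedaUnit : 𝟙_ (PSh C) ≅ yoneda.obj (𝟙_ C) where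
  hom := descOne (C := C) (ofHom (𝟙 (𝟙_ C)))
  inv := yonedaEquiv.symm (one : El (𝟙_ (PSh C)) (𝟙_ C))
  hom_inv_id := unit_hom_ext C (by
    rw [app_comp, app_descOne, app_yonedaEquiv_symm, app_id, res_id])
  inv_hom_id := yoneda_hom_ext (by
    rw [app_comp, app_yonedaEquiv_symm, res_id, app_descOne, app_id])

lemma app_yonedaUnit : app (yonedaUnit (C := C)).hom (one : El _ (𝟙_ C)) = ofHom (𝟙 (𝟙_ C)) :=
  app_descOne _

variable (C) in
/-- The Yoneda embedding is strong monoidal. -/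
noncomputable def yonedaCoreMonoidal : (yoneda (C := C)).CoreMonoidal where
  εIso := yonedaUnit
  μIso := yonedaTensor
  μIso_hom_natural_left f y := yoneda_tensor_hom_ext (by
    simp only [app_comp, app_whiskerRight, app_yoneda_map, app_yonedaTensor, tensorHom_id,
      Category.id_comp, id_whiskerRight])
  μIso_hom_natural_right x f := yoneda_tensor_hom_ext (by
    simp only [app_comp, app_whiskerLeft, app_yoneda_map, app_yonedaTensor, id_tensorHom,
      Category.id_comp, whiskerLeft_id])
  associativity x y z := yoneda_tensor_hom_ext₃ (by
    simp only [app_comp, app_whiskerLeft, app_whiskerRight, app_yonedaTensor, app_yoneda_map,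
      app_associator, app_res, id_tensorHom_id, res_ofHom, Category.id_comp, Category.comp_id])
  left_unitality x := tensor_hom_ext (C := C) fun a b p q => by
    obtain ⟨f, rfl⟩ := exists_one p
    obtain ⟨q, rfl⟩ := ofHom.surjective q
    simp only [pair_res_left, app_res, app_comp, app_whiskerRight, app_yonedaUnit, app_leftUnitor,
      app_yonedaTensor, app_yoneda_map, res_ofHom, id_tensorHom, leftUnitor_naturality]
  right_unitality x := tensor_hom_ext (C := C) fun a b p q => by
    obtain ⟨f, rfl⟩ := exists_one q
    obtain ⟨p, rfl⟩ := ofHom.surjective p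
    simp only [pair_res_right, app_res, app_comp, app_whiskerLeft, app_yonedaUnit, app_rightUnitor,
      app_yonedaTensor, app_yoneda_map, res_ofHom, tensorHom_id, rightUnitor_naturality]

noncomputable instance : (yoneda (C := C)).Braided :=
  { (yonedaCoreMonoidal C).toMonoidal with
    braided := fun x y => yoneda_tensor_hom_ext (by
      change app ((yonedaTensor x y).hom ≫ _) _ = app (_ ≫ (yonedaTensor y x).hom) _
      simp only [app_comp, app_yonedaTensor, app_yoneda_map, app_braiding, app_res,
        id_tensorHom_id, res_ofHom, Category.id_comp, Category.comp_id]) }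

end PSh

namespace PrecompData
open DayLike PSh
variable {C : Type} [SmallCategory C] [MonoidalCategory C] [SymmetricCategory C]
  {C' : Type} [SmallCategory C'] [MonoidalCategory C'] [SymmetricCategory C']
  {Φ : C ⥤ C'} {L : PSh C ⥤ PSh C'} {I : PSh C' ⥤ PSh C} (h : PrecompData Φ I) (adj : L ⊣ I)

/-- The map from the left Kan extension of the presheaf represented by `x` to the presheaf
represented by `Φ x`. -/
noncomputable def yonedaHom (x : C) : L.obj (yoneda.obj x) ⟶ yoneda.obj (Φ.obj x) :=
  h.lift adj (fun _ p => ofHom (Φ.map (ofHom.symm p))) fun _ _ f p =>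
    congrArg ofHom (Φ.map_comp f (ofHom.symm p))

lemma app_yonedaHom {a x : C} (f : a ⟶ x) :
    app (h.yonedaHom adj x) (h.ins adj (ofHom f)) = ofHom (Φ.map f) :=
  h.app_lift adj _ _ _

/-- Left Kan extension along `Φ` maps the presheaf represented by `x` to the one represented by
`Φ x`. -/
noncomputable def yonedaIso (x : C) : L.obj (yoneda.obj x) ≅ yoneda.obj (Φ.obj x) where
  hom := h.yonedaHom adj x
  inv := yonedaEquiv.symm (h.ins adj (ofHom (𝟙 x)))
  hom_inv_id := h.hom_ext adj fun a p => by
    obtain ⟨p, rfl⟩ := ofHom.surjective p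
    rw [app_comp, app_yonedaHom, app_yonedaEquiv_symm, ← ins_res, res_ofHom, Category.comp_id,
      app_id]
  inv_hom_id := yoneda_hom_ext (by
    rw [app_comp, app_yonedaEquiv_symm, res_id, app_yonedaHom, app_id, Φ.map_id])

end PrecompData

/-! ### The Kleisli category of a symmetric monoidal adjunction -/

namespace CategoryTheory.Adjunction
variable {C : Type u} [Category.{v} C] {D : Type u'} [Category.{v'} D] {F : C ⥤ D} {G : D ⥤ C}
  (adj : F ⊣ G)

/-- Kleisli composition corresponds to composition of the transposed morphisms. -/
lemma homEquiv_symm_kleisli_comp {X Y Z : C} (f : X ⟶ G.obj (F.obj Y)) (g : Y ⟶ G.obj (F.obj Z)) :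
    (adj.homEquiv X (F.obj Z)).symm (f ≫ G.map (F.map g) ≫ G.map (adj.counit.app (F.obj Z))) =
      (adj.homEquiv X (F.obj Y)).symm f ≫ (adj.homEquiv Y (F.obj Z)).symm g := by
  rw [Equiv.symm_apply_eq, adj.homEquiv_naturality_right, Equiv.apply_symm_apply,
    adj.homEquiv_counit, G.map_comp]

/-- The comparison functor from the Kleisli category of the monad of an adjunction. -/
def kleisliComparison : Kleisli adj.toMonad ⥤ D where
  obj X := F.obj X.of
  map {X Y} f := (adj.homEquiv X.of (F.obj Y.of)).symm f.of
  map_id X := (Equiv.symm_apply_eq _).2 (adj.homEquiv_id _).symm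
  map_comp f g := adj.homEquiv_symm_kleisli_comp f.of g.of

/-- The comparison functor is fully faithful. -/
def fullyFaithfulKleisliComparison : adj.kleisliComparison.FullyFaithful where
  preimage {X Y} f := .mk (adj.homEquiv X.of (F.obj Y.of) f)
  map_preimage {X Y} f := (adj.homEquiv X.of (F.obj Y.of)).symm_apply_apply f
  preimage_map {X Y} f := Kleisli.Hom.ext ((adj.homEquiv X.of (F.obj Y.of)).apply_symm_apply f.of)

instance : adj.kleisliComparison.Full := adj.fullyFaithfulKleisliComparison.full
instance : adj.kleisliComparison.Faithful := adj.fullyFaithfulKleisliComparison.faithful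

variable [MonoidalCategory C] [SymmetricCategory C] [MonoidalCategory D] [SymmetricCategory D]
  [F.Braided]

attribute [local instance] symmetricMonoidalMonad

open KleisliTensor Functor.LaxMonoidal Functor.OplaxMonoidal

/-- On a morphism without effect, that is, one composed with the unit of the monad, the comparison
functor is `F`. -/
lemma kleisliComparison_map_pure {X Y : C} (f : X ⟶ Y) :
    adj.kleisliComparison.map (pure adj.toMonad f) = F.map f := by
  change (adj.homEquiv X (F.obj Y)).symm (f ≫ adj.unit.app Y) = _
  rw [adj.homEquiv_naturality_left_symm, ← adj.homEquiv_id, Equiv.symm_apply_apply,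
    Category.comp_id]

/-- The comparison functor maps `f ⊗ g` to the tensor product of the images of `f` and `g`. -/
lemma kleisliComparison_map_tensor {X X' Y Y' : C} (f : X ⟶ G.obj (F.obj X'))
    (g : Y ⟶ G.obj (F.obj Y')) :
    letI := adj.rightLaxBraided
    μ F X Y ≫ (adj.homEquiv _ _).symm ((f ⊗ₘ g) ≫ μ G _ _ ≫ G.map (μ F X' Y')) =
      ((adj.homEquiv _ _).symm f ⊗ₘ (adj.homEquiv _ _).symm g) ≫ μ F X' Y' := by
  let _ := adj.rightLaxBraided
  have : adj.IsMonoidal := inferInstance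
  have h : F.map (G.map (μ F X' Y')) ≫ adj.counit.app _ = adj.counit.app _ ≫ μ F X' Y' :=
    adj.counit_naturality _
  have h' := adj.map_μ_comp_counit_app_tensor (F.obj X') (F.obj Y')
  have e (u : X ⊗ Y ⟶ G.obj (F.obj (X' ⊗ Y'))) :
    (adj.homEquiv _ _).symm u = F.map u ≫ adj.counit.app _ := adj.homEquiv_counit _ _ _
  rw [e, F.map_comp, F.map_comp, Category.assoc, Category.assoc, h, reassoc_of% h',
    ← μ_natural_assoc, Functor.Monoidal.μ_δ_assoc, tensorHom_comp_tensorHom_assoc,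
    ← adj.homEquiv_counit, ← adj.homEquiv_counit]

lemma kleisliComparison_map_whiskerRight {X X' : C} (f : X ⟶ G.obj (F.obj X')) (Y : C) :
    letI := adj.rightLaxBraided
    (adj.homEquiv _ _).symm f ▷ F.obj Y ≫ μ F X' Y = μ F X Y ≫
      (adj.homEquiv _ _).symm ((f ⊗ₘ adj.unit.app Y) ≫ μ G _ _ ≫ G.map (μ F X' Y)) :=
  ((adj.kleisliComparison_map_tensor f (adj.unit.app Y)).trans (by
    erw [adj.homEquiv_symm_unit, tensorHom_id]
    rfl)).symm

lemma kleisliComparison_map_whiskerLeft {X X' : C} (f : X ⟶ G.obj (F.obj X')) (Y : C) :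
    letI := adj.rightLaxBraided
    F.obj Y ◁ (adj.homEquiv _ _).symm f ≫ μ F Y X' = μ F Y X ≫
      (adj.homEquiv _ _).symm ((adj.unit.app Y ⊗ₘ f) ≫ μ G _ _ ≫ G.map (μ F Y X')) :=
  ((adj.kleisliComparison_map_tensor (adj.unit.app Y) f).trans (by
    erw [adj.homEquiv_symm_unit, id_tensorHom]
    rfl)).symm

/-- The comparison functor is strong monoidal. -/
def kleisliComparisonCoreMonoidal : adj.kleisliComparison.CoreMonoidal where
  εIso := Functor.Monoidal.εIso F
  μIso X Y := Functor.Monoidal.μIso F X.of Y.of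
  μIso_hom_natural_left f Z := adj.kleisliComparison_map_whiskerRight f.of Z.of
  μIso_hom_natural_right Z f := adj.kleisliComparison_map_whiskerLeft f.of Z.of
  associativity X Y Z := (congrArg (fun k => _ ≫ _ ≫ k) (adj.kleisliComparison_map_pure _)).trans
    (Functor.LaxMonoidal.associativity F X.of Y.of Z.of)
  left_unitality X := (Functor.LaxMonoidal.left_unitality F X.of).trans
    (congrArg (fun k => _ ≫ _ ≫ k) (adj.kleisliComparison_map_pure _).symm)
  right_unitality X := (Functor.LaxMonoidal.right_unitality F X.of).trans
    (congrArg (fun k => _ ≫ _ ≫ k) (adj.kleisliComparison_map_pure _).symm)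

instance : adj.kleisliComparison.Braided :=
  { adj.kleisliComparisonCoreMonoidal.toMonoidal with
    braided := fun X Y => (congrArg (fun k => _ ≫ k) (adj.kleisliComparison_map_pure _)).trans
      (Functor.LaxBraided.braided (F := F) X.of Y.of) }

end CategoryTheory.Adjunction

namespace CategoryTheory.Functor
open Functor.LaxMonoidal Functor.OplaxMonoidal
variable {A : Type*} [Category* A] [MonoidalCategory A] [SymmetricCategory A]
  {B : Type*} [Category* B] [MonoidalCategory B] [SymmetricCategory B]
  {D : Type*} [Category* D] [MonoidalCategory D] [SymmetricCategory D]

/-- A functor is strong symmetric monoidal if its composite with a fully faithful strong symmetric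
monoidal functor is. -/
@[reducible]
noncomputable def Braided.ofCompFullyFaithful (E : A ⥤ B) (K : B ⥤ D) [K.Braided] [K.Full]
    [K.Faithful] [(E ⋙ K).Braided] : E.Braided :=
  letI m : E.CoreMonoidal :=
  { εIso := K.preimageIso ((Monoidal.εIso K).symm ≪≫ Monoidal.εIso (E ⋙ K))
    μIso X Y := K.preimageIso ((Monoidal.μIso K _ _).symm ≪≫ Monoidal.μIso (E ⋙ K) X Y)
    μIso_hom_natural_left f Y := K.map_injective (by
      have := μ_natural_left (E ⋙ K) f Y
      simp only [Functor.comp_map] at this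
      simp [← δ_natural_left_assoc, ← this])
    μIso_hom_natural_right X f := K.map_injective (by
      have := μ_natural_right (E ⋙ K) X f
      simp only [Functor.comp_map] at this
      simp [← δ_natural_right_assoc, ← this])
    associativity X Y Z := K.map_injective (by
      have := Functor.LaxMonoidal.associativity (E ⋙ K) X Y Z
      simp only [Functor.comp_map, Functor.comp_obj] at this
      simp [Functor.Monoidal.map_whiskerRight, Functor.Monoidal.map_whiskerLeft, this,
        Functor.OplaxMonoidal.associativity_assoc])
    left_unitality X := K.map_injective (by
      have := Functor.LaxMonoidal.left_unitality (E ⋙ K) X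
      simp only [Functor.comp_map, Functor.comp_obj] at this
      simp only [Functor.map_comp, Functor.preimageIso_hom, Functor.map_preimage, Iso.trans_hom,
        Iso.symm_hom, Category.assoc, Functor.Monoidal.εIso_inv, Functor.Monoidal.εIso_hom,
        Functor.Monoidal.μIso_inv, Functor.Monoidal.μIso_hom, ← δ_natural_left_assoc,
        comp_whiskerRight, ← this, Functor.OplaxMonoidal.left_unitality_hom])
    right_unitality X := K.map_injective (by
      have := Functor.LaxMonoidal.right_unitality (E ⋙ K) X
      simp only [Functor.comp_map, Functor.comp_obj] at this
      simp only [Functor.map_comp, Functor.preimageIso_hom, Functor.map_preimage, Iso.trans_hom,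
        Iso.symm_hom, Category.assoc, Functor.Monoidal.εIso_inv, Functor.Monoidal.εIso_hom,
        Functor.Monoidal.μIso_inv, Functor.Monoidal.μIso_hom, ← δ_natural_right_assoc,
        MonoidalCategory.whiskerLeft_comp, ← this,
        Functor.OplaxMonoidal.right_unitality_hom]) }
  { m.toMonoidal with
    braided := fun X Y => K.map_injective (by
      have := Functor.LaxBraided.braided (F := E ⋙ K) X Y
      simp only [Functor.comp_map] at this
      change K.map (K.preimage _ ≫ _) = K.map (_ ≫ K.preimage _)
      simp [Functor.map_braiding, this]) }

/-- A strong symmetric monoidal structure can be transported along a natural isomorphism. -/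
@[reducible]
def Braided.transport {F G : A ⥤ B} [F.Braided] (i : F ≅ G) : G.Braided :=
  { Monoidal.transport i with
    braided := fun X Y => by
      change ((i.inv.app X ⊗ₘ i.inv.app Y) ≫ μ F X Y ≫ i.hom.app (X ⊗ Y)) ≫ _ =
        _ ≫ (i.inv.app Y ⊗ₘ i.inv.app X) ≫ μ F Y X ≫ i.hom.app (Y ⊗ X)
      simp only [Category.assoc]
      rw [← i.hom.naturality, Functor.LaxBraided.braided_assoc,
        BraidedCategory.braiding_naturality_assoc] }

end CategoryTheory.Functor

/-! ### The embedding of `Q` into the Kleisli category -/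

namespace ContPSh

/-- The Yoneda embedding of `Q` into the presheaves that preserve finite products. -/
def yoneda : Superop ⥤ ContPSh :=
  productPreserving.lift PSh.yoneda fun H =>
    inferInstanceAs (PreservesFiniteProducts (CategoryTheory.yoneda.obj H))

instance : yoneda.Full :=
  .of_comp_faithful_iso (G := productPreserving.ι) (H := PSh.yoneda) (Iso.refl _)
instance : yoneda.Faithful := .of_comp_iso (G := productPreserving.ι) (H := PSh.yoneda) (Iso.refl _)

/-- Representable presheaves preserve products, so that they agree with their reflections. -/
noncomputable def yonedaCompRefl : PSh.yoneda ⋙ refl ≅ yoneda :=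
  Functor.isoWhiskerLeft yoneda (asIso adj.counit)

noncomputable instance : yoneda.Braided := .transport yonedaCompRefl

/-- The Yoneda lemma, as a natural isomorphism. -/
def yonedaLemma (P : ContPSh) : yoneda.op ⋙ CategoryTheory.yoneda.obj P ≅ P.obj.functor :=
  NatIso.ofComponents
    (fun H => (productPreserving.fullyFaithfulι.homEquiv.trans PSh.yonedaEquiv).toIso)
    fun f => by
      ext g
      exact (PSh.map_yonedaEquiv f.unop g.hom).symm

/-- A presheaf that preserves finite products turns coproducts of `Q` into products, so that
coproducts of `Q` have the universal property of coproducts in `ContPSh`. -/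
instance : PreservesFiniteCoproducts yoneda := ⟨fun n => ⟨fun {K} => ⟨fun {c} hc =>
  ⟨(yoneda.mapCocone c).isColimitYonedaEquiv.symm fun P => by
    have : PreservesFiniteProducts P.obj.functor := P.property
    have : PreservesLimitsOfShape (Discrete (Fin n))ᵒᵖ P.obj.functor :=
      preservesLimitsOfShape_of_equiv (Discrete.opposite (Fin n)).symm P.obj.functor
    exact IsLimit.mapConeEquiv (yonedaLemma P).symm (isLimitOfPreserves P.obj.functor hc.op)⟩⟩⟩⟩

end ContPSh

namespace Superop

/-- The object of `Q''` that consists of the one-element sequences `(V_j)`. -/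
def singletons (H : Superop) : QValue := ⟨H.index, fun j => ⟨1, fun _ => H.space j⟩⟩

/-- Every object of `Q` is a value of `Ψ`. -/
def functorΨSingletons (H : Superop) : functorΨ.obj H.singletons ≅ H :=
  ofIso (H := functorΨ.obj H.singletons) (FinFam.isoOfIndex fun j => SimpleSuperop.relabelIso
    (H := Fwm.toSuperop.obj (H.singletons.obj j)) (K := ⟨H.space j⟩)
    (Equiv.funUnique (Fin 1) (H.space j)))

end Superop

namespace ContPSh

/-- The left adjoint of the second adjunction maps representable presheaves to representable
presheaves. -/
noncomputable def reflLanΨIso (x : QValue) :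
    (lanΨ ⋙ refl).obj (PSh.yoneda.obj x) ≅ yoneda.obj (functorΨ.obj x) :=
  refl.mapIso (precompΨ.yonedaIso adjΨ x) ≪≫ yonedaCompRefl.app _

/-- The representable presheaves are in the image of the Kleisli category. -/
noncomputable def comparisonIso (H : Superop) : (adjΨ.comp adj).kleisliComparison.obj
    (.mk _ (PSh.yoneda.obj H.singletons)) ≅ yoneda.obj H :=
  reflLanΨIso H.singletons ≪≫ yoneda.mapIso H.functorΨSingletons

/-- The embedding of `Q` into the Kleisli category, which is a full subcategory of `ContPSh` that
contains the representable presheaves. -/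
noncomputable def embedding : Superop ⥤ Kleisli (adjΨ.comp adj).toMonad where
  obj H := .mk _ (PSh.yoneda.obj H.singletons)
  map {H K} f := (adjΨ.comp adj).fullyFaithfulKleisliComparison.preimage
    ((comparisonIso H).hom ≫ yoneda.map f ≫ (comparisonIso K).inv)
  map_id H := (adjΨ.comp adj).fullyFaithfulKleisliComparison.map_injective (by simp)
  map_comp f g := (adjΨ.comp adj).fullyFaithfulKleisliComparison.map_injective (by simp)

/-- In `ContPSh`, the embedding is the Yoneda embedding. -/
noncomputable def embeddingComp :
    embedding ⋙ (adjΨ.comp adj).kleisliComparison ≅ yoneda :=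
  NatIso.ofComponents (fun H => comparisonIso H) fun f => by
    simp [embedding]

instance : embedding.Full := .of_comp_faithful_iso embeddingComp
instance : embedding.Faithful := .of_comp_iso embeddingComp

noncomputable instance : SymmetricMonoidalMonad (adjΨ.comp adj).toMonad :=
  (adjΨ.comp adj).symmetricMonoidalMonad

/-- The comparison functor is fully faithful, so that it reflects the structure of `yoneda`. -/
noncomputable instance : embedding.Braided :=
  letI : (embedding ⋙ (adjΨ.comp adj).kleisliComparison).Braided := .transport embeddingComp.symm
  .ofCompFullyFaithful embedding (adjΨ.comp adj).kleisliComparison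

instance : PreservesFiniteCoproducts embedding := ⟨fun n => by
  have : PreservesColimitsOfShape (Discrete (Fin n))
    (embedding ⋙ (adjΨ.comp adj).kleisliComparison) :=
    preservesColimitsOfShape_of_natIso embeddingComp.symm
  exact preservesColimitsOfShape_of_reflects_of_preserves embedding
    (adjΨ.comp adj).kleisliComparison⟩

/-- The two adjunctions form a concrete model. -/
noncomputable def model : AdjunctionModel Superop adjΦ (adjΨ.comp adj) :=
  letI := adjΦ.symmetricMonoidalComonad
  { abstractModel (adjΨ.comp adj).toMonad with
    strength_eq := fun _ _ => rfl
    embedding := embedding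
    full := inferInstance
    faithful := inferInstance
    preservesTensor := inferInstance
    preservesCoproducts := inferInstance }

end ContPSh

theorem mainTheorem4 :
    ∃ (R : PSh Superop ⥤ ContPSh) (adjR : R ⊣ productPreserving.ι)
      (_ : MonoidalCategory ContPSh) (_ : SymmetricCategory ContPSh)
      (_ : R.Braided) (_ : lanΦ.Braided) (_ : lanΨ.Braided),
      Nonempty (MonoidalClosed (PSh QValue)) ∧ Nonempty (MonoidalClosed ContPSh) ∧
      Nonempty (AdjunctionModel Superop adjΦ (adjΨ.comp adjR)) :=
  ⟨ContPSh.refl, ContPSh.adj, inferInstance, inferInstance, inferInstance, inferInstance,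
    inferInstance, ⟨inferInstance⟩, ⟨inferInstance⟩, ⟨ContPSh.model⟩⟩
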